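/- Throughout, $p>2$ is prime, $n,m\ge 1$, matrices are over $\mathbb F_p$, vectors are row vectors, $\log=\log_2$, and $\langle\cdot\rangle$ is linear span. **Tensors.** For $\mathbf G\in\mathbb F_p^{m\times n\times n}$ let $X_{\mathbf G,i}\in M(n,n)$ and $Y_{\mathbf G,j}\in M(m,n)$ be given by $X_{\mathbf G,i}[j,k]=Y_{\mathbf G,j}[i,k]=\mathbf G[i,j,k]$, and let $X_{\mathbf G}$, $Y_{\mathbf G}$ be the spans of the $X_{\mathbf G,i}$ and of the $Y_{\mathbf G,j}$. $\mathbf G$ is a *skew-symmetric matrix space tensor* if $X_{\mathbf G}$ is an $m$-dimensional space of skew-symmetric matrices. For $N\in \mathrm{GL}(n,\mathbb F_p)$, $M\in \mathrm{GL}(m,\mathbb F_p)$ let $\mathrm{Trans}_{N,M}(\mathbf G)$ be the tensor $\mathbf H$ with $X_{\mathbf H,i}=\sum_{i'}M[i,i']\,N X_{\mathbf G,i'}N^T$. Two such tensors $\mathbf G,\mathbf H$ are *isometric* if $\mathrm{Trans}_{N,M}(\mathbf G)=\mathbf H$ for some $N,M$. **Matrix spaces.** For a matrix space $\mathcal A\le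 M(m,n)$ and matrices $L,R$ put $\mathrm{zero}_{L,R}(\mathcal A)=\{A\in\mathcal A: LAR=0\}$. A tuple $(A_1,\dots,A_d)$, $d=\dim\mathcal A$, is a *semi-canonical basis* of $\mathcal A$ with respect to $L,R$ if it spans $\mathcal A$ and, for each $i$, $LA_iR\preceq LAR$ for all $A\in\mathcal A\setminus\langle A_1,\dots,A_{i-1}\rangle$, where $\preceq$ is the row-by-row lexicographic order with $0<1<\dots<p-1$. For a finite linearly independent set $\Lambda\subset\mathbb F_p^n$ put $\ker(\mathcal A,\Lambda)=\{v\in\mathbb F_p^m: vA\in\langle\Lambda\rangle\ \forall A\in\mathcal A\}$ and, for a space $\mathcal A$ of skew-symmetric matrices, $\ker_{\rm skew}(\mathcal A,\Lambda)=\{v\in\ker(\mathcal A,\Lambda): xv^T=0\ \forall x\in\Lambda\}$. **Characterization tuples.** A characterization tuple for a skew-symmetric matrix space tensor $\mathbf G$ is $(L_{\rm s},L,\Lambda,C_{\rm s},C)$ where $L_{\rm s}$ has $n$ columns and $L$ has $m$ columns (each with at least one row), $\Lambda\subset\mathbb F_p^n$ is linearly independent, and, with $K_Y=\ker(\mathrm{zero}_{L,L_{\rm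 s}^T}(Y_{\mathbf G}),\Lambda)$ and $K_X=\ker_{\rm skew}(\mathrm{zero}_{L_{\rm s},L_{\rm s}^T}(X_{\mathbf G}),\Lambda)$: the rows of $C$ form a basis of a complement of $K_Y$ in $\mathbb F_p^m$; the rows of $C_{\rm s}$ form a basis of a complement of $K_X$ in $\mathbb F_p^n$, and all rows of $C_{\rm s}$ except the last $|\Lambda|$ are orthogonal to $\Lambda$. **Semi-canonical forms.** Let $\mathcal X=\{\sum_i v[i]X_{\mathbf G,i}:v\in K_Y\}$, $\mathcal Y=\{\sum_j v[j]Y_{\mathbf G,j}:v\in K_X\}$, and $\alpha_X=\dim \mathrm{zero}_{L_{\rm s},L_{\rm s}^T}(\mathcal X)$, $\beta_X=\dim L_{\rm s}\mathcal X L_{\rm s}^T$, $\alpha_Y=\dim \mathrm{zero}_{L,L_{\rm s}^T}(\mathcal Y)$, $\beta_Y=\dim L\mathcal Y L_{\rm s}^T$. A semi-canonical form of $\mathbf G$ with respect to the tuple, with parameters $\alpha_X,\beta_X,\alpha_Y,\beta_Y$, is a tensor $\mathrm{Trans}_{N,M}(\mathbf G)$ with $N\in\mathrm{GL}(n,\mathbb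 F_p)$, $M\in\mathrm{GL}(m,\mathbb F_p)$ such that 1. the first $\dim K_X$ rows of $N$ form a basis of $K_X$, its remaining rows are the rows of $C_{\rm s}$ in order, and $\big(Y_{\mathrm{Trans}_{N,I_m}(\mathbf G),j}(N^T)^{-1}\big)_{1\le j\le\alpha_Y+\beta_Y}$ is a semi-canonical basis of $\mathcal Y$ with respect to $L,L_{\rm s}^T$; 2. the first $\dim K_Y$ rows of $M$ form a basis of $K_Y$, its remaining rows are the rows of $C$ in order, and $\big(X_{\mathrm{Trans}_{I_n,M}(\mathbf G),i}\big)_{1\le i\le\alpha_X+\beta_X}$ is a semi-canonical basis of $\mathcal X$ with respect to $L_{\rm s},L_{\rm s}^T$. Two semi-canonical forms $\mathbf S,\mathbf S'\in\mathbb F_p^{m\times n\times n}$ (of possibly different tensors) are *isometric* if they have the same parameters and $\mathrm{Trans}_{N,M}(\mathbf S)=\mathbf S'$ for some invertible $$M=\begin{pmatrix}X&0&0\\Y&I_{\beta_X}&0\\0&0&I\end{pmatrix},\qquad N=\begin{pmatrix}X'&0&0\\Y'&I_{\beta_Y}&0\\0&0&I\end{pmatrix},\qquad X\in\mathrm{GL}(\alpha_X,\mathbb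 F_p),\ X'\in\mathrm{GL}(\alpha_Y,\mathbb F_p).$$ **Algorithms.** An algorithm is a single program (for all $p,n,m$) in a unit-cost language over binary trees with the operations leaf, left and right subtree, pairing, composition, branching and while-loops. Its input consists of $p,n,m$ and two tensors, given as nested lists of numbers in unary; for semi-canonical forms also their parameters. **Statement.** There are absolute constants $c,k$ such that, for every function $T(p,n,m)$: if there is an algorithm that decides, for all $p,n,m$, in at most $T(p,n,m)$ steps whether two given semi-canonical forms of skew-symmetric matrix space tensors in $\mathbb F_p^{m\times n\times n}$ are isometric, then there is an algorithm that decides, for all $p,n,m$, whether two given skew-symmetric matrix space tensors in $\mathbb F_p^{m\times n\times n}$ are isometric, in at most $$p^{\,c\,(m+n)\,n^{0.8}\log p}\cdot T(p,n,m)\cdot (p+n+m)^{k}$$ steps. -/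

import Mathlib

namespace TensorIso

open scoped Matrix

/-! ### Machine model: programs over binary trees with unit cost

Data are finite binary trees.  A program transforms one tree; its basic operations are the leaf, the
two projections and pairing (which only copies pointers), and it is built with composition, branching
and unbounded loops.  Every basic operation, every composition and every test costs one step.
A program is a finite object, independent of the sizes of its inputs. -/

/-- Binary trees, the data of the machine. -/
inductive BTree : Type
  | nil : BTree
  | node : BTree → BTree → BTree

/-- Programs. -/
inductive Prog : Type
  | id : Prog
  | nil : Prog
  | fst : Prog
  | snd : Prog
  | pair : Prog → Prog → Prog
  | comp : Prog → Prog → Prog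
  | ite : Prog → Prog → Prog → Prog
  | loop : Prog → Prog → Prog

/-- `Runs P x y t`: started on the tree `x`, the program `P` halts with result `y` after exactly
`t` steps.  `comp Q P` runs `P` first, `ite c P Q` runs `P` if the result of `c` is not `nil` and
`Q` otherwise, `loop c P` repeats `P` as long as the result of `c` is not `nil`. -/
inductive Runs : Prog → BTree → BTree → ℕ → Prop
  | id (x : BTree) : Runs Prog.id x x 1
  | nil (x : BTree) : Runs Prog.nil x BTree.nil 1
  | fst_nil : Runs Prog.fst BTree.nil BTree.nil 1
  | fst_node (a b : BTree) : Runs Prog.fst (BTree.node a b) a 1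
  | snd_nil : Runs Prog.snd BTree.nil BTree.nil 1
  | snd_node (a b : BTree) : Runs Prog.snd (BTree.node a b) b 1
  | pair {P Q : Prog} {x a b : BTree} {s t : ℕ} :
      Runs P x a s → Runs Q x b t → Runs (Prog.pair P Q) x (BTree.node a b) (s + t + 1)
  | comp {P Q : Prog} {x y z : BTree} {s t : ℕ} :
      Runs P x y s → Runs Q y z t → Runs (Prog.comp Q P) x z (s + t + 1)
  | ite_true {c P Q : Prog} {x a b y : BTree} {s t : ℕ} :
      Runs c x (BTree.node a b) s → Runs P x y t → Runs (Prog.ite c P Q) x y (s + t + 1)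
  | ite_false {c P Q : Prog} {x y : BTree} {s t : ℕ} :
      Runs c x BTree.nil s → Runs Q x y t → Runs (Prog.ite c P Q) x y (s + t + 1)
  | loop_done {c P : Prog} {x : BTree} {s : ℕ} :
      Runs c x BTree.nil s → Runs (Prog.loop c P) x x (s + 1)
  | loop_step {c P : Prog} {x a b y z : BTree} {s t u : ℕ} :
      Runs c x (BTree.node a b) s → Runs P x y t → Runs (Prog.loop c P) y z u →
        Runs (Prog.loop c P) x z (s + t + u + 1)

/-- `P` answers the yes/no question `q` correctly on input `x` within `T` steps; the answer is "no"
if the result is `nil` and "yes" otherwise. -/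
def AnswersWithin (P : Prog) (x : BTree) (q : Prop) (T : ℝ) : Prop :=
  ∃ (y : BTree) (t : ℕ), Runs P x y t ∧ (t : ℝ) ≤ T ∧ (y ≠ BTree.nil ↔ q)

/-! ### Matrix spaces -/

/-- Vectors of length `n` over `𝔽_p`. -/
abbrev Vec (p n : ℕ) : Type := Fin n → ZMod p

/-- `m × n` matrices over `𝔽_p`. -/
abbrev Mat (p m n : ℕ) : Type := Matrix (Fin m) (Fin n) (ZMod p)

/-- `m × n` matrix spaces over `𝔽_p`. -/
abbrev MatSpace (p m n : ℕ) : Type := Submodule (ZMod p) (Mat p m n)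

/-- Lexicographic order of matrices, read row by row, with `𝔽_p` ordered as `0 < 1 < ⋯ < p - 1`. -/
def LexLT {p m n : ℕ} (A B : Mat p m n) : Prop :=
  ∃ (q : Fin m) (r : Fin n),
    (∀ i j, (i < q ∨ (i = q ∧ j < r)) → A i j = B i j) ∧ (A q r).val < (B q r).val

def LexLE {p m n : ℕ} (A B : Mat p m n) : Prop := LexLT A B ∨ A = B

/-- The linear map `A ↦ L A R`. -/
def sandwich {p a m n b : ℕ} (L : Mat p a m) (R : Mat p n b) : Mat p m n →ₗ[ZMod p] Mat p a b where
  toFun A := L * A * R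
  map_add' A B := by rw [Matrix.mul_add, Matrix.add_mul]
  map_smul' c A := by rw [Matrix.mul_smul, Matrix.smul_mul, RingHom.id_apply]

/-- The space of all `A ∈ 𝒜` with `L A R = 0`. -/
def zeroSpace {p a m n b : ℕ} (L : Mat p a m) (R : Mat p n b) (𝒜 : MatSpace p m n) :
    MatSpace p m n :=
  𝒜 ⊓ LinearMap.ker (sandwich L R)

/-- `A` is a semi-canonical basis of `𝒜` with respect to the individualization matrices
`L` and `R`. -/
def IsSemiCanonicalBasis {p a m n b d : ℕ} (L : Mat p a m) (R : Mat p n b) (𝒜 : MatSpace p m n)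
    (A : Fin d → Mat p m n) : Prop :=
  Module.finrank (ZMod p) 𝒜 = d ∧
  Submodule.span (ZMod p) (Set.range A) = 𝒜 ∧
  ∀ i : Fin d, ∀ B ∈ 𝒜, B ∉ Submodule.span (ZMod p) (A '' {j | j < i}) →
    LexLE (L * A i * R) (L * B * R)

/-- An attribute set: a (finite) set of linearly independent vectors. -/
def IsAttributeSet {p n : ℕ} (Λ : Finset (Vec p n)) : Prop :=
  LinearIndependent (ZMod p) (fun x : Λ => (x : Vec p n))

/-- The kernel `ker(𝒜, Λ)`: all `v` with `v A ∈ ⟨Λ⟩` for every `A ∈ 𝒜`. -/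
def ker {p m n : ℕ} (𝒜 : MatSpace p m n) (Λ : Finset (Vec p n)) :
    Submodule (ZMod p) (Vec p m) where
  carrier := {v | ∀ A ∈ 𝒜, v ᵥ* A ∈ Submodule.span (ZMod p) (Λ : Set (Vec p n))}
  add_mem' := by
    intro v w hv hw A hA
    rw [Matrix.add_vecMul]
    exact Submodule.add_mem _ (hv A hA) (hw A hA)
  zero_mem' := by
    intro A _
    rw [Matrix.zero_vecMul]
    exact Submodule.zero_mem _
  smul_mem' := by
    intro c v hv A hA
    rw [Matrix.smul_vecMul]
    exact Submodule.smul_mem _ c (hv A hA)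

/-- The vectors orthogonal to all elements of `Λ`. -/
def orth {p n : ℕ} (Λ : Finset (Vec p n)) : Submodule (ZMod p) (Vec p n) where
  carrier := {v | ∀ x ∈ Λ, x ⬝ᵥ v = 0}
  add_mem' := by
    intro v w hv hw x hx
    rw [dotProduct_add, hv x hx, hw x hx, add_zero]
  zero_mem' := by
    intro x _
    exact dotProduct_zero x
  smul_mem' := by
    intro c v hv x hx
    rw [dotProduct_smul, hv x hx, smul_zero]

/-- The kernel `ker_skew(𝒜, Λ)` of a skew-symmetric matrix space. -/
def kerSkew {p n : ℕ} (𝒜 : MatSpace p n n) (Λ : Finset (Vec p n)) :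
    Submodule (ZMod p) (Vec p n) :=
  orth Λ ⊓ ker 𝒜 Λ

/-- The rows of `C` are a basis of a complement of `K`. -/
def IsComplement {p m c : ℕ} (K : Submodule (ZMod p) (Vec p m)) (C : Mat p c m) : Prop :=
  c = m - Module.finrank (ZMod p) K ∧
  LinearIndependent (ZMod p) (fun i : Fin c => C i) ∧
  K ⊓ Submodule.span (ZMod p) (Set.range fun i : Fin c => C i) = ⊥

/-- Complementary matrices of a matrix space and an attribute set. -/
def IsComplementary {p m n c : ℕ} (𝒜 : MatSpace p m n) (Λ : Finset (Vec p n))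
    (C : Mat p c m) : Prop :=
  IsComplement (ker 𝒜 Λ) C

/-- Complementary matrices of a skew-symmetric matrix space and an attribute set: moreover all
rows but the last `|Λ|` are orthogonal to `Λ`. -/
def IsComplementarySkew {p n c : ℕ} (𝒜 : MatSpace p n n) (Λ : Finset (Vec p n))
    (C : Mat p c n) : Prop :=
  IsComplement (kerSkew 𝒜 Λ) C ∧
  ∀ i : Fin c, (i : ℕ) + Λ.card < c → ∀ x ∈ Λ, x ⬝ᵥ C i = 0

/-- The first `dim K` rows of the invertible matrix `P` form a basis of `K`, and the remaining rows
of `P` are the rows of `C`.  For `K = ker(𝒜, Λ)` these are the left formatting matrices, and for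
`K = ker_skew(𝒜, Λ)` the formatting matrices of a skew-symmetric matrix space. -/
def IsFormatting {p m c : ℕ} (K : Submodule (ZMod p) (Vec p m)) (C : Mat p c m)
    (P : GL (Fin m) (ZMod p)) : Prop :=
  Submodule.span (ZMod p)
    {v | ∃ i : Fin m, (i : ℕ) < Module.finrank (ZMod p) K ∧ v = (P : Mat p m m) i} = K ∧
  ∀ (i : Fin m) (k : Fin c), (i : ℕ) = Module.finrank (ZMod p) K + k →
    (P : Mat p m m) i = C k

/-! ### Tensors -/

/-- Tensors in `𝔽_p^{m × n × n}`. -/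
abbrev Tensor (p m n : ℕ) : Type := Fin m → Fin n → Fin n → ZMod p

/-- The `n × n` matrix `X_{G,i}`. -/
def sliceX {p m n : ℕ} (G : Tensor p m n) (i : Fin m) : Mat p n n := Matrix.of fun j k => G i j k

/-- The `m × n` matrix `Y_{G,j}`. -/
def sliceY {p m n : ℕ} (G : Tensor p m n) (j : Fin n) : Mat p m n := Matrix.of fun i k => G i j k

def spaceX {p m n : ℕ} (G : Tensor p m n) : MatSpace p n n :=
  Submodule.span (ZMod p) (Set.range (sliceX G))

def spaceY {p m n : ℕ} (G : Tensor p m n) : MatSpace p m n :=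
  Submodule.span (ZMod p) (Set.range (sliceY G))

/-- `G` is a tensor of an `m`-dimensional space of skew-symmetric `n × n` matrices. -/
def IsSkewTensor {p m n : ℕ} (G : Tensor p m n) : Prop :=
  (∀ A ∈ spaceX G, A = -Aᵀ) ∧ Module.finrank (ZMod p) (spaceX G) = m

/-- The transform of `G` by `N` and `M`. -/
def trans {p m n : ℕ} (N : GL (Fin n) (ZMod p)) (M : GL (Fin m) (ZMod p)) (G : Tensor p m n) :
    Tensor p m n :=
  fun i j k =>
    (∑ i' : Fin m, (M : Mat p m m) i i' •
      ((N : Mat p n n) * sliceX G i' * (N : Mat p n n)ᵀ)) j k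

def IsometricTensors {p m n : ℕ} (G H : Tensor p m n) : Prop :=
  ∃ (N : GL (Fin n) (ZMod p)) (M : GL (Fin m) (ZMod p)), trans N M G = H

/-! ### Semi-canonical forms -/

/-- The data `(L_skew, L, Λ, C_skew, C)` of a characterization tuple. -/
structure CharTuple (p m n : ℕ) where
  {a b cs c : ℕ}
  Lskew : Mat p a n
  L : Mat p b m
  Λ : Finset (Vec p n)
  Cskew : Mat p cs n
  C : Mat p c m

namespace CharTuple

variable {p m n : ℕ} (τ : CharTuple p m n) (G : Tensor p m n)

/-- `zero_{L_skew, L_skewᵀ}(X_G)`. -/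
def zeroX : MatSpace p n n := zeroSpace τ.Lskew τ.Lskewᵀ (spaceX G)

/-- `zero_{L, L_skewᵀ}(Y_G)`. -/
def zeroY : MatSpace p m n := zeroSpace τ.L τ.Lskewᵀ (spaceY G)

/-- The conditions on a characterization tuple for `G`. -/
def IsFor : Prop :=
  0 < τ.a ∧ 0 < τ.b ∧ IsAttributeSet τ.Λ ∧
  IsComplementarySkew (τ.zeroX G) τ.Λ τ.Cskew ∧ IsComplementary (τ.zeroY G) τ.Λ τ.C

/-- The space of the matrices `∑ v[i] X_{G,i}` for `v ∈ ker(zero_{L, L_skewᵀ}(Y_G), Λ)`. -/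
def kerSpaceX : MatSpace p n n :=
  Submodule.span (ZMod p) {A | ∃ v ∈ ker (τ.zeroY G) τ.Λ, A = ∑ i, v i • sliceX G i}

/-- The space of the matrices `∑ v[j] Y_{G,j}` for
`v ∈ ker_skew(zero_{L_skew, L_skewᵀ}(X_G), Λ)`. -/
def kerSpaceY : MatSpace p m n :=
  Submodule.span (ZMod p) {A | ∃ v ∈ kerSkew (τ.zeroX G) τ.Λ, A = ∑ j, v j • sliceY G j}

noncomputable def αX : ℕ :=
  Module.finrank (ZMod p) (zeroSpace τ.Lskew τ.Lskewᵀ (τ.kerSpaceX G))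

noncomputable def βX : ℕ :=
  Module.finrank (ZMod p) ((τ.kerSpaceX G).map (sandwich τ.Lskew τ.Lskewᵀ))

noncomputable def αY : ℕ :=
  Module.finrank (ZMod p) (zeroSpace τ.L τ.Lskewᵀ (τ.kerSpaceY G))

noncomputable def βY : ℕ :=
  Module.finrank (ZMod p) ((τ.kerSpaceY G).map (sandwich τ.L τ.Lskewᵀ))

/-- `S` is a semi-canonical form of `G` with respect to the characterization tuple `τ`.
(The inequalities `h` only make the indices meaningful; they always hold.) -/
def IsSemiCanonicalForm (S : Tensor p m n) : Prop :=
  ∃ (N : GL (Fin n) (ZMod p)) (M : GL (Fin m) (ZMod p)),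
    S = trans N M G ∧
    IsFormatting (kerSkew (τ.zeroX G) τ.Λ) τ.Cskew N ∧
    (∃ h : τ.αY G + τ.βY G ≤ n,
      IsSemiCanonicalBasis τ.L τ.Lskewᵀ (τ.kerSpaceY G)
        (fun j : Fin (τ.αY G + τ.βY G) =>
          sliceY (trans N 1 G) (Fin.castLE h j) * ((N : Mat p n n)ᵀ)⁻¹)) ∧
    IsFormatting (ker (τ.zeroY G) τ.Λ) τ.C M ∧
    (∃ h : τ.αX G + τ.βX G ≤ m,
      IsSemiCanonicalBasis τ.Lskew τ.Lskewᵀ (τ.kerSpaceX G)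
        (fun i : Fin (τ.αX G + τ.βX G) => sliceX (trans 1 M G) (Fin.castLE h i)))

end CharTuple

/-- A tensor together with four parameters. -/
structure ParamTensor (p m n : ℕ) where
  tensor : Tensor p m n
  αX : ℕ
  βX : ℕ
  αY : ℕ
  βY : ℕ

/-- `S` is a semi-canonical form, with its parameters, of some tensor of a skew-symmetric matrix
space. -/
def IsSemiForm {p m n : ℕ} (S : ParamTensor p m n) : Prop :=
  ∃ (G : Tensor p m n) (τ : CharTuple p m n),
    IsSkewTensor G ∧ τ.IsFor G ∧ τ.IsSemiCanonicalForm G S.tensor ∧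
    S.αX = τ.αX G ∧ S.βX = τ.βX G ∧ S.αY = τ.αY G ∧ S.βY = τ.βY G

/-- The invertible matrix `P` has the block form `[[X, 0, 0], [Y, I_β, 0], [0, 0, I]]` with an
`α × α` block `X` (which is then invertible). -/
def IsBlockForm {p m : ℕ} (α β : ℕ) (P : GL (Fin m) (ZMod p)) : Prop :=
  (∀ i j : Fin m, α ≤ (j : ℕ) → (P : Mat p m m) i j = if i = j then 1 else 0) ∧
  (∀ i j : Fin m, α + β ≤ (i : ℕ) → (P : Mat p m m) i j = if i = j then 1 else 0)

/-- Isometry of semi-canonical forms. -/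
def IsometricSemiForms {p m n : ℕ} (S S' : ParamTensor p m n) : Prop :=
  S.αX = S'.αX ∧ S.βX = S'.βX ∧ S.αY = S'.αY ∧ S.βY = S'.βY ∧
  ∃ (N : GL (Fin n) (ZMod p)) (M : GL (Fin m) (ZMod p)),
    IsBlockForm S.αY S.βY N ∧ IsBlockForm S.αX S.βX M ∧ trans N M S.tensor = S'.tensor

/-! ### Inputs, decision problems -/

/-- The tree of a list of trees. -/
def encList : List BTree → BTree
  | [] => BTree.nil
  | x :: l => BTree.node x (encList l)

/-- Natural numbers in unary. -/
def encNat (k : ℕ) : BTree := encList (List.replicate k BTree.nil)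

/-- A tensor as a list of lists of lists of entries in `{0, …, p - 1}`. -/
def encTensor {p m n : ℕ} (G : Tensor p m n) : BTree :=
  encList (List.ofFn fun i => encList (List.ofFn fun j => encList (List.ofFn fun k =>
    encNat (G i j k).val)))

def encParamTensor {p m n : ℕ} (S : ParamTensor p m n) : BTree :=
  encList [encNat S.αX, encNat S.βX, encNat S.αY, encNat S.βY, encTensor S.tensor]

/-- `P` decides, for all odd primes `p` and all `n, m ≥ 1`, whether two semi-canonical forms of
skew-symmetric matrix space tensors in `𝔽_p^{m × n × n}` are isometric, within `T p n m` steps. -/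
def DecidesSemiFormIsometry (P : Prog) (T : ℕ → ℕ → ℕ → ℝ) : Prop :=
  ∀ p n m : ℕ, p.Prime → 2 < p → 0 < n → 0 < m →
    ∀ S S' : ParamTensor p m n, IsSemiForm S → IsSemiForm S' →
      AnswersWithin P
        (encList [encNat p, encNat n, encNat m, encParamTensor S, encParamTensor S'])
        (IsometricSemiForms S S') (T p n m)

/-- `P` decides, for all odd primes `p` and all `n, m ≥ 1`, whether two skew-symmetric matrix space
tensors in `𝔽_p^{m × n × n}` are isometric, within `T p n m` steps. -/
def DecidesTensorIsometry (P : Prog) (T : ℕ → ℕ → ℕ → ℝ) : Prop :=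
  ∀ p n m : ℕ, p.Prime → 2 < p → 0 < n → 0 < m →
    ∀ G H : Tensor p m n, IsSkewTensor G → IsSkewTensor H →
      AnswersWithin P
        (encList [encNat p, encNat n, encNat m, encTensor G, encTensor H])
        (IsometricTensors G H) (T p n m)

end TensorIso

namespace TensorIso

open scoped Matrix

/-! ### Polynomially bounded functions and computations -/

/-! The reduction is an exhaustive search. A bounded amount of data (`TupleData`: individualization
vectors, a list spanning the attribute set, candidates for the complements) determines a
semi-canonical form of a tensor. The program builds the forms of `G` and of `H` for all data of
prescribed size, submits every pair to the given procedure and accepts if one pair is accepted. Each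
form is a transform of its tensor, so acceptance implies isometry. The converse rests on two facts.

Small data exist (`exists_tupleData`). Let `w` be the fourth root of `n`, rounded up. By averaging
(`exists_lists`), `O(m/w + w³)` vectors of length `n` and `O(w³)` vectors of length `m` detect every
matrix of rank above `2w³` in the spaces `X_G` and `Y_G`, so the two zero spaces contain only
matrices of rank at most `2w³`. A space of matrices of rank at most `r` maps a subspace of
codimension at most `2r` into one of dimension at most `2r` (`exists_compression`): for an element
`A` of maximal rank, every other element induces a map from the kernel to the cokernel of `A` of at
most half that rank (`two_mul_finrank_le`), and one recurses. With an attribute set spanning the two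
small target spaces, both kernels have codimension `O(w³)`, so the complements are small too.

Corresponding data give isometric forms (`TupleData.transport_isometric`). An isometry carries data
for `G` to data for `H`. The rows of the formatting matrices are chosen greedily by increasing key;
the keys of the chosen rows do not depend on the choices (`IsRows.key_eq`), and two choices differ
by a matrix of block form modulo vectors that the trilinear form does not see
(`IsRows.exists_blockForm`, `tri_congr`).

Since `n ≤ w⁴`, the data consist of `O((m + n) w³)` field elements, and `w³ ≤ 8 n^(3/4)`. All other
steps, which store subspaces as lists of all their elements, are polynomial in `p ^ ((m + n) w³)`.
This is certified by `PT`, a calculus of polynomial-time computations on trees. -/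

/-- The number of nodes of a tree. -/
def BTree.size : BTree → ℕ
  | .nil => 1
  | .node a b => a.size + b.size + 1

/-- `f` is bounded by a fixed power of `μ + 2`. -/
def PolyBdd {ι : Type} (μ f : ι → ℕ) : Prop := ∃ k, ∀ i, f i ≤ (μ i + 2) ^ k

namespace PolyBdd

variable {ι κ : Type} {μ f g : ι → ℕ}

theorem mono (hg : PolyBdd μ g) (h : ∀ i, f i ≤ g i) : PolyBdd μ f := by
  obtain ⟨k, hk⟩ := hg
  exact ⟨k, fun i => (h i).trans (hk i)⟩

/-- The base `μ i + 2` is at least `2` even where `μ` vanishes, so `c < 2 ^ c` absorbs every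
constant. -/
theorem const (c : ℕ) : PolyBdd μ fun _ => c :=
  ⟨c, fun i => (Nat.lt_two_pow_self (n := c)).le.trans (Nat.pow_le_pow_left (by omega) _)⟩

theorem self : PolyBdd μ μ := ⟨1, fun i => by simp⟩

theorem mul (hf : PolyBdd μ f) (hg : PolyBdd μ g) : PolyBdd μ fun i => f i * g i := by
  obtain ⟨k, hk⟩ := hf
  obtain ⟨l, hl⟩ := hg
  exact ⟨k + l, fun i => by rw [pow_add]; exact Nat.mul_le_mul (hk i) (hl i)⟩

theorem add (hf : PolyBdd μ f) (hg : PolyBdd μ g) : PolyBdd μ fun i => f i + g i := by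
  obtain ⟨k, hk⟩ := hf
  obtain ⟨l, hl⟩ := hg
  refine ⟨k + l + 1, fun i => ?_⟩
  have h1 : (μ i + 2) ^ k ≤ (μ i + 2) ^ (k + l) := Nat.pow_le_pow_right (by omega) (by omega)
  have h2 : (μ i + 2) ^ l ≤ (μ i + 2) ^ (k + l) := Nat.pow_le_pow_right (by omega) (by omega)
  have h3 : 2 * (μ i + 2) ^ (k + l) ≤ (μ i + 2) ^ (k + l + 1) := by
    rw [pow_succ, mul_comm]
    exact Nat.mul_le_mul_left _ (by omega)
  have := hk i
  have := hl i
  show f i + g i ≤ _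
  omega

theorem pow (hf : PolyBdd μ f) (c : ℕ) : PolyBdd μ fun i => f i ^ c := by
  induction c with
  | zero => simpa using const 1
  | succ c ih => simpa only [pow_succ] using ih.mul hf

theorem reindex (hf : PolyBdd μ f) (π : κ → ι) :
    PolyBdd (fun q => μ (π q)) fun q => f (π q) := by
  obtain ⟨k, hk⟩ := hf
  exact ⟨k, fun q => hk (π q)⟩

end PolyBdd

theorem size_encList_cons (x : BTree) (l : List BTree) :
    (encList (x :: l)).size = x.size + (encList l).size + 1 := rfl

theorem length_lt_size_encList (l : List BTree) : l.length < (encList l).size := by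
  induction l with
  | nil => simp [encList, BTree.size]
  | cons x l ih => rw [size_encList_cons, List.length_cons]; omega

theorem size_le_size_encList {l : List BTree} {x : BTree} (hx : x ∈ l) :
    x.size ≤ (encList l).size := by
  induction l with
  | nil => simp at hx
  | cons y l ih =>
    rw [size_encList_cons]
    rcases List.mem_cons.1 hx with rfl | h
    · omega
    · have := ih h; omega

theorem size_encList_sublist {l₁ l₂ : List BTree} (h : l₁.Sublist l₂) :
    (encList l₁).size ≤ (encList l₂).size := by
  induction h with
  | slnil => rfl
  | cons a _ ih => rw [size_encList_cons]; omega
  | cons_cons a _ ih => rw [size_encList_cons, size_encList_cons]; omega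

theorem size_encList_le {l : List BTree} {c : ℕ} (h : ∀ x ∈ l, x.size ≤ c) :
    (encList l).size ≤ l.length * (c + 1) + 1 := by
  induction l with
  | nil => simp [encList, BTree.size]
  | cons y l ih =>
    rw [size_encList_cons, List.length_cons, add_mul]
    have h1 := ih fun x hx => h x (List.mem_cons_of_mem _ hx)
    have h2 := h y List.mem_cons_self
    omega

theorem size_encList_append (l₁ l₂ : List BTree) :
    (encList (l₁ ++ l₂)).size + 1 = (encList l₁).size + (encList l₂).size := by
  induction l₁ with
  | nil => simp [encList, BTree.size]; omega
  | cons y l ih => rw [List.cons_append, size_encList_cons, size_encList_cons]; omega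

theorem size_encNat (k : ℕ) : (encNat k).size = 2 * k + 1 := by
  induction k with
  | zero => rfl
  | succ k ih =>
    have : encNat (k + 1) = BTree.node BTree.nil (encNat k) := rfl
    rw [this, BTree.size, ih, BTree.size]; omega

/-- A bounded loop. -/
theorem Runs.loop_iterate {c P : Prog} {N tc tp : ℕ} (st : ℕ → BTree)
    (hc : ∀ j < N, ∃ a b s, s ≤ tc ∧ Runs c (st j) (.node a b) s)
    (hP : ∀ j < N, ∃ t ≤ tp, Runs P (st j) (st (j + 1)) t)
    (hd : ∃ s ≤ tc, Runs c (st N) .nil s) :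
    ∃ t ≤ N * (tc + tp + 1) + (tc + 1), Runs (.loop c P) (st 0) (st N) t := by
  induction N generalizing st with
  | zero =>
    obtain ⟨s, hs, h⟩ := hd
    exact ⟨s + 1, by omega, Runs.loop_done h⟩
  | succ N ih =>
    obtain ⟨a, b, s, hs, h1⟩ := hc 0 (by omega)
    obtain ⟨t, ht, h2⟩ := hP 0 (by omega)
    obtain ⟨u, hu, h3⟩ := ih (fun j => st (j + 1)) (fun j hj => hc (j + 1) (by omega))
      (fun j hj => hP (j + 1) (by omega)) hd
    refine ⟨s + t + u + 1, ?_, Runs.loop_step h1 h2 h3⟩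
    rw [add_mul]
    omega

/-- Some program computes the tree `g i` from the tree `e i` in time polynomial in `μ i`, and
the size of the result is polynomial in `μ i`. -/
def PT {ι : Type} (μ : ι → ℕ) (e g : ι → BTree) : Prop :=
  PolyBdd μ (fun i => (g i).size) ∧
    ∃ (P : Prog) (k : ℕ), ∀ i, ∃ t ≤ (μ i + 2) ^ k, Runs P (e i) (g i) t

/-! ### Polynomial-time computability: program constructors and truth values -/

namespace PT

variable {ι : Type} {μ : ι → ℕ} {e g h : ι → BTree}

theorem of_bdd (hg : PolyBdd μ fun i => (g i).size) (P : Prog) {f : ι → ℕ} (hf : PolyBdd μ f)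
    (H : ∀ i, ∃ t ≤ f i, Runs P (e i) (g i) t) : PT μ e g := by
  obtain ⟨k, hk⟩ := hf
  refine ⟨hg, P, k, fun i => ?_⟩
  obtain ⟨t, ht, hr⟩ := H i
  exact ⟨t, ht.trans (hk i), hr⟩

theorem exists_bdd (hg : PT μ e g) : ∃ (P : Prog) (f : ι → ℕ), PolyBdd μ f ∧
    ∀ i, ∃ t ≤ f i, Runs P (e i) (g i) t := by
  obtain ⟨_, P, k, hk⟩ := hg
  exact ⟨P, fun i => (μ i + 2) ^ k, ⟨k, fun _ => le_rfl⟩, hk⟩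

theorem refl (he : PolyBdd μ fun i => (e i).size) : PT μ e e :=
  of_bdd he .id (PolyBdd.const 1) fun _ => ⟨1, le_rfl, Runs.id _⟩

theorem nil : PT μ e fun _ => .nil :=
  of_bdd (PolyBdd.const 1) .nil (PolyBdd.const 1) fun _ => ⟨1, le_rfl, Runs.nil _⟩

theorem comp (hg : PT μ e g) (hh : PT μ g h) : PT μ e h := by
  obtain ⟨P, f, hf, H⟩ := hg.exists_bdd
  obtain ⟨Q, f', hf', H'⟩ := hh.exists_bdd
  refine of_bdd hh.1 (.comp Q P) ((hf.add hf').add (PolyBdd.const 1)) fun i => ?_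
  obtain ⟨t, ht, hr⟩ := H i
  obtain ⟨t', ht', hr'⟩ := H' i
  exact ⟨_, by omega, Runs.comp hr hr'⟩

theorem pair (hg : PT μ e g) (hh : PT μ e h) : PT μ e fun i => .node (g i) (h i) := by
  obtain ⟨P, f, hf, H⟩ := hg.exists_bdd
  obtain ⟨Q, f', hf', H'⟩ := hh.exists_bdd
  refine of_bdd ((hg.1.add hh.1).add (PolyBdd.const 1)) (.pair P Q)
    ((hf.add hf').add (PolyBdd.const 1)) fun i => ?_
  obtain ⟨t, ht, hr⟩ := H i
  obtain ⟨t', ht', hr'⟩ := H' i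
  exact ⟨_, by omega, Runs.pair hr hr'⟩

theorem fst_of (hg : PT μ e fun i => .node (g i) (h i)) : PT μ e g :=
  hg.comp (of_bdd (hg.1.mono fun i => by simp only [BTree.size]; omega) .fst (PolyBdd.const 1)
    fun _ => ⟨1, le_rfl, Runs.fst_node _ _⟩)

theorem snd_of (hg : PT μ e fun i => .node (g i) (h i)) : PT μ e h :=
  hg.comp (of_bdd (hg.1.mono fun i => by simp only [BTree.size]; omega) .snd (PolyBdd.const 1)
    fun _ => ⟨1, le_rfl, Runs.snd_node _ _⟩)

/-- Ignoring the most recent variable of the environment. -/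
theorem weak {Y : ι → Type} {x : (i : ι) × Y i → BTree} (hg : PT μ e g) :
    PT (fun q : (i : ι) × Y i => μ q.1) (fun q => .node (x q) (e q.1)) (fun q => g q.1) := by
  obtain ⟨P, f, hf, H⟩ := hg.exists_bdd
  refine of_bdd (hg.1.reindex Sigma.fst) (.comp P .snd)
    ((hf.reindex Sigma.fst).add (PolyBdd.const 2)) fun i => ?_
  obtain ⟨t, ht, hr⟩ := H i.1
  exact ⟨_, by omega, Runs.comp (Runs.snd_node _ _) hr⟩

/-- The most recent variable of the environment. -/
theorem var {x : ι → BTree} (hx : PolyBdd μ fun i => (x i).size) :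
    PT μ (fun i => .node (x i) (e i)) x :=
  of_bdd hx .fst (PolyBdd.const 1) fun _ => ⟨1, le_rfl, Runs.fst_node _ _⟩

theorem var₁ {x y : ι → BTree} (hx : PolyBdd μ fun i => (x i).size) :
    PT μ (fun i => .node (.node (x i) (y i)) (e i)) x :=
  of_bdd hx (.comp .fst .fst) (PolyBdd.const 3)
    fun _ => ⟨_, le_rfl, Runs.comp (Runs.fst_node _ _) (Runs.fst_node _ _)⟩

theorem var₂ {x y : ι → BTree} (hy : PolyBdd μ fun i => (y i).size) :
    PT μ (fun i => .node (.node (x i) (y i)) (e i)) y :=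
  of_bdd hy (.comp .snd .fst) (PolyBdd.const 3)
    fun _ => ⟨_, le_rfl, Runs.comp (Runs.fst_node _ _) (Runs.snd_node _ _)⟩

theorem congr (hg : PT μ e g) (hh : ∀ i, h i = g i) : PT μ e h := by
  obtain rfl : h = g := funext hh
  exact hg

open Classical in
/-- The tree of a truth value. -/
noncomputable def _root_.TensorIso.bit (q : Prop) : BTree := if q then .node .nil .nil else .nil

theorem _root_.TensorIso.size_bit_le (q : Prop) : (bit q).size ≤ 3 := by
  unfold bit; split_ifs <;> simp [BTree.size]

open Classical in
theorem ite {q : ι → Prop} (hq : PT μ e fun i => bit (q i)) (hg : PT μ e g) (hh : PT μ e h) :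
    PT μ e fun i => if q i then g i else h i := by
  obtain ⟨R, f'', hf'', H''⟩ := hq.exists_bdd
  obtain ⟨P, f, hf, H⟩ := hg.exists_bdd
  obtain ⟨Q, f', hf', H'⟩ := hh.exists_bdd
  refine of_bdd ((hg.1.add hh.1).mono fun i => by split_ifs <;> omega) (.ite R P Q)
    (((hf''.add hf).add hf').add (PolyBdd.const 1)) fun i => ?_
  obtain ⟨t, ht, hr⟩ := H i
  obtain ⟨t', ht', hr'⟩ := H' i
  obtain ⟨t'', ht'', hr''⟩ := H'' i
  by_cases hqi : q i
  · rw [bit, if_pos hqi] at hr''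
    rw [if_pos hqi]
    exact ⟨_, by omega, Runs.ite_true hr'' hr⟩
  · rw [bit, if_neg hqi] at hr''
    rw [if_neg hqi]
    exact ⟨_, by omega, Runs.ite_false hr'' hr'⟩

theorem true : PT μ e fun _ => bit True :=
  (PT.nil.pair PT.nil).congr fun i => by simp [bit]

theorem not {q : ι → Prop} (hq : PT μ e fun i => bit (q i)) : PT μ e fun i => bit (¬ q i) :=
  (hq.ite PT.nil PT.true).congr fun i => by by_cases h : q i <;> simp [h, bit]

theorem and {q r : ι → Prop} (hq : PT μ e fun i => bit (q i)) (hr : PT μ e fun i => bit (r i)) :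
    PT μ e fun i => bit (q i ∧ r i) :=
  (hq.ite hr PT.nil).congr fun i => by
    by_cases h : q i <;> by_cases h' : r i <;> simp [h, h', bit]

theorem or {q r : ι → Prop} (hq : PT μ e fun i => bit (q i)) (hr : PT μ e fun i => bit (r i)) :
    PT μ e fun i => bit (q i ∨ r i) :=
  (hq.ite PT.true hr).congr fun i => by
    by_cases h : q i <;> by_cases h' : r i <;> simp [h, h', bit]

/-! ### Polynomial-time folds over lists -/

section lists

variable {X : ι → Type} {l : ∀ i, List (X i)} {enc : ∀ i, X i → BTree}

/-- The step is one family indexed by instances and positions together, so its result has a size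
bound in `μ` that is uniform in the position. This keeps the state from growing with the number of
iterations, which is itself bounded by the size of the list. -/
theorem foldl (st : ι → ℕ → BTree) (hl : PT μ e fun i => encList ((l i).map (enc i)))
    (h0 : PT μ e fun i => st i 0)
    (hstep : PT (fun q : (i : ι) × Fin (l i).length => μ q.1)
      (fun q => .node (.node (enc q.1 ((l q.1)[q.2])) (st q.1 q.2)) (e q.1))
      (fun q => st q.1 (q.2 + 1))) :
    PT μ e fun i => st i (l i).length := by
  obtain ⟨Pl, fl, hfl, Hl⟩ := hl.exists_bdd
  obtain ⟨P0, f0, hf0, H0⟩ := h0.exists_bdd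
  obtain ⟨hsize, Q, k, H⟩ := hstep
  have hlen : PolyBdd μ fun i => (l i).length := hl.1.mono fun i => by
    simpa using (length_lt_size_encList ((l i).map (enc i))).le
  have hsz : PolyBdd μ fun i => (st i (l i).length).size := by
    obtain ⟨k', hk'⟩ := hsize
    refine PolyBdd.mono (h0.1.add (⟨k', fun i => le_rfl⟩ : PolyBdd μ fun i => (μ i + 2) ^ k'))
      fun i => ?_
    rcases Nat.eq_zero_or_pos (l i).length with h | h
    · rw [h]; exact Nat.le_add_right _ _
    · have := hk' ⟨i, ⟨(l i).length - 1, by omega⟩⟩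
      simp only [Nat.sub_add_cancel h] at this
      exact this.trans (Nat.le_add_left _ _)
  -- The loop works on `((state, remaining list), environment)`. The guard returns the remaining
  -- list, which is `nil` exactly when the loop has to stop.
  let c : Prog := .comp .snd .fst
  let step : Prog := .pair (.pair (.comp Q (.pair (.pair (.comp .fst (.comp .snd .fst))
    (.comp .fst .fst)) .snd)) (.comp .snd (.comp .snd .fst))) .snd
  refine of_bdd hsz (.comp (.comp .fst .fst) (.comp (.loop c step) (.pair (.pair P0 Pl) .id)))
    (f := fun i => f0 i + fl i + ((l i).length * (3 + ((μ i + 2) ^ k + 30) + 1) + 30))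
    ((hf0.add hfl).add ((hlen.mul (((PolyBdd.const 3).add (PolyBdd.add ⟨k, fun _ => le_rfl⟩
      (PolyBdd.const 30))).add (PolyBdd.const 1))).add (PolyBdd.const 30))) fun i => ?_
  obtain ⟨tl, htl, hrl⟩ := Hl i
  obtain ⟨t0, ht0, hr0⟩ := H0 i
  have hloop := Runs.loop_iterate (c := c) (P := step) (N := (l i).length) (tc := 3)
    (tp := (μ i + 2) ^ k + 30)
    (fun j => .node (.node (st i j) (encList (((l i).drop j).map (enc i)))) (e i))
    (fun j hj => by
      simp only [List.drop_eq_getElem_cons hj, List.map_cons, encList]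
      exact ⟨_, _, _, le_rfl, Runs.comp (Runs.fst_node _ _) (Runs.snd_node _ _)⟩)
    (fun j hj => by
      obtain ⟨t, ht, hr⟩ := H ⟨i, ⟨j, hj⟩⟩
      simp only [List.drop_eq_getElem_cons hj, List.map_cons, encList]
      refine ⟨_, ?_, Runs.pair (Runs.pair (Runs.comp (Runs.pair (Runs.pair
        (Runs.comp (Runs.comp (Runs.fst_node _ _) (Runs.snd_node _ _)) (Runs.fst_node _ _))
        (Runs.comp (Runs.fst_node _ _) (Runs.fst_node _ _))) (Runs.snd_node _ _)) hr)
        (Runs.comp (Runs.comp (Runs.fst_node _ _) (Runs.snd_node _ _)) (Runs.snd_node _ _)))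
        (Runs.snd_node _ _)⟩
      simp only at ht
      omega)
    (by
      simp only [List.drop_length, List.map_nil, encList]
      exact ⟨_, le_rfl, Runs.comp (Runs.fst_node _ _) (Runs.snd_node _ _)⟩)
  obtain ⟨t, ht, hr⟩ := hloop
  refine ⟨_, ?_, Runs.comp (Runs.comp (Runs.pair (Runs.pair hr0 hrl) (Runs.id _)) hr)
    (Runs.comp (Runs.fst_node _ _) (Runs.fst_node _ _))⟩
  omega

theorem poly_length (hl : PT μ e fun i => encList ((l i).map (enc i))) :
    PolyBdd μ fun i => (l i).length :=
  hl.1.mono fun i => by simpa using (length_lt_size_encList ((l i).map (enc i))).le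

theorem poly_mem (hl : PT μ e fun i => encList ((l i).map (enc i))) :
    PolyBdd (fun q : (i : ι) × {x : X i // x ∈ l i} => μ q.1)
      fun q => (enc q.1 q.2.1).size :=
  (hl.1.reindex Sigma.fst).mono fun q => size_le_size_encList (List.mem_map_of_mem q.2.2)

theorem reverse (hl : PT μ e fun i => encList ((l i).map (enc i))) :
    PT μ e fun i => encList ((l i).reverse.map (enc i)) := by
  refine (foldl (fun i j => encList (((l i).take j).reverse.map (enc i))) hl ?_ ?_).congr ?_
  · exact PT.nil.congr fun i => by simp [encList]
  · refine ((var₁ ?_).pair (var₂ ?_)).congr (h := _) ?_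
    · exact (hl.poly_mem.reindex fun q : (i : ι) × Fin (l i).length =>
        (⟨q.1, (l q.1)[q.2], List.getElem_mem _⟩ : (i : ι) × {x : X i // x ∈ l i}))
    · refine ((hl.1.reindex (κ := (i : ι) × Fin (l i).length) Sigma.fst)).mono fun q => ?_
      have h1 := fun x hx => size_le_size_encList (l := (l q.1).map (enc q.1)) (x := x) hx
      generalize hb : (l q.1).take q.2 = b
      have hb' : (b.map (enc q.1)).Sublist ((l q.1).map (enc q.1)) :=
        (hb ▸ List.take_sublist _ _ : b.Sublist (l q.1)).map _
      refine le_trans (le_of_eq ?_) (size_encList_sublist hb')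
      clear hb hb'
      induction b with
      | nil => rfl
      | cons x b ih =>
        have := size_encList_append (b.reverse.map (enc q.1)) [enc q.1 x]
        rw [List.reverse_cons, List.map_append, List.map_cons, List.map_nil,
          List.map_cons, size_encList_cons]
        simp only [encList, BTree.size] at this
        omega
    · intro q
      rw [List.take_add_one, List.getElem?_eq_getElem q.2.2]
      simp only [Option.toList_some, List.reverse_append, List.reverse_singleton,
        List.singleton_append, List.map_cons, encList]
      rfl
  · intro i
    simp

/-- The positions in a list, given by an element and the part of the list after it. -/
abbrev Pos (l : ∀ i, List (X i)) : Type :=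
  (i : ι) × {q : X i × List (X i) // q.1 :: q.2 <:+ l i}

/-- The fold is a left fold over the reversed list. The step is given in higher-order style: it
receives a weakening rule for everything computable in the outer environment, and programs for the
current element and the current state, so that bodies can be written without handling environments.
The size bound `hs` has to be supplied, because reading the state as a variable requires it
beforehand. -/
theorem foldr (st : ∀ i, List (X i) → BTree) (hl : PT μ e fun i => encList ((l i).map (enc i)))
    (h0 : PT μ e fun i => st i [])
    (hs : PolyBdd (fun q : Pos l => μ q.1) fun q => (st q.1 q.2.1.2).size)
    (hstep : (∀ {g : ι → BTree}, PT μ e g → PT (fun q : Pos l => μ q.1)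
        (fun q => .node (.node (enc q.1 q.2.1.1) (st q.1 q.2.1.2)) (e q.1)) (fun q => g q.1)) →
      PT (fun q : Pos l => μ q.1)
        (fun q => .node (.node (enc q.1 q.2.1.1) (st q.1 q.2.1.2)) (e q.1))
        (fun q => enc q.1 q.2.1.1) →
      PT (fun q : Pos l => μ q.1)
        (fun q => .node (.node (enc q.1 q.2.1.1) (st q.1 q.2.1.2)) (e q.1))
        (fun q => st q.1 q.2.1.2) →
      PT (fun q : Pos l => μ q.1)
        (fun q => .node (.node (enc q.1 q.2.1.1) (st q.1 q.2.1.2)) (e q.1))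
        (fun q => st q.1 (q.2.1.1 :: q.2.1.2))) :
    PT μ e fun i => st i (l i) := by
  have hstep' := hstep weak
    (var₁ (hl.poly_mem.reindex fun q : Pos l => (⟨q.1, q.2.1.1, q.2.2.subset List.mem_cons_self⟩ :
      (i : ι) × {x : X i // x ∈ l i}))) (var₂ hs)
  refine (foldl (l := fun i => (l i).reverse) (fun i j => st i ((l i).drop ((l i).length - j)))
    hl.reverse ?_ ?_).congr ?_
  · exact h0.congr fun i => by simp
  · have key : ∀ q : (i : ι) × Fin (l i).reverse.length,
        (l q.1).reverse[q.2] :: (l q.1).drop ((l q.1).length - q.2) =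
          (l q.1).drop ((l q.1).length - (q.2 + 1)) := by
      intro q
      have hq : (q.2 : ℕ) < (l q.1).length := q.2.2.trans_eq List.length_reverse
      rw [List.drop_eq_getElem_cons (i := (l q.1).length - (q.2 + 1)) (by omega)]
      simp only [Fin.getElem_fin, List.getElem_reverse]
      congr 1
      · congr 1; omega
      · congr 1; omega
    obtain ⟨⟨k, hk⟩, Q, k', hk'⟩ := hstep'
    let ρ : (i : ι) × Fin (l i).reverse.length → Pos l := fun q =>
      ⟨q.1, ((l q.1).reverse[q.2], (l q.1).drop ((l q.1).length - q.2)),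
        (key q).symm ▸ List.drop_suffix _ _⟩
    refine ⟨⟨k, fun q => ?_⟩, Q, k', fun q => ?_⟩
    · have := hk (ρ q)
      simp only [ρ, key] at this
      exact this
    · have := hk' (ρ q)
      simp only [ρ, key] at this
      exact this
  · intro i
    simp

end lists

end PT

open Classical in
/-- The elements of a list with a given property. -/
noncomputable def sel {α : Type} (q : α → Prop) (l : List α) : List α :=
  l.filter fun x => decide (q x)

section sel

variable {α : Type} {q : α → Prop}

theorem mem_sel {l : List α} {x : α} : x ∈ sel q l ↔ x ∈ l ∧ q x := by
  simp [sel]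

theorem sel_cons_of_pos {x : α} {l : List α} (h : q x) : sel q (x :: l) = x :: sel q l := by
  simp [sel, h]

theorem sel_cons_of_neg {x : α} {l : List α} (h : ¬ q x) : sel q (x :: l) = sel q l := by
  simp [sel, h]

theorem sel_sublist (l : List α) : (sel q l).Sublist l := List.filter_sublist

end sel

namespace PT

variable {ι κ : Type} {μ : ι → ℕ} {e g h : ι → BTree}

theorem reindex (π : κ → ι) (hg : PT μ e g) :
    PT (fun q => μ (π q)) (fun q => e (π q)) (fun q => g (π q)) := by
  obtain ⟨hs, P, k, H⟩ := hg
  exact ⟨hs.reindex π, P, k, fun q => H (π q)⟩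

/-- Adapts a program for a body that sees only the list element to the environment of a fold, where
a state is stored next to the element. -/
theorem drop_state {x y : ι → BTree} (hg : PT μ (fun i => .node (x i) (e i)) g) :
    PT μ (fun i => .node (.node (x i) (y i)) (e i)) g := by
  obtain ⟨P, f, hf, H⟩ := hg.exists_bdd
  refine of_bdd hg.1 (.comp P (.pair (.comp .fst .fst) .snd)) (hf.add (PolyBdd.const 6))
    fun i => ?_
  obtain ⟨t, ht, hr⟩ := H i
  exact ⟨_, by omega, Runs.comp (Runs.pair (Runs.comp (Runs.fst_node _ _) (Runs.fst_node _ _))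
    (Runs.snd_node _ _)) hr⟩

/-! ### List operations derived from folds -/

section lists

variable {X Y : ι → Type} {l : ∀ i, List (X i)} {enc : ∀ i, X i → BTree}
  {l' : ∀ i, List (Y i)} {enc' : ∀ i, Y i → BTree}

/-- The members of a family of lists. -/
abbrev Mem (l : ∀ i, List (X i)) : Type := (i : ι) × {x : X i // x ∈ l i}

/-- Conversion of a position to a member. -/
def Pos.toMem (q : Pos l) : Mem l := ⟨q.1, q.2.1.1, q.2.2.subset List.mem_cons_self⟩

theorem append {a b : ι → List BTree} (ha : PT μ e fun i => encList (a i))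
    (hb : PT μ e fun i => encList (b i)) : PT μ e fun i => encList (a i ++ b i) := by
  refine foldr (X := fun _ => BTree) (enc := fun _ => _root_.id) (l := a)
    (fun i l => encList (l ++ b i)) (ha.congr fun i => by simp) (hb.congr fun i => rfl) ?_ ?_
  · refine ((ha.1.add hb.1).reindex Sigma.fst).mono fun q => ?_
    have h1 := size_encList_append q.2.1.2 (b q.1)
    have h2 := size_encList_sublist ((List.sublist_cons_self _ _).trans q.2.2.sublist)
    simp only
    omega
  · exact fun _ hx hst => hx.pair hst

theorem map {f : ∀ i, X i → BTree} (hl : PT μ e fun i => encList ((l i).map (enc i)))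
    (hf : (∀ {g : ι → BTree}, PT μ e g → PT (fun q : Mem l => μ q.1)
        (fun q => .node (enc q.1 q.2.1) (e q.1)) (fun q => g q.1)) →
      PT (fun q : Mem l => μ q.1) (fun q => .node (enc q.1 q.2.1) (e q.1))
        (fun q => enc q.1 q.2.1) →
      PT (fun q : Mem l => μ q.1) (fun q => .node (enc q.1 q.2.1) (e q.1))
        (fun q => f q.1 q.2.1)) :
    PT μ e fun i => encList ((l i).map (f i)) := by
  have hf' := hf weak (var hl.poly_mem)
  refine foldr (fun i l => encList (l.map (f i))) hl PT.nil ?_ fun _ _ hst => ?_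
  · obtain ⟨k, hk⟩ := hf'.1
    refine PolyBdd.mono (((hl.poly_length.reindex Sigma.fst).mul
      (PolyBdd.add ⟨k, fun _ => le_rfl⟩ (PolyBdd.const 1))).add (PolyBdd.const 1)) fun q => ?_
    refine (size_encList_le (c := (μ q.1 + 2) ^ k) ?_).trans ?_
    · intro x hx
      obtain ⟨y, hy, rfl⟩ := List.mem_map.1 hx
      exact hk ⟨q.1, y, q.2.2.subset (List.mem_cons_of_mem _ hy)⟩
    · rw [List.length_map]
      have := q.2.2.length_le
      rw [List.length_cons] at this
      gcongr
      omega
  · exact (hf'.reindex Pos.toMem).drop_state.pair hst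

theorem flatten {a : ι → List (List BTree)} (ha : PT μ e fun i => encList ((a i).map encList)) :
    PT μ e fun i => encList (a i).flatten := by
  refine foldr (X := fun _ => List BTree) (enc := fun _ => encList) (l := a)
    (fun i l => encList l.flatten) ha PT.nil ?_ fun _ hx hst => hx.append hst
  refine (ha.1.reindex Sigma.fst).mono fun q => ?_
  refine le_trans ?_ (size_encList_sublist (((List.sublist_cons_self _ _).trans
    q.2.2.sublist).map encList))
  generalize q.2.1.2 = l
  induction l with
  | nil => simp [encList]
  | cons x l ih =>
    have := size_encList_append x l.flatten
    rw [List.flatten_cons, List.map_cons, size_encList_cons]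
    omega

theorem flatMap {f : ∀ i, X i → List BTree}
    (hl : PT μ e fun i => encList ((l i).map (enc i)))
    (hf : (∀ {g : ι → BTree}, PT μ e g → PT (fun q : Mem l => μ q.1)
        (fun q => .node (enc q.1 q.2.1) (e q.1)) (fun q => g q.1)) →
      PT (fun q : Mem l => μ q.1) (fun q => .node (enc q.1 q.2.1) (e q.1))
        (fun q => enc q.1 q.2.1) →
      PT (fun q : Mem l => μ q.1) (fun q => .node (enc q.1 q.2.1) (e q.1))
        (fun q => encList (f q.1 q.2.1))) :
    PT μ e fun i => encList ((l i).flatMap (f i)) := by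
  refine (flatten (a := fun i => (l i).map (f i)) ?_).congr fun i => by rw [List.flatMap_def]
  exact (map (f := fun i x => encList (f i x)) hl hf).congr fun i => by rw [List.map_map]; rfl

theorem sel {p : ∀ i, X i → Prop} (hl : PT μ e fun i => encList ((l i).map (enc i)))
    (hp : (∀ {g : ι → BTree}, PT μ e g → PT (fun q : Mem l => μ q.1)
        (fun q => .node (enc q.1 q.2.1) (e q.1)) (fun q => g q.1)) →
      PT (fun q : Mem l => μ q.1) (fun q => .node (enc q.1 q.2.1) (e q.1))
        (fun q => enc q.1 q.2.1) →
      PT (fun q : Mem l => μ q.1) (fun q => .node (enc q.1 q.2.1) (e q.1))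
        (fun q => bit (p q.1 q.2.1))) :
    PT μ e fun i => encList ((TensorIso.sel (p i) (l i)).map (enc i)) := by
  have hp' := hp weak (var hl.poly_mem)
  refine foldr (fun i l => encList ((TensorIso.sel (p i) l).map (enc i))) hl PT.nil ?_
    fun _ hx hst => ?_
  · exact (hl.1.reindex Sigma.fst).mono fun q => size_encList_sublist
      (((sel_sublist _).trans ((List.sublist_cons_self _ _).trans q.2.2.sublist)).map _)
  · refine (ite (hp'.reindex Pos.toMem).drop_state (hx.pair hst) hst).congr fun q => ?_
    by_cases hq : p q.1 q.2.1.1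
    · simp [sel_cons_of_pos hq, encList, hq, Pos.toMem]
    · simp [sel_cons_of_neg hq, hq, Pos.toMem]

theorem all {p : ∀ i, X i → Prop} (hl : PT μ e fun i => encList ((l i).map (enc i)))
    (hp : (∀ {g : ι → BTree}, PT μ e g → PT (fun q : Mem l => μ q.1)
        (fun q => .node (enc q.1 q.2.1) (e q.1)) (fun q => g q.1)) →
      PT (fun q : Mem l => μ q.1) (fun q => .node (enc q.1 q.2.1) (e q.1))
        (fun q => enc q.1 q.2.1) →
      PT (fun q : Mem l => μ q.1) (fun q => .node (enc q.1 q.2.1) (e q.1))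
        (fun q => bit (p q.1 q.2.1))) :
    PT μ e fun i => bit (∀ x ∈ l i, p i x) := by
  have hp' := hp weak (var hl.poly_mem)
  refine foldr (fun i l => bit (∀ x ∈ l, p i x)) hl (PT.true.congr fun i => by simp)
    ((PolyBdd.const 3).mono fun _ => size_bit_le _) fun _ _ hst => ?_
  refine ((hp'.reindex Pos.toMem).drop_state.and hst).congr fun q => ?_
  simp [Pos.toMem]

/-- The fold runs along the first list. Its state holds the pairs formed so far, in reverse, and the
unread part of the second list; the length hypothesis ensures that this part is never exhausted too
early. -/
theorem zip (hl : PT μ e fun i => encList ((l i).map (enc i)))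
    (hl' : PT μ e fun i => encList ((l' i).map (enc' i)))
    (hlen : ∀ i, (l i).length ≤ (l' i).length) :
    PT μ e fun i => encList (((l i).zip (l' i)).map
      fun z => .node (enc i z.1) (enc' i z.2)) := by
  let st : ι → ℕ → BTree := fun i j =>
    .node (encList ((((l i).zip (l' i)).take j).reverse.map
      fun z => .node (enc i z.1) (enc' i z.2))) (encList (((l' i).drop j).map (enc' i)))
  have hlen' : ∀ i, ((l i).zip (l' i)).length = (l i).length := fun i => by
    rw [List.length_zip, min_eq_left (hlen i)]
  have hmain : PT μ e fun i => st i (l i).length := by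
    refine foldl st hl ?_ ?_
    · exact (PT.nil.pair hl').congr fun i => by simp [st, encList]
    · have hx : PolyBdd (fun q : (i : ι) × Fin (l i).length => μ q.1)
          (fun q => (enc q.1 ((l q.1)[q.2])).size) :=
        hl.poly_mem.reindex fun q : (i : ι) × Fin (l i).length =>
          (⟨q.1, (l q.1)[q.2], List.getElem_mem _⟩ : (i : ι) × {x : X i // x ∈ l i})
      have hst : PolyBdd (fun q : (i : ι) × Fin (l i).length => μ q.1)
          (fun q => (st q.1 q.2).size) := by
        refine (((hl'.poly_length.mul (((hl.1.add hl'.1).add (PolyBdd.const 1)).add (PolyBdd.const 1))).add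
          (hl'.1.add (PolyBdd.const 2))).reindex Sigma.fst).mono fun q => ?_
        have h1 : (encList (((l' q.1).drop q.2).map (enc' q.1))).size ≤
            (encList ((l' q.1).map (enc' q.1))).size :=
          size_encList_sublist ((List.drop_sublist _ _).map _)
        have h2 := size_encList_le (l := (((l q.1).zip (l' q.1)).take q.2).reverse.map
          fun z => .node (enc q.1 z.1) (enc' q.1 z.2))
          (c := (encList ((l q.1).map (enc q.1))).size + (encList ((l' q.1).map (enc' q.1))).size
            + 1) fun x hx => by
            obtain ⟨z, hz, rfl⟩ := List.mem_map.1 hx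
            have hz' := List.mem_of_mem_take (List.mem_reverse.1 hz)
            have h1 := size_le_size_encList (List.mem_map_of_mem (f := enc q.1)
              (List.of_mem_zip hz').1)
            have h2 := size_le_size_encList (List.mem_map_of_mem (f := enc' q.1)
              (List.of_mem_zip hz').2)
            simp only [BTree.size]
            omega
        have h3 : ((((l q.1).zip (l' q.1)).take q.2).reverse.map
          fun z => BTree.node (enc q.1 z.1) (enc' q.1 z.2)).length ≤ (l' q.1).length := by
          simp
        have h4 := h2.trans (Nat.add_le_add_right (Nat.mul_le_mul_right _ h3) 1)
        simp only [st, BTree.size]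
        omega
      have h2 : PT (fun q : (i : ι) × Fin (l i).length => μ q.1)
          (fun q => .node (.node (enc q.1 ((l q.1)[q.2])) (st q.1 q.2)) (e q.1))
          (fun q => st q.1 q.2) := var₂ hst
      have hd : ∀ q : (i : ι) × Fin (l i).length,
          (l' q.1).drop q.2 = (l' q.1)[q.2]'(q.2.2.trans_le (hlen _)) ::
            (l' q.1).drop (q.2 + 1) := fun q =>
        List.drop_eq_getElem_cons (q.2.2.trans_le (hlen _))
      have h3 : PT (fun q : (i : ι) × Fin (l i).length => μ q.1)
          (fun q => .node (.node (enc q.1 ((l q.1)[q.2])) (st q.1 q.2)) (e q.1))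
          (fun q => .node (enc' q.1 ((l' q.1)[q.2]'(q.2.2.trans_le (hlen _))))
            (encList (((l' q.1).drop (q.2 + 1)).map (enc' q.1)))) :=
        h2.snd_of.congr fun q => by rw [hd]; rfl
      refine (((((var₁ hx).pair h3.fst_of).pair h2.fst_of)).pair h3.snd_of).congr fun q => ?_
      have hz : (q.2 : ℕ) < ((l q.1).zip (l' q.1)).length := q.2.2.trans_eq (hlen' _).symm
      simp only [st]
      rw [List.take_add_one, List.getElem?_eq_getElem hz]
      simp only [Option.toList_some, List.reverse_append, List.reverse_singleton,
        List.singleton_append, List.map_cons, encList, List.getElem_zip]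
      rfl
  refine (reverse (X := fun i => X i × Y i) (l := fun i => ((l i).zip (l' i)).reverse)
    (enc := fun i z => .node (enc i z.1) (enc' i z.2))
    (hmain.fst_of.congr fun i => ?_)).congr fun i => ?_
  · simp [List.take_of_length_le (hlen' i).le]
  · simp

end lists

/-! ### Arithmetic of unary numbers -/

section numbers

variable {a b : ι → ℕ}

theorem encNat_eq (k : ℕ) :
    encNat k = encList ((List.replicate k ()).map fun _ => BTree.nil) := by
  simp [encNat]

theorem poly_nat (ha : PT μ e fun i => encNat (a i)) : PolyBdd μ a :=
  ha.1.mono fun i => by rw [size_encNat]; omega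

/-- A unary number is a list of leaves, so recursion on it is a fold over that list. -/
theorem natRec (st : ι → ℕ → BTree) (ha : PT μ e fun i => encNat (a i))
    (h0 : PT μ e fun i => st i 0)
    (hs : PolyBdd (fun q : (i : ι) × Fin (a i) => μ q.1) fun q => (st q.1 q.2).size)
    (hstep : (∀ {g : ι → BTree}, PT μ e g → PT (fun q : (i : ι) × Fin (a i) => μ q.1)
        (fun q => .node (.node .nil (st q.1 q.2)) (e q.1)) (fun q => g q.1)) →
      PT (fun q : (i : ι) × Fin (a i) => μ q.1)
        (fun q => .node (.node .nil (st q.1 q.2)) (e q.1)) (fun q => st q.1 q.2) →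
      PT (fun q : (i : ι) × Fin (a i) => μ q.1)
        (fun q => .node (.node .nil (st q.1 q.2)) (e q.1)) (fun q => st q.1 (q.2 + 1))) :
    PT μ e fun i => st i (a i) := by
  refine (foldl (X := fun _ => Unit) (enc := fun _ _ => .nil)
    (l := fun i => List.replicate (a i) ()) st (ha.congr fun i => (encNat_eq _).symm)
    h0 ?_).congr fun i => by simp
  exact (hstep weak (var₂ hs)).reindex
    fun q : (i : ι) × Fin (List.replicate (a i) ()).length =>
      (⟨q.1, q.2.cast (by simp)⟩ : (i : ι) × Fin (a i))

theorem succ (ha : PT μ e fun i => encNat (a i)) : PT μ e fun i => encNat (a i + 1) :=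
  PT.nil.pair ha

theorem constNat (c : ℕ) : PT μ e fun _ => encNat c := by
  induction c with
  | zero => exact PT.nil
  | succ c ih => exact ih.succ

theorem add (ha : PT μ e fun i => encNat (a i)) (hb : PT μ e fun i => encNat (b i)) :
    PT μ e fun i => encNat (a i + b i) :=
  (ha.append hb).congr fun i => by rw [encNat, List.replicate_add]

theorem mul (ha : PT μ e fun i => encNat (a i)) (hb : PT μ e fun i => encNat (b i)) :
    PT μ e fun i => encNat (a i * b i) := by
  refine natRec (fun i j => encNat (j * b i)) ha (PT.nil.congr fun i => by simp [encNat, encList])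
    ?_ fun up hst => ?_
  · refine (((PolyBdd.const 2).mul (ha.poly_nat.mul hb.poly_nat)).add
      (PolyBdd.const 1)).reindex Sigma.fst |>.mono fun q => ?_
    rw [size_encNat]
    gcongr
    exact q.2.2.le
  · exact (hst.add (up hb)).congr fun q => by rw [add_mul, one_mul]

theorem pred (ha : PT μ e fun i => encNat (a i)) : PT μ e fun i => encNat (a i - 1) := by
  refine ha.comp (of_bdd (ha.1.mono fun i => by simp only [size_encNat]; omega) .snd
    (PolyBdd.const 1) fun i => ?_)
  cases a i with
  | zero => exact ⟨1, le_rfl, Runs.snd_nil⟩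
  | succ k => exact ⟨1, le_rfl, Runs.snd_node _ _⟩

theorem sub (ha : PT μ e fun i => encNat (a i)) (hb : PT μ e fun i => encNat (b i)) :
    PT μ e fun i => encNat (a i - b i) := by
  refine natRec (fun i j => encNat (a i - j)) hb ha ?_ fun _ hst => hst.pred
  refine (ha.1.reindex Sigma.fst).mono fun q => ?_
  simp only [size_encNat]
  omega

theorem isPos (ha : PT μ e fun i => encNat (a i)) : PT μ e fun i => bit (0 < a i) := by
  refine ha.comp (of_bdd ((PolyBdd.const 3).mono fun i => size_bit_le _)
    (.ite .id (.pair .nil .nil) .nil) (PolyBdd.const 5) fun i => ?_)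
  cases a i with
  | zero => exact ⟨3, by omega, by
      rw [bit, if_neg (lt_irrefl 0)]
      exact Runs.ite_false (Runs.id .nil) (Runs.nil _)⟩
  | succ k => exact ⟨_, le_rfl, by
      rw [bit, if_pos k.succ_pos]
      exact Runs.ite_true (Runs.id (.node .nil (encNat k))) (Runs.pair (Runs.nil _) (Runs.nil _))⟩

theorem lt (ha : PT μ e fun i => encNat (a i)) (hb : PT μ e fun i => encNat (b i)) :
    PT μ e fun i => bit (a i < b i) :=
  (hb.sub ha).isPos.congr fun i => by simp

theorem eq (ha : PT μ e fun i => encNat (a i)) (hb : PT μ e fun i => encNat (b i)) :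
    PT μ e fun i => bit (a i = b i) :=
  ((ha.lt hb).not.and (hb.lt ha).not).congr fun i => by congr 1; ext; omega

theorem length {X : ι → Type} {l : ∀ i, List (X i)} {enc : ∀ i, X i → BTree}
    (hl : PT μ e fun i => encList ((l i).map (enc i))) : PT μ e fun i => encNat (l i).length :=
  (map (f := fun _ _ => BTree.nil) hl fun _ _ => PT.nil).congr fun i => by
    rw [encNat, List.map_const']

end numbers

end PT

/-- The tree of an element of `ZMod p`. -/
def encZ {p : ℕ} (x : ZMod p) : BTree := encNat x.val

/-- The tree of a vector. -/
def encVec {p n : ℕ} (v : Vec p n) : BTree := encList ((List.ofFn v).map encZ)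

namespace PT

/-! ### Arithmetic in the prime field -/

section field

theorem zeroZ {ι : Type} {μ : ι → ℕ} {e : ι → BTree} {p : ι → ℕ} :
    PT μ e fun i => encZ (0 : ZMod (p i)) :=
  PT.nil.congr fun i => by simp [encZ, encNat, encList]

variable {ι : Type} {μ : ι → ℕ} {e : ι → BTree} {p n : ι → ℕ} [∀ i, NeZero (p i)]
  {x y : ∀ i, ZMod (p i)}

theorem poly_encZ (hp : PT μ e fun i => encNat (p i)) : PolyBdd μ fun i => (encZ (x i)).size :=
  hp.1.mono fun i => by
    rw [encZ, size_encNat, size_encNat]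
    have := ZMod.val_lt (x i)
    omega

/-- The only place where a program reduces modulo `p`: the successor of `p - 1` is replaced by `0`.
Addition iterates this operation, and multiplication iterates addition. -/
theorem succZ (hp : PT μ e fun i => encNat (p i)) (hx : PT μ e fun i => encZ (x i)) :
    PT μ e fun i => encZ (x i + 1) := by
  have hx' : PT μ e fun i => encNat ((x i).val) := hx
  refine (ite (hx'.succ.eq hp) PT.nil hx'.succ).congr fun i => ?_
  have h1 : ((x i).val + 1 : ℕ) = x i + 1 := by simp
  have h2 := ZMod.val_lt (x i)
  rw [← h1, encZ, ZMod.val_natCast]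
  split_ifs with h
  · rw [h, Nat.mod_self]; rfl
  · rw [Nat.mod_eq_of_lt (by omega)]

theorem addZ (hp : PT μ e fun i => encNat (p i)) (hx : PT μ e fun i => encZ (x i))
    (hy : PT μ e fun i => encZ (y i)) : PT μ e fun i => encZ (x i + y i) := by
  refine (natRec (a := fun i => (x i).val) (fun i j => encZ (y i + (j : ZMod (p i)))) hx
    (hy.congr fun i => by simp) (poly_encZ hp.weak (e := fun q => .node .nil (e q.1)))
    fun up hst => (succZ (up hp) hst).congr fun q => by push_cast; rw [add_assoc]).congr fun i => ?_
  rw [ZMod.natCast_zmod_val, add_comm]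

theorem mulZ (hp : PT μ e fun i => encNat (p i)) (hx : PT μ e fun i => encZ (x i))
    (hy : PT μ e fun i => encZ (y i)) : PT μ e fun i => encZ (x i * y i) := by
  refine (natRec (a := fun i => (x i).val) (fun i j => encZ ((j : ZMod (p i)) * y i)) hx
    (PT.nil.congr fun i => by simp [encZ, encNat, encList])
    (poly_encZ hp.weak (e := fun q => .node .nil (e q.1)))
    fun up hst => (addZ (up hp) hst (up hy)).congr fun q => by
      push_cast; rw [add_mul, one_mul]).congr fun i => ?_
  rw [ZMod.natCast_zmod_val]

theorem eqZ (hx : PT μ e fun i => encZ (x i)) (hy : PT μ e fun i => encZ (y i)) :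
    PT μ e fun i => bit (x i = y i) :=
  (eq (a := fun i => (x i).val) (b := fun i => (y i).val) hx hy).congr fun i => by
    congr 1; ext; exact (ZMod.val_injective _).eq_iff.symm

theorem dot {v w : ∀ i, Vec (p i) (n i)} (hp : PT μ e fun i => encNat (p i))
    (hv : PT μ e fun i => encVec (v i)) (hw : PT μ e fun i => encVec (w i)) :
    PT μ e fun i => encZ (v i ⬝ᵥ w i) := by
  refine (foldr (X := fun i => ZMod (p i) × ZMod (p i))
    (l := fun i => (List.ofFn (v i)).zip (List.ofFn (w i)))
    (enc := fun i z => .node (encZ z.1) (encZ z.2))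
    (fun i l => encZ (l.map fun z => z.1 * z.2).sum) (hv.zip hw fun i => by simp) ?_
    (poly_encZ hp.weak (e := fun q => .node .nil (e q.1))) fun up hz hst => ?_).congr fun i => ?_
  · simpa using zeroZ
  · exact addZ (up hp) (mulZ (up hp) hz.fst_of hz.snd_of) hst
  · have : ((List.ofFn (v i)).zip (List.ofFn (w i))).map (fun z => z.1 * z.2) =
        List.ofFn fun k => v i k * w i k := by
      apply List.ext_getElem <;> simp
    rw [this, List.sum_ofFn]
    rfl

end field

end PT

/-! ### The objects computed by the reduction -/

/-- All elements of `ZMod p`. -/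
def elems (p : ℕ) : List (ZMod p) := (List.range p).reverse.map Nat.cast

/-- All families of length `k` of elements of a list. -/
def families {α : Type} (l : List α) : (k : ℕ) → List (Fin k → α)
  | 0 => [Fin.elim0]
  | k + 1 => l.flatMap fun x => (families l k).map (Fin.cons x)

/-- All vectors. -/
def vecs (p n : ℕ) : List (Vec p n) := families (elems p) n

/-- The trilinear form of a tensor. -/
def tri {p m n : ℕ} (G : Tensor p m n) (u : Vec p m) (v w : Vec p n) : ZMod p :=
  u ⬝ᵥ fun i => v ⬝ᵥ fun j => w ⬝ᵥ G i j

/-- The vectors orthogonal to a list of vectors. -/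
noncomputable def perp {p n : ℕ} (l : List (Vec p n)) : List (Vec p n) :=
  sel (fun v => ∀ x ∈ l, x ⬝ᵥ v = 0) (vecs p n)

/-- The span of a list of vectors. -/
def lspan {p n : ℕ} (l : List (Vec p n)) : Submodule (ZMod p) (Vec p n) :=
  Submodule.span (ZMod p) {x | x ∈ l}

open Classical in
/-- Going through a list of vectors from its end, keep those that are not in the span of the base
and of the vectors kept before. -/
noncomputable def greedy {p n : ℕ} (base : List (Vec p n)) : List (Vec p n) → List (Vec p n)
  | [] => []
  | x :: l => if x ∈ lspan (base ++ greedy base l) then greedy base l else x :: greedy base l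

/-- Sorting in descending order. -/
noncomputable def descSort {α : Type} (le : α → α → Prop) : List α → List α
  | [] => []
  | x :: l => sel (fun y => ¬ le y x) (descSort le l) ++ x :: sel (fun y => le y x) (descSort le l)

/-- Lexicographic comparison of the first components with the second components. -/
def lexZip {p : ℕ} : List (ZMod p × ZMod p) → Prop
  | [] => True
  | z :: l => z.1.val < z.2.val ∨ z.1 = z.2 ∧ lexZip l

/-- Lexicographic comparison of lists of equal length. -/
def lexLE {p : ℕ} (a b : List (ZMod p)) : Prop := lexZip (a.zip b)

/-- The first rows of a formatting matrix: representatives modulo `R` of a basis of `K` that is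
chosen greedily with respect to the keys; `C` spans a complement of `K`. -/
noncomputable def mainRows {p n : ℕ} (key : Vec p n → List (ZMod p)) (K R C : List (Vec p n)) :
    List (Vec p n) :=
  (greedy (R ++ C) (descSort (fun v w => lexLE (key v) (key w)) K)).reverse

/-- The rows of a formatting matrix. -/
noncomputable def formatRows {p n : ℕ} (key : Vec p n → List (ZMod p)) (K R C : List (Vec p n)) :
    List (Vec p n) :=
  mainRows key K R C ++ (greedy (mainRows key K R C ++ C) R ++ C)

/-- The data that determine a characterization tuple. -/
structure TupleData (p m n : ℕ) where
  Ls : List (Vec p n)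
  L : List (Vec p m)
  Λ₀ : List (Vec p n)
  Cs₁ : List (Vec p n)
  Cs₂ : List (Vec p n)
  C₀ : List (Vec p m)

namespace TupleData

variable {p m n : ℕ} (D : TupleData p m n) (G : Tensor p m n)

noncomputable def Λ : List (Vec p n) := greedy [] D.Λ₀

noncomputable def zeroX : List (Vec p m) :=
  sel (fun u => ∀ x ∈ D.Ls, ∀ y ∈ D.Ls, tri G u x y = 0) (vecs p m)

noncomputable def zeroY : List (Vec p n) :=
  sel (fun v => ∀ x ∈ D.L, ∀ y ∈ D.Ls, tri G x v y = 0) (vecs p n)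

/-- Testing against `perp D.Λ` expresses membership of `v ᵥ* A` in the span of the attribute set, by
`mem_lspan_iff`. -/
noncomputable def KX : List (Vec p n) :=
  sel (fun v => ∀ u ∈ D.zeroX G, ∀ w ∈ perp D.Λ, tri G u v w = 0) (perp D.Λ)

noncomputable def KY : List (Vec p m) :=
  sel (fun u => ∀ v ∈ D.zeroY G, ∀ w ∈ perp D.Λ, tri G u v w = 0) (vecs p m)

/-- These vectors contribute nothing to the space spanned by the `Y`-slices, so a semi-canonical
basis determines rows only modulo them. -/
noncomputable def RX : List (Vec p n) :=
  sel (fun v => ∀ u ∈ vecs p m, ∀ w ∈ vecs p n, tri G u v w = 0) (D.KX G)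

noncomputable def RY : List (Vec p m) :=
  sel (fun u => ∀ v ∈ vecs p n, ∀ w ∈ vecs p n, tri G u v w = 0) (D.KY G)

/-- As `greedy` reads from the end, admissible candidates from `Cs₁` have priority and `perp D.Λ`
only fills up. Hence arbitrary data produce a valid tuple, so the program needs no validity check,
while a correct prescribed complement is kept as it is. -/
noncomputable def C₁ : List (Vec p n) :=
  greedy (D.KX G) (perp D.Λ ++ sel (fun v => ∀ x ∈ D.Λ, x ⬝ᵥ v = 0) D.Cs₁)

/-- The orthogonal space of `Λ` has codimension at most `|Λ|`, so these vectors fit into the last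
`|Λ|` rows, the only rows that need not be orthogonal to `Λ`. -/
noncomputable def C₂ : List (Vec p n) :=
  greedy (D.KX G ++ D.C₁ G) (vecs p n ++ D.Cs₂)

noncomputable def Cs : List (Vec p n) := D.C₁ G ++ D.C₂ G

noncomputable def C : List (Vec p m) := greedy (D.KY G) (vecs p m ++ D.C₀)

def keyY (v : Vec p n) : List (ZMod p) := D.L.flatMap fun x => D.Ls.map fun y => tri G x v y

def keyX (u : Vec p m) : List (ZMod p) := D.Ls.flatMap fun x => D.Ls.map fun y => tri G u x y

noncomputable def mainN : List (Vec p n) := mainRows (D.keyY G) (D.KX G) (D.RX G) (D.Cs G)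

noncomputable def mainM : List (Vec p m) := mainRows (D.keyX G) (D.KY G) (D.RY G) (D.C G)

noncomputable def rowsN : List (Vec p n) := formatRows (D.keyY G) (D.KX G) (D.RX G) (D.Cs G)

noncomputable def rowsM : List (Vec p m) := formatRows (D.keyX G) (D.KY G) (D.RY G) (D.C G)

/-- The semi-canonical form determined by the data. -/
noncomputable def form : ParamTensor p m n where
  tensor i j k := tri G ((D.rowsM G).getD i 0) ((D.rowsN G).getD j 0) ((D.rowsN G).getD k 0)
  αX := (sel (fun u => ∀ c ∈ D.keyX G u, c = 0) (D.mainM G)).length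
  βX := (sel (fun u => ¬ ∀ c ∈ D.keyX G u, c = 0) (D.mainM G)).length
  αY := (sel (fun v => ∀ c ∈ D.keyY G v, c = 0) (D.mainN G)).length
  βY := (sel (fun v => ¬ ∀ c ∈ D.keyY G v, c = 0) (D.mainN G)).length

end TupleData

theorem encVec_eq {p n : ℕ} (v : Vec p n) :
    encList (List.ofFn fun k => encNat (v k).val) = encVec v := by
  rw [encVec, List.map_ofFn]; rfl

theorem encTensor_eq {p m n : ℕ} (G : Tensor p m n) :
    encTensor G = encList ((List.ofFn G).map fun r => encList ((List.ofFn r).map encVec)) := by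
  simp only [encTensor, encVec_eq, List.map_ofFn]
  rfl

/-! ### Enumeration of vectors, and spans by double orthogonality -/

section span

variable {p n : ℕ}

theorem mem_elems [NeZero p] (x : ZMod p) : x ∈ elems p := by
  simp only [elems, List.mem_map, List.mem_reverse, List.mem_range]
  exact ⟨x.val, ZMod.val_lt x, ZMod.natCast_zmod_val x⟩

theorem mem_families {α : Type} {l : List α} {k : ℕ} {f : Fin k → α} :
    f ∈ families l k ↔ ∀ i, f i ∈ l := by
  induction k with
  | zero => simp [families, Subsingleton.elim f Fin.elim0]
  | succ k ih =>
    simp only [families, List.mem_flatMap, List.mem_map]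
    constructor
    · rintro ⟨x, hx, g, hg, rfl⟩ i
      refine Fin.cases hx (fun j => ?_) i
      simpa using ih.1 hg j
    · intro h
      exact ⟨f 0, h 0, Fin.tail f, ih.2 fun i => h i.succ, Fin.cons_self_tail f⟩

theorem length_families {α : Type} (l : List α) (k : ℕ) :
    (families l k).length = l.length ^ k := by
  induction k with
  | zero => simp [families]
  | succ k ih => simp [families, List.length_flatMap, ih, pow_succ, mul_comm]

theorem mem_vecs [NeZero p] (v : Vec p n) : v ∈ vecs p n := mem_families.2 fun _ => mem_elems _

theorem mem_perp [NeZero p] {l : List (Vec p n)} {v : Vec p n} :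
    v ∈ perp l ↔ ∀ x ∈ l, x ⬝ᵥ v = 0 := by
  simp [perp, mem_sel, mem_vecs]

/-- A linear functional that kills the list but not `v` is the dot product with some vector, and all
vectors are enumerated. Membership in a span thus becomes a finite test that needs no elimination.
-/
theorem mem_lspan_iff [Fact p.Prime] {l : List (Vec p n)} {v : Vec p n} :
    v ∈ lspan l ↔ ∀ w ∈ perp l, v ⬝ᵥ w = 0 := by
  constructor
  · intro hv w hw
    rw [mem_perp] at hw
    refine Submodule.span_induction (p := fun v _ => v ⬝ᵥ w = 0) hw (zero_dotProduct w)
      (fun x y _ _ hx hy => by rw [add_dotProduct, hx, hy, add_zero])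
      (fun c x _ hx => by rw [smul_dotProduct, hx, smul_zero]) hv
  · intro h
    by_contra hv
    obtain ⟨f, hf, hf'⟩ := Submodule.exists_dual_map_eq_bot_of_notMem hv inferInstance
    have key : ∀ x : Vec p n, x ⬝ᵥ (fun i => f (Pi.single i 1)) = f x := by
      intro x
      conv_rhs => rw [pi_eq_sum_univ' x, map_sum]
      simp [dotProduct]
    refine hf ?_
    rw [← key]
    refine h _ (mem_perp.2 fun x hx => ?_)
    rw [key]
    have : f x ∈ (lspan l).map f := ⟨x, Submodule.subset_span hx, rfl⟩
    rwa [hf', Submodule.mem_bot] at this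

end span

namespace PT

/-! ### Programs for the trilinear form, greedy choice, sorting and formatting rows -/

section

variable {ι : Type} {μ : ι → ℕ} {e : ι → BTree} {p m n : ι → ℕ}

theorem tri [∀ i, NeZero (p i)] {G : ∀ i, Tensor (p i) (m i) (n i)} {u : ∀ i, Vec (p i) (m i)}
    {v w : ∀ i, Vec (p i) (n i)} (hp : PT μ e fun i => encNat (p i))
    (hG : PT μ e fun i => encTensor (G i)) (hu : PT μ e fun i => encVec (u i))
    (hv : PT μ e fun i => encVec (v i)) (hw : PT μ e fun i => encVec (w i)) :
    PT μ e fun i => encZ (TensorIso.tri (G i) (u i) (v i) (w i)) := by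
  refine dot hp hu ((map (X := fun i => Fin (n i) → Vec (p i) (n i))
    (f := fun i r => encZ (v i ⬝ᵥ fun j => w i ⬝ᵥ r j))
    (enc := fun i r => encList ((List.ofFn r).map encVec)) (l := fun i => List.ofFn (G i))
    (hG.congr fun i => (encTensor_eq _).symm) fun up hr => ?_).congr fun i => ?_)
  · refine dot (up hp) (up hv) ((map (X := fun q => Vec (p q.1) (n q.1))
      (f := fun q x => encZ (w q.1 ⬝ᵥ x)) hr fun up' hx => ?_).congr fun q => ?_)
    · exact dot (up' (up hp)) (up' (up hw)) hx
    · rw [encVec, List.map_ofFn, List.map_ofFn]; rfl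
  · rw [encVec, List.map_ofFn, List.map_ofFn]; rfl

theorem perp [∀ i, NeZero (p i)] {l : ∀ i, List (Vec (p i) (n i))}
    (hp : PT μ e fun i => encNat (p i))
    (hV : PT μ e fun i => encList ((vecs (p i) (n i)).map encVec))
    (hl : PT μ e fun i => encList ((l i).map encVec)) :
    PT μ e fun i => encList ((TensorIso.perp (l i)).map encVec) :=
  sel hV fun up hv => all (up hl) fun up' hx => eqZ (dot (up' (up hp)) hx (up' hv)) zeroZ

theorem appendMap {X : ι → Type} {enc : ∀ i, X i → BTree} {a b : ∀ i, List (X i)}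
    (ha : PT μ e fun i => encList ((a i).map (enc i)))
    (hb : PT μ e fun i => encList ((b i).map (enc i))) :
    PT μ e fun i => encList ((a i ++ b i).map (enc i)) :=
  (ha.append hb).congr fun i => by rw [List.map_append]

theorem _root_.TensorIso.greedy_sublist {p n : ℕ} (base l : List (Vec p n)) :
    (greedy base l).Sublist l := by
  induction l with
  | nil => exact List.Sublist.refl _
  | cons x l ih =>
    rw [greedy]
    split_ifs
    · exact ih.cons x
    · exact ih.cons_cons x

theorem greedy [∀ i, Fact (p i).Prime] {b l : ∀ i, List (Vec (p i) (n i))}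
    (hp : PT μ e fun i => encNat (p i))
    (hV : PT μ e fun i => encList ((vecs (p i) (n i)).map encVec))
    (hb : PT μ e fun i => encList ((b i).map encVec))
    (hl : PT μ e fun i => encList ((l i).map encVec)) :
    PT μ e fun i => encList ((TensorIso.greedy (b i) (l i)).map encVec) := by
  refine foldr (fun i l => encList ((TensorIso.greedy (b i) l).map encVec)) hl PT.nil ?_
    fun up hx hst => ?_
  · exact (hl.1.reindex Sigma.fst).mono fun q => size_encList_sublist
      (((greedy_sublist _ _).trans ((List.sublist_cons_self _ _).trans q.2.2.sublist)).map _)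
  · refine (ite (all (p := fun q w => q.2.1.1 ⬝ᵥ w = 0) (perp (up hp) (up hV) (appendMap (up hb) hst))
      fun up' hw => eqZ (dot (up' (up hp)) (up' hx) hw) zeroZ) hst (hx.pair hst)).congr fun q => ?_
    rw [TensorIso.greedy]
    simp only [mem_lspan_iff]
    split_ifs <;> rfl

theorem lexZip [∀ i, NeZero (p i)] {l : ∀ i, List (ZMod (p i) × ZMod (p i))}
    (hl : PT μ e fun i => encList ((l i).map fun z => .node (encZ z.1) (encZ z.2))) :
    PT μ e fun i => bit (TensorIso.lexZip (l i)) := by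
  refine foldr (fun i l => bit (TensorIso.lexZip l)) hl PT.true
    ((PolyBdd.const 3).mono fun _ => size_bit_le _) fun _ hz hst => ?_
  refine or (lt hz.fst_of hz.snd_of) (and ?_ hst)
  exact eqZ hz.fst_of hz.snd_of

theorem lexLE [∀ i, NeZero (p i)] {a b : ∀ i, List (ZMod (p i))}
    (ha : PT μ e fun i => encList ((a i).map encZ)) (hb : PT μ e fun i => encList ((b i).map encZ))
    (h : ∀ i, (a i).length ≤ (b i).length) : PT μ e fun i => bit (TensorIso.lexLE (a i) (b i)) :=
  lexZip (ha.zip hb h)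

theorem _root_.TensorIso.descSort_perm {α : Type} (le : α → α → Prop) (l : List α) :
    (descSort le l).Perm l := by
  induction l with
  | nil => exact List.Perm.refl _
  | cons x l ih =>
    rw [descSort]
    refine List.perm_middle.trans ((List.Perm.cons x ?_).trans (ih.cons x))
    refine List.perm_append_comm.trans ?_
    classical
    have h := List.filter_append_perm (fun y => decide (le y x)) (descSort le l)
    have h' : TensorIso.sel (fun y => ¬ le y x) (descSort le l) =
        (descSort le l).filter fun y => !decide (le y x) :=
      List.filter_congr fun y _ => by by_cases hy : le y x <;> simp [hy]
    rw [h']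
    convert h using 2
    exact List.filter_congr fun y _ => by congr

theorem _root_.TensorIso.descSort_map {α β : Type} (le : β → β → Prop) (f : α → β) (l : List α) :
    descSort le (l.map f) = (descSort (fun a b => le (f a) (f b)) l).map f := by
  induction l with
  | nil => rfl
  | cons x l ih =>
    rw [List.map_cons, descSort, descSort, ih, List.map_append, List.map_cons]
    simp only [TensorIso.sel, List.filter_map]
    rfl

theorem _root_.TensorIso.size_encList_perm {l l' : List BTree} (h : l.Perm l') :
    (encList l).size = (encList l').size := by
  induction h with
  | nil => rfl
  | cons x _ ih => rw [size_encList_cons, size_encList_cons, ih]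
  | swap x y l => simp only [size_encList_cons]; omega
  | trans _ _ ih ih' => exact ih.trans ih'

/-- The tree of a vector with a key. -/
def _root_.TensorIso.encKeyed {p n : ℕ} (z : List (ZMod p) × Vec p n) : BTree :=
  .node (encList (z.1.map encZ)) (encVec z.2)

/-- The keys are computed once and travel with their vectors. They are required to have a common
length because the comparison zips them. -/
theorem descSort [∀ i, NeZero (p i)] {c : ι → ℕ} {l : ∀ i, List (List (ZMod (p i)) × Vec (p i) (n i))}
    (hl : PT μ e fun i => encList ((l i).map encKeyed))
    (hc : ∀ i, ∀ z ∈ l i, z.1.length = c i) :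
    PT μ e fun i => encList ((TensorIso.descSort (fun z z' => TensorIso.lexLE z.1 z'.1)
      (l i)).map encKeyed) := by
  refine foldr (fun i l => encList ((TensorIso.descSort (fun z z' => TensorIso.lexLE z.1 z'.1)
    l).map encKeyed)) hl PT.nil ?_ fun up hx hst => ?_
  · refine (hl.1.reindex Sigma.fst).mono fun q => ?_
    rw [size_encList_perm ((descSort_perm _ _).map _)]
    exact size_encList_sublist (((List.sublist_cons_self _ _).trans q.2.2.sublist).map _)
  · have key := fun {r : ∀ q : Pos l, List (ZMod (p q.1)) × Vec (p q.1) (n q.1) → Prop} h =>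
      sel (p := r) hst h
    refine appendMap (sel hst fun up' hy => not (lexLE hy.fst_of (up' hx).fst_of ?_))
      (pair hx (sel (p := fun q y => TensorIso.lexLE y.1 q.2.1.1.1) hst
        fun up' hy => lexLE hy.fst_of (up' hx).fst_of ?_))
    all_goals
      intro q
      rw [hc q.1.1 _ (q.1.2.2.subset List.mem_cons_self), hc q.1.1 _ (q.1.2.2.subset
        (List.mem_cons_of_mem _ ((descSort_perm _ _).subset q.2.2)))]

theorem mainRows [∀ i, Fact (p i).Prime] {c : ι → ℕ} {key : ∀ i, Vec (p i) (n i) → List (ZMod (p i))}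
    {K R C : ∀ i, List (Vec (p i) (n i))} (hp : PT μ e fun i => encNat (p i))
    (hV : PT μ e fun i => encList ((vecs (p i) (n i)).map encVec))
    (hK : PT μ e fun i => encList (((K i).map fun v => (key i v, v)).map encKeyed))
    (hc : ∀ i v, (key i v).length = c i)
    (hR : PT μ e fun i => encList ((R i).map encVec))
    (hC : PT μ e fun i => encList ((C i).map encVec)) :
    PT μ e fun i => encList ((TensorIso.mainRows (key i) (K i) (R i) (C i)).map encVec) := by
  refine (greedy hp hV (appendMap hR hC) ?_).reverse
  refine (map (f := fun _ z => encVec z.2) (descSort hK (c := c) ?_)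
    fun _ hz => hz.snd_of).congr fun i => ?_
  · intro i z hz
    obtain ⟨v, _, rfl⟩ := List.mem_map.1 hz
    exact hc i v
  · rw [descSort_map, List.map_map]
    rfl

theorem formatRows [∀ i, Fact (p i).Prime] {c : ι → ℕ}
    {key : ∀ i, Vec (p i) (n i) → List (ZMod (p i))}
    {K R C : ∀ i, List (Vec (p i) (n i))} (hp : PT μ e fun i => encNat (p i))
    (hV : PT μ e fun i => encList ((vecs (p i) (n i)).map encVec))
    (hK : PT μ e fun i => encList (((K i).map fun v => (key i v, v)).map encKeyed))
    (hc : ∀ i v, (key i v).length = c i)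
    (hR : PT μ e fun i => encList ((R i).map encVec))
    (hC : PT μ e fun i => encList ((C i).map encVec)) :
    PT μ e fun i => encList ((TensorIso.formatRows (key i) (K i) (R i) (C i)).map encVec) :=
  have hm := mainRows hp hV hK hc hR hC
  appendMap hm (appendMap (greedy hp hV (appendMap hm hC) hR) hC)

end

/-! ### Programs for the kernels and complements of a characterization tuple -/

section tuple

variable {ι : Type} {μ : ι → ℕ} {e : ι → BTree} {p m n : ι → ℕ} [∀ i, Fact (p i).Prime]
  {G : ∀ i, Tensor (p i) (m i) (n i)} {D : ∀ i, TupleData (p i) (m i) (n i)}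

/-- The data that the semi-canonical form is computed from are available. -/
structure TupleInput (μ : ι → ℕ) (e : ι → BTree) (G : ∀ i, Tensor (p i) (m i) (n i))
    (D : ∀ i, TupleData (p i) (m i) (n i)) : Prop where
  hp : PT μ e fun i => encNat (p i)
  hV : PT μ e fun i => encList ((vecs (p i) (n i)).map encVec)
  hU : PT μ e fun i => encList ((vecs (p i) (m i)).map encVec)
  hG : PT μ e fun i => encTensor (G i)
  Ls : PT μ e fun i => encList ((D i).Ls.map encVec)
  L : PT μ e fun i => encList ((D i).L.map encVec)
  Λ₀ : PT μ e fun i => encList ((D i).Λ₀.map encVec)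
  Cs₁ : PT μ e fun i => encList ((D i).Cs₁.map encVec)
  Cs₂ : PT μ e fun i => encList ((D i).Cs₂.map encVec)
  C₀ : PT μ e fun i => encList ((D i).C₀.map encVec)

namespace TupleInput

theorem hΛ (H : TupleInput μ e G D) : PT μ e fun i => encList ((D i).Λ.map encVec) :=
  greedy H.hp H.hV nil H.Λ₀

theorem perpΛ (H : TupleInput μ e G D) : PT μ e fun i => encList ((TensorIso.perp (D i).Λ).map encVec) :=
  perp H.hp H.hV H.hΛ

theorem zeroX (H : TupleInput μ e G D) :
    PT μ e fun i => encList (((D i).zeroX (G i)).map encVec) :=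
  sel H.hU fun up hu => all (up H.Ls) fun up' hx =>
      all (up' (up H.Ls)) fun up'' hy =>
        eqZ (tri (up'' (up' (up H.hp))) (up'' (up' (up H.hG))) (up'' (up' hu)) (up'' hx) hy)
          zeroZ

theorem zeroY (H : TupleInput μ e G D) :
    PT μ e fun i => encList (((D i).zeroY (G i)).map encVec) :=
  sel H.hV fun up hv => all (up H.L) fun up' hx =>
      all (up' (up H.Ls)) fun up'' hy =>
        eqZ (tri (up'' (up' (up H.hp))) (up'' (up' (up H.hG))) (up'' hx) (up'' (up' hv)) hy)
          zeroZ

theorem KX (H : TupleInput μ e G D) : PT μ e fun i => encList (((D i).KX (G i)).map encVec) :=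
  sel H.perpΛ fun up hv => all (up H.zeroX)
    fun up' hu => all (up' (up H.perpΛ)) fun up'' hw =>
      eqZ (tri (up'' (up' (up H.hp))) (up'' (up' (up H.hG))) (up'' hu) (up'' (up' hv)) hw) zeroZ

theorem KY (H : TupleInput μ e G D) : PT μ e fun i => encList (((D i).KY (G i)).map encVec) :=
  sel H.hU fun up hu => all (up H.zeroY)
    fun up' hv => all (up' (up H.perpΛ)) fun up'' hw =>
      eqZ (tri (up'' (up' (up H.hp))) (up'' (up' (up H.hG))) (up'' (up' hu)) (up'' hv) hw) zeroZ

theorem RX (H : TupleInput μ e G D) : PT μ e fun i => encList (((D i).RX (G i)).map encVec) :=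
  sel H.KX fun up hv => all (up H.hU) fun up' hu => all (up' (up H.hV)) fun up'' hw =>
    eqZ (tri (up'' (up' (up H.hp))) (up'' (up' (up H.hG))) (up'' hu) (up'' (up' hv)) hw) zeroZ

theorem RY (H : TupleInput μ e G D) : PT μ e fun i => encList (((D i).RY (G i)).map encVec) :=
  sel H.KY fun up hu => all (up H.hV) fun up' hv => all (up' (up H.hV)) fun up'' hw =>
    eqZ (tri (up'' (up' (up H.hp))) (up'' (up' (up H.hG))) (up'' (up' hu)) (up'' hv) hw) zeroZ

theorem C₁ (H : TupleInput μ e G D) : PT μ e fun i => encList (((D i).C₁ (G i)).map encVec) :=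
  greedy H.hp H.hV H.KX (appendMap H.perpΛ (sel H.Cs₁ fun up hv =>
    all (up H.hΛ) fun up' hx =>
      eqZ (dot (up' (up H.hp)) hx (up' hv)) zeroZ))

theorem Cs (H : TupleInput μ e G D) : PT μ e fun i => encList (((D i).Cs (G i)).map encVec) :=
  appendMap H.C₁ (greedy H.hp H.hV (appendMap H.KX H.C₁) (appendMap H.hV H.Cs₂))

theorem C (H : TupleInput μ e G D) : PT μ e fun i => encList (((D i).C (G i)).map encVec) :=
  greedy H.hp H.hU H.KY (appendMap H.hU H.C₀)

end TupleInput

end tuple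

end PT

/-! ### Lexicographic comparison -/

section lex

variable {p : ℕ}

theorem lexLE_append_left (c a b : List (ZMod p)) : lexLE (c ++ a) (c ++ b) ↔ lexLE a b := by
  induction c with
  | nil => rfl
  | cons x c ih =>
    rw [← ih]
    simp [lexLE, lexZip]

theorem lexLE_cons {x y : ZMod p} {a b : List (ZMod p)} :
    lexLE (x :: a) (y :: b) ↔ x.val < y.val ∨ x = y ∧ lexLE a b := Iff.rfl

theorem lexLE_refl (a : List (ZMod p)) : lexLE a a := by
  induction a with
  | nil => trivial
  | cons x a ih => exact Or.inr ⟨rfl, ih⟩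

/-- The entries of a matrix, row by row. -/
def flat {m n : ℕ} (A : Fin m → Fin n → ZMod p) : List (ZMod p) :=
  (List.ofFn A).flatMap fun r => List.ofFn r

/-- The rows above `q` and the entries left of `r` in row `q` form a common prefix of the two lists;
the entry that follows decides the comparison in both directions. -/
theorem lexLE_flat_of_lt {m n : ℕ} {A B : Fin m → Fin n → ZMod p} {q : Fin m} {r : Fin n}
    (h : ∀ i j, (i < q ∨ (i = q ∧ j < r)) → A i j = B i j) (hlt : (A q r).val < (B q r).val) :
    lexLE (flat A) (flat B) ∧ ¬ lexLE (flat B) (flat A) := by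
  have row : ∀ M : Fin m → Fin n → ZMod p, List.ofFn (M q) =
      (List.ofFn (M q)).take r ++ M q r :: (List.ofFn (M q)).drop (r + 1) := by
    intro M
    conv_lhs => rw [← List.take_append_drop r (List.ofFn (M q)),
      List.drop_eq_getElem_cons (by simp)]
    simp
  have split : ∀ M : Fin m → Fin n → ZMod p, flat M =
      (((List.ofFn M).take q).flatMap (fun r => List.ofFn r) ++ (List.ofFn (M q)).take r) ++
      M q r :: ((List.ofFn (M q)).drop (r + 1) ++
        ((List.ofFn M).drop (q + 1)).flatMap fun r => List.ofFn r) := by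
    intro M
    have h1 : List.ofFn M = (List.ofFn M).take q ++ M q :: (List.ofFn M).drop (q + 1) := by
      conv_lhs => rw [← List.take_append_drop q (List.ofFn M),
        List.drop_eq_getElem_cons (by simp)]
      simp
    conv_lhs => rw [flat, h1, List.flatMap_append, List.flatMap_cons, row]
    simp
  have e1 : (List.ofFn A).take q = (List.ofFn B).take q := by
    refine List.ext_getElem (by simp) fun i hi _ => ?_
    rw [List.length_take] at hi
    simp only [List.getElem_take, List.getElem_ofFn]
    exact funext fun j => h _ _ (Or.inl (Fin.lt_def.2 (by simp only; omega)))
  have e2 : (List.ofFn (A q)).take r = (List.ofFn (B q)).take r := by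
    refine List.ext_getElem (by simp) fun i hi _ => ?_
    rw [List.length_take] at hi
    simp only [List.getElem_take, List.getElem_ofFn]
    exact h _ _ (Or.inr ⟨rfl, Fin.lt_def.2 (by simp only; omega)⟩)
  rw [split A, split B, e1, e2, lexLE_append_left, lexLE_append_left, lexLE_cons, lexLE_cons]
  refine ⟨Or.inl hlt, ?_⟩
  rintro (h' | ⟨h', _⟩)
  · omega
  · rw [h'] at hlt
    exact lt_irrefl _ hlt

theorem LexLT.flat {m n : ℕ} {A B : Mat p m n} (h : LexLT A B) :
    lexLE (flat A) (flat B) ∧ ¬ lexLE (TensorIso.flat B) (TensorIso.flat A) := by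
  obtain ⟨q, r, h, hlt⟩ := h
  exact lexLE_flat_of_lt h hlt

/-- The entries of a matrix as an element of a lexicographic product. -/
def lexKey {m n : ℕ} (A : Mat p m n) : Lex (Fin m ×ₗ Fin n → ℕ) :=
  toLex fun q => (A (ofLex q).1 (ofLex q).2).val

/-- Embedding matrices into a linearly ordered lexicographic product supplies totality, transitivity
and antisymmetry of the order. -/
theorem lexLT_iff [NeZero p] {m n : ℕ} {A B : Mat p m n} : LexLT A B ↔ lexKey A < lexKey B := by
  constructor
  · rintro ⟨q, r, h, hlt⟩
    refine ⟨toLex (q, r), fun s hs => ?_, hlt⟩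
    show (A _ _).val = (B _ _).val
    rw [h]
    exact (Prod.Lex.lt_iff (x := s)).1 hs
  · rintro ⟨s, hs, hlt⟩
    refine ⟨(ofLex s).1, (ofLex s).2, fun i j hij => ZMod.val_injective _ ?_, hlt⟩
    exact hs (toLex (i, j)) (Prod.Lex.lt_iff.2 hij)

theorem lexKey_injective [NeZero p] {m n : ℕ} :
    Function.Injective (lexKey : Mat p m n → _) := by
  intro A B h
  ext i j
  exact ZMod.val_injective _ (congrFun (congrArg ofLex h) (toLex (i, j)))

theorem lexLE_iff [NeZero p] {m n : ℕ} {A B : Mat p m n} : LexLE A B ↔ lexKey A ≤ lexKey B := by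
  rw [LexLE, lexLT_iff, le_iff_lt_or_eq, lexKey_injective.eq_iff]
  exact Iff.rfl

theorem lexLE_flat_iff [NeZero p] {m n : ℕ} {A B : Mat p m n} :
    lexLE (flat A) (flat B) ↔ LexLE A B := by
  rcases lt_trichotomy (lexKey A) (lexKey B) with h | h | h
  · exact iff_of_true (lexLT_iff.2 h).flat.1 (lexLE_iff.2 h.le)
  · obtain rfl := lexKey_injective h
    exact iff_of_true (lexLE_refl _) (Or.inr rfl)
  · exact iff_of_false (lexLT_iff.2 h).flat.2 (by rw [lexLE_iff]; exact not_le.2 h)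

end lex

/-! ### Sorting -/

theorem descSort_pairwise {α : Type} {le : α → α → Prop} (htot : ∀ a b, le a b ∨ le b a)
    (htrans : ∀ a b c, le a b → le b c → le a c) (l : List α) :
    (descSort le l).Pairwise fun a b => le b a := by
  induction l with
  | nil => exact List.Pairwise.nil
  | cons x l ih =>
    rw [descSort, List.pairwise_append, List.pairwise_cons]
    have hx : ∀ y, ¬ le y x → le x y := fun y hy => (htot y x).resolve_left hy
    refine ⟨ih.sublist (sel_sublist _), ⟨fun y hy => (mem_sel.1 hy).2,
      ih.sublist (sel_sublist _)⟩, fun a ha b hb => ?_⟩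
    have ha' := hx a (mem_sel.1 ha).2
    rcases List.mem_cons.1 hb with rfl | hb
    · exact ha'
    · exact htrans _ _ _ (mem_sel.1 hb).2 ha'

theorem mem_descSort {α : Type} {le : α → α → Prop} {l : List α} {x : α} :
    x ∈ descSort le l ↔ x ∈ l := (descSort_perm le l).mem_iff

/-! ### Greedy choice of independent vectors -/

section greedy

variable {p d : ℕ} {base l : List (Vec p d)}

theorem lspan_append (l l' : List (Vec p d)) : lspan (l ++ l') = lspan l ⊔ lspan l' := by
  rw [lspan, lspan, lspan, ← Submodule.span_union]
  congr 1
  ext x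
  simp

theorem lspan_cons (x : Vec p d) (l : List (Vec p d)) :
    lspan (x :: l) = Submodule.span _ {x} ⊔ lspan l := by
  rw [lspan, lspan, ← Submodule.span_union]
  congr 1
  ext y
  simp

theorem lspan_nil : lspan ([] : List (Vec p d)) = ⊥ := by simp [lspan]

theorem lspan_mono {l l' : List (Vec p d)} (h : l ⊆ l') : lspan l ≤ lspan l' :=
  Submodule.span_mono fun _ hx => h hx

theorem mem_lspan {x : Vec p d} (h : x ∈ l) : x ∈ lspan l := Submodule.subset_span h

theorem lspan_le {K : Submodule (ZMod p) (Vec p d)} : lspan l ≤ K ↔ ∀ x ∈ l, x ∈ K :=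
  Submodule.span_le

theorem lspan_eq {K : Submodule (ZMod p) (Vec p d)} (h : ∀ x, x ∈ l ↔ x ∈ K) : lspan l = K :=
  le_antisymm (lspan_le.2 fun x hx => (h x).1 hx) fun x hx => mem_lspan ((h x).2 hx)

theorem lspan_reverse (l : List (Vec p d)) : lspan l.reverse = lspan l := by
  simp [lspan]

theorem lspan_vecs [NeZero p] : lspan (vecs p d) = ⊤ := lspan_eq fun x => by simp [mem_vecs]

theorem lspan_greedy (base l : List (Vec p d)) :
    lspan (base ++ greedy base l) = lspan (base ++ l) := by
  induction l with
  | nil => rfl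
  | cons x l ih =>
    have key : ∀ l', lspan (base ++ x :: l') = Submodule.span _ {x} ⊔ lspan (base ++ l') := by
      intro l'
      rw [lspan_append, lspan_cons, lspan_append, sup_left_comm]
    rw [greedy, key]
    split_ifs with h
    · rw [← ih, eq_comm, sup_eq_right]
      simpa using h
    · rw [key, ih]

theorem finrank_lspan_greedy [Fact p.Prime] (base l : List (Vec p d)) :
    Module.finrank (ZMod p) (lspan (base ++ greedy base l)) =
      Module.finrank (ZMod p) (lspan base) + (greedy base l).length := by
  induction l with
  | nil => rw [greedy, List.append_nil, List.length_nil, add_zero]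
  | cons x l ih =>
    by_cases h : x ∈ lspan (base ++ greedy base l)
    · rw [greedy, if_pos h]
      exact ih
    · rw [greedy, if_neg h, lspan_append, lspan_cons, sup_left_comm, ← lspan_append, List.length_cons, ← add_assoc,
        ← ih]
      have hx : x ≠ 0 := fun h0 => h (h0 ▸ zero_mem _)
      have hd : Submodule.span (ZMod p) {x} ⊓ lspan (base ++ greedy base l) = ⊥ := by
        rw [← disjoint_iff, disjoint_comm, Submodule.disjoint_span_singleton']
        · exact h
        · exact hx
      have := Submodule.finrank_sup_add_finrank_inf_eq (Submodule.span (ZMod p) {x})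
        (lspan (base ++ greedy base l))
      rw [hd, finrank_bot, finrank_span_singleton hx] at this
      omega

theorem finrank_lspan_le [Fact p.Prime] (l : List (Vec p d)) :
    Module.finrank (ZMod p) (lspan l) ≤ l.length := by
  induction l with
  | nil => simp [lspan_nil]
  | cons x l ih =>
    rw [lspan_cons, List.length_cons]
    have h1 := Submodule.finrank_add_le_finrank_add_finrank (Submodule.span (ZMod p) {x}) (lspan l)
    have h2 : Module.finrank (ZMod p) (Submodule.span (ZMod p) {x}) ≤ 1 := by
      simpa using finrank_span_le_card (R := ZMod p) ({x} : Set (Vec p d))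
    omega

/-- A list that is linearly independent modulo the base is kept. -/
theorem greedy_eq_self [Fact p.Prime] (h : Module.finrank (ZMod p) (lspan (base ++ l)) =
    Module.finrank (ZMod p) (lspan base) + l.length) : greedy base l = l := by
  refine (greedy_sublist base l).eq_of_length ?_
  have := finrank_lspan_greedy base l
  rw [lspan_greedy, h] at this
  omega

/-- The front of the list is examined last, when everything in the span of the base and the later
vectors is already covered. This discards zero padding and superfluous fallback vectors. -/
theorem greedy_append_of_subset {l' : List (Vec p d)}
    (h : ∀ x ∈ l', x ∈ lspan (base ++ l)) : greedy base (l' ++ l) = greedy base l := by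
  induction l' with
  | nil => rfl
  | cons x l' ih =>
    have ih' := ih fun y hy => h y (List.mem_cons_of_mem _ hy)
    rw [List.cons_append, greedy, ih', if_pos]
    rw [lspan_greedy]
    exact h x List.mem_cons_self

/-- The vectors are chosen greedily. -/
theorem le_of_greedy {le : Vec p d → Vec p d → Prop} (hrefl : ∀ a, le a a)
    (hl : l.Pairwise fun a b => le b a) {a b : List (Vec p d)} {x : Vec p d}
    (h : greedy base l = a ++ x :: b) {y : Vec p d} (hy : y ∈ l) (hy' : y ∉ lspan (base ++ b)) :
    le x y := by
  induction l generalizing a with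
  | nil => simp at hy
  | cons z l ih =>
    rw [List.pairwise_cons] at hl
    rw [greedy] at h
    split_ifs at h with hz
    · have hx : x ∈ l := (greedy_sublist base l).subset (h ▸ by simp)
      rcases List.mem_cons.1 hy with rfl | hy
      · exact hl.1 x hx
      · exact ih hl.2 h hy
    · rcases a with _ | ⟨a0, a⟩
      · rw [List.nil_append, List.cons.injEq] at h
        obtain ⟨rfl, rfl⟩ := h
        rcases List.mem_cons.1 hy with rfl | hy
        · exact hrefl _
        -- Here `b` consists of all vectors kept from `l`, so together with the base it spans every
        -- element of `l`, including `y`.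
        · refine absurd ?_ hy'
          rw [lspan_greedy]
          exact mem_lspan (List.mem_append_right _ hy)
      · rw [List.cons_append, List.cons.injEq] at h
        have hx : x ∈ l := (greedy_sublist base l).subset (h.2 ▸ by simp)
        rcases List.mem_cons.1 hy with rfl | hy
        · exact hl.1 x hx
        · exact ih hl.2 h.2 hy

end greedy

/-! ### Formatting rows -/

section rows

variable {p d a b : ℕ}

/-- The span of the vectors of a family whose indices have a given property. -/
def sp (N : Fin d → Vec p d) (P : Fin d → Prop) : Submodule (ZMod p) (Vec p d) :=
  Submodule.span (ZMod p) (N '' {i | P i})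

variable {N N' : Fin d → Vec p d} {P Q : Fin d → Prop}

theorem mem_sp {y : Vec p d} :
    y ∈ sp N P ↔ ∃ c : Fin d → ZMod p, (∀ j, ¬ P j → c j = 0) ∧ y = ∑ j, c j • N j := by
  classical
  rw [sp, show {i | P i} = ((Finset.univ.filter P : Finset (Fin d)) : Set (Fin d)) by ext; simp,
    Submodule.mem_span_image_finset_iff_exists_fun']
  constructor
  · rintro ⟨c, rfl⟩
    refine ⟨fun j => if P j then c j else 0, fun j hj => if_neg hj, ?_⟩
    simp [Finset.sum_filter, ite_smul]
  · rintro ⟨c, hc, rfl⟩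
    refine ⟨c, Finset.sum_subset (Finset.subset_univ _) fun j _ hj => ?_⟩
    rw [hc j (by simpa using hj), zero_smul]

theorem sp_mono (h : ∀ i, P i → Q i) : sp N P ≤ sp N Q :=
  Submodule.span_mono (Set.image_mono h)

theorem sp_le {K : Submodule (ZMod p) (Vec p d)} : sp N P ≤ K ↔ ∀ i, P i → N i ∈ K := by
  rw [sp, Submodule.span_le]
  exact ⟨fun h i hi => h ⟨i, hi, rfl⟩, fun h => by rintro _ ⟨i, hi, rfl⟩; exact h i hi⟩

theorem self_mem_sp {i : Fin d} (h : P i) : N i ∈ sp N P := Submodule.subset_span ⟨i, h, rfl⟩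

theorem sp_or : sp N P ⊔ sp N Q = sp N fun i => P i ∨ Q i := by
  rw [sp, sp, sp, ← Submodule.span_union, ← Set.image_union]
  rfl

theorem eq_sp_of_le [Fact p.Prime] {K : Submodule (ZMod p) (Vec p d)} [DecidablePred P]
    (hN : LinearIndependent (ZMod p) N) (h : ∀ i, P i → N i ∈ K)
    (hK : Module.finrank (ZMod p) K = Fintype.card {i // P i}) : K = sp N P := by
  refine (Submodule.eq_of_le_of_finrank_eq (sp_le.2 h) ?_).symm
  rw [hK, sp, Set.image_eq_range]
  exact finrank_span_eq_card (hN.comp _ Subtype.val_injective)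

theorem finrank_sp [Fact p.Prime] [DecidablePred P] (hN : LinearIndependent (ZMod p) N) :
    Module.finrank (ZMod p) (sp N P) = Fintype.card {i // P i} := by
  rw [sp, Set.image_eq_range]
  exact finrank_span_eq_card (hN.comp _ Subtype.val_injective)

theorem notMem_sp [Fact p.Prime] (hN : LinearIndependent (ZMod p) N) {i : Fin d} (h : ¬ P i) :
    N i ∉ sp N P :=
  hN.notMem_span_image h

theorem disjoint_sp [Fact p.Prime] (hN : LinearIndependent (ZMod p) N)
    (h : ∀ i, P i → ¬ Q i) : Disjoint (sp N P) (sp N Q) :=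
  hN.disjoint_span_image (Set.disjoint_left.2 h)

theorem finrank_map_add_finrank_inf_ker [Fact p.Prime] {V W : Type} [AddCommGroup V]
    [Module (ZMod p) V] [FiniteDimensional (ZMod p) V] [AddCommGroup W] [Module (ZMod p) W]
    (K : Submodule (ZMod p) V) (f : V →ₗ[ZMod p] W) :
    Module.finrank (ZMod p) (K.map f) + Module.finrank (ZMod p) (K ⊓ LinearMap.ker f : Submodule _ _)
      = Module.finrank (ZMod p) K := by
  have h := (f.domRestrict K).finrank_range_add_finrank_ker
  rw [LinearMap.range_domRestrict, LinearMap.ker_domRestrict] at h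
  rw [← h, ← Submodule.map_comap_subtype, (Submodule.equivMapOfInjective K.subtype
    K.injective_subtype (Submodule.comap K.subtype (LinearMap.ker f))).finrank_eq]

/-- The rows `N` begin with `α + β` representatives modulo `R` of a basis of `K` that is
semi-canonical for `φ`, followed by a basis of `R`. -/
structure IsRows (K R : Submodule (ZMod p) (Vec p d)) (φ : Vec p d →ₗ[ZMod p] Mat p a b)
    (α β : ℕ) (N : Fin d → Vec p d) : Prop where
  indep : LinearIndependent (ZMod p) N
  le : α + β ≤ Module.finrank (ZMod p) K
  eq_K : K = sp N fun i => (i : ℕ) < Module.finrank (ZMod p) K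
  eq_R : R = sp N fun i => α + β ≤ (i : ℕ) ∧ (i : ℕ) < Module.finrank (ZMod p) K
  zero : ∀ i : Fin d, (i : ℕ) < α + β → (φ (N i) = 0 ↔ (i : ℕ) < α)
  min : ∀ i : Fin d, (i : ℕ) < α + β → ∀ y ∈ K, y ∉ sp N (fun j => j < i) ⊔ R →
    LexLE (φ (N i)) (φ y)

/-- No representative lies below `0`, so the zero matrix is the minimum of the order. This is why
rows with zero key come first. -/
theorem LexLE.eq_zero {m n : ℕ} {A : Mat p m n} (h : LexLE A 0) : A = 0 := by
  rcases h with ⟨q, r, _, h⟩ | h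
  · simp at h
  · exact h

theorem LexLE.antisymm [NeZero p] {m n : ℕ} {A B : Mat p m n} (h : LexLE A B) (h' : LexLE B A) :
    A = B :=
  lexKey_injective (le_antisymm (lexLE_iff.1 h) (lexLE_iff.1 h'))

theorem card_fin_lt {k : ℕ} (h : k ≤ d) : Fintype.card {i : Fin d // (i : ℕ) < k} = k := by
  rw [Fintype.card_subtype]
  have : (Finset.univ.filter fun i : Fin d => (i : ℕ) < k) =
      Finset.univ.map (Fin.castLEEmb h) := by
    ext i
    simp only [Finset.mem_filter, Finset.mem_univ, true_and, Finset.mem_map]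
    exact ⟨fun hi => ⟨⟨i, hi⟩, rfl⟩, by rintro ⟨j, rfl⟩; exact j.2⟩
  rw [this, Finset.card_map, Finset.card_univ, Fintype.card_fin]

namespace IsRows

variable [Fact p.Prime] {K R : Submodule (ZMod p) (Vec p d)} {φ : Vec p d →ₗ[ZMod p] Mat p a b}
  {α β α' β' : ℕ}

theorem finrank_le (_ : IsRows K R φ α β N) : Module.finrank (ZMod p) K ≤ d := by
  simpa using Submodule.finrank_le K

theorem R_le (h : IsRows K R φ α β N) : R ≤ K := by
  rw [h.eq_R]
  conv_rhs => rw [h.eq_K]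
  exact sp_mono fun i hi => hi.2

theorem finrank_R (h : IsRows K R φ α β N) :
    α + β + Module.finrank (ZMod p) R = Module.finrank (ZMod p) K := by
  have h0 := h.le
  have h1 := Submodule.finrank_sup_add_finrank_inf_eq (sp N fun i => (i : ℕ) < α + β) R
  have h2 : (sp N fun i => (i : ℕ) < α + β) ⊔ R = K := by
    conv_rhs => rw [h.eq_K]
    conv_lhs => rw [h.eq_R]
    rw [sp_or]
    congr 1
    ext i
    omega
  have h3 : (sp N fun i => (i : ℕ) < α + β) ⊓ R = ⊥ := by
    rw [h.eq_R, ← disjoint_iff]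
    exact disjoint_sp h.indep fun i hi => by omega
  rw [h2, h3, finrank_bot, finrank_sp h.indep, card_fin_lt (h0.trans h.finrank_le)] at h1
  omega

/-- A vector of `K` killed by `φ` and lying outside the right-hand side would be admissible in the
minimality of row `α`. This would force that row to have zero image, which the clause `zero`
forbids. If `β = 0` there is no such row, but then the right-hand side is all of `K`. -/
theorem inf_ker_le (h : IsRows K R φ α β N) :
    K ⊓ LinearMap.ker φ ≤ (sp N fun i => (i : ℕ) < α) ⊔ R := by
  rintro y ⟨hyK, hy⟩
  rw [SetLike.mem_coe, LinearMap.mem_ker] at hy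
  have h0 := h.le.trans h.finrank_le
  rcases Nat.eq_zero_or_pos β with hβ | hβ
  · rw [SetLike.mem_coe, h.eq_K] at hyK
    rw [h.eq_R, sp_or]
    exact sp_mono (fun i hi => by omega) hyK
  · by_contra hyn
    have := h.min ⟨α, by omega⟩ (by simpa using hβ) y hyK hyn
    rw [hy] at this
    have := (h.zero ⟨α, by omega⟩ (by simpa using hβ)).1 this.eq_zero
    simp at this

theorem finrank_inf_ker (h : IsRows K R φ α β N) (hR : R ≤ LinearMap.ker φ) :
    Module.finrank (ZMod p) (K ⊓ LinearMap.ker φ : Submodule _ _) =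
      α + Module.finrank (ZMod p) R := by
  have h0 := h.le
  have h1 : (sp N fun i => (i : ℕ) < α) ⊔ R = K ⊓ LinearMap.ker φ := by
    refine le_antisymm (sup_le (sp_le.2 fun i hi => ⟨?_, ?_⟩) (le_inf h.R_le hR)) h.inf_ker_le
    · rw [SetLike.mem_coe, h.eq_K]
      exact self_mem_sp (by omega)
    · exact (h.zero i (by omega)).2 hi
  have h2 := Submodule.finrank_sup_add_finrank_inf_eq (sp N fun i => (i : ℕ) < α) R
  have h3 : (sp N fun i => (i : ℕ) < α) ⊓ R = ⊥ := by
    rw [h.eq_R, ← disjoint_iff]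
    exact disjoint_sp h.indep fun i hi => by omega
  rw [h1, h3, finrank_bot, finrank_sp h.indep, card_fin_lt (by have := h.finrank_le; omega)] at h2
  omega

/-- The dimensions of `K` and of its intersection with the kernel of `φ` are `α + β + dim R` and `α
+ dim R`, whatever the rows. -/
theorem params_eq (h : IsRows K R φ α β N) (h' : IsRows K R φ α' β' N')
    (hR : R ≤ LinearMap.ker φ) : α = α' ∧ β = β' := by
  have h1 := h.finrank_R
  have h2 := h'.finrank_R
  have h3 := h.finrank_inf_ker hR
  have h4 := h'.finrank_inf_ker hR
  omega

theorem mem_K (h : IsRows K R φ α β N) {i : Fin d} (hi : (i : ℕ) < Module.finrank (ZMod p) K) :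
    N i ∈ K := by
  rw [h.eq_K]
  exact self_mem_sp hi

theorem mem_R (h : IsRows K R φ α β N) {i : Fin d} (hi : (i : ℕ) < Module.finrank (ZMod p) K)
    (hi' : α + β ≤ i) : N i ∈ R := by
  rw [h.eq_R]
  exact self_mem_sp ⟨hi', hi⟩

theorem not_mem_before (h : IsRows K R φ α β N) {i : Fin d} (hi : (i : ℕ) < α + β) :
    N i ∉ sp N (fun j => j < i) ⊔ R := by
  rw [h.eq_R, sp_or]
  exact notMem_sp h.indep fun h => by
    rcases h with h | h
    · exact lt_irrefl _ h
    · omega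

/-- Equal keys put `N j - N' j` into the kernel of `φ` on `K`. For `i ≥ α` this kernel is contained
in the span of `R` and of the rows of `N'` before `i`, so the two flags agree modulo `R`. -/
theorem before_le (h : IsRows K R φ α β N) (h' : IsRows K R φ α β N') (i : Fin d)
    (hi : (i : ℕ) < α + β)
    (heq : ∀ j : Fin d, j < i → φ (N j) = φ (N' j)) :
    sp N (fun j => j < i) ⊔ R ≤ sp N' (fun j => j < i) ⊔ R ∨ (i : ℕ) < α := by
  have h0 := h.le
  refine or_iff_not_imp_right.2 fun hα => sup_le (sp_le.2 fun j hj => ?_) le_sup_right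
  rw [Fin.lt_def] at hj
  have hZ : K ⊓ LinearMap.ker φ ≤ sp N' (fun j => j < i) ⊔ R :=
    h'.inf_ker_le.trans (sup_le_sup_right (sp_mono fun k hk => Fin.lt_def.2 (by omega)) _)
  have hd : N j - N' j ∈ K ⊓ LinearMap.ker φ :=
    ⟨sub_mem (h.mem_K (by omega)) (h'.mem_K (by omega)), by
      rw [SetLike.mem_coe, LinearMap.mem_ker, map_sub, heq j hj, sub_self]⟩
  have := add_mem (hZ hd) (Submodule.mem_sup_left (T := R) (self_mem_sp (N := N')
    (P := fun j => j < i) hj))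
  rwa [sub_add_cancel] at this

/-- By induction the rows before `i` span the same space modulo `R` in both systems, once `i ≥ α`.
Hence each of the two rows numbered `i` competes in the minimality of the other one, and the order
is antisymmetric. For `i < α` both keys vanish. -/
theorem key_eq (h : IsRows K R φ α β N) (h' : IsRows K R φ α β N') (i : Fin d)
    (hi : (i : ℕ) < α + β) : φ (N i) = φ (N' i) := by
  induction i using WellFoundedLT.induction with
  | ind i ih =>
    have h0 := h.le
    have ih' : ∀ j : Fin d, j < i → φ (N j) = φ (N' j) := fun j hj =>
      ih j hj (lt_trans (Fin.lt_def.1 hj) hi)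
    rcases lt_or_ge (i : ℕ) α with hα | hα
    · rw [(h.zero i hi).2 hα, (h'.zero i hi).2 hα]
    · refine (h.min i hi _ (h'.mem_K (by omega)) fun hm => ?_).antisymm
        (h'.min i hi _ (h.mem_K (by omega)) fun hm => ?_)
      · exact h'.not_mem_before hi
          (((h.before_le h' i hi ih').resolve_right (by omega)) hm)
      · exact h.not_mem_before hi
          (((h'.before_le h i hi fun j hj => (ih' j hj).symm).resolve_right (by omega)) hm)

theorem exists_coeffs (h : IsRows K R φ α β N) {y : Vec p d} (hy : y ∈ K ⊓ LinearMap.ker φ) :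
    ∃ c : Fin d → ZMod p, (∀ j : Fin d, α ≤ j → c j = 0) ∧ y - ∑ j, c j • N j ∈ R := by
  obtain ⟨z, hz, r, hr, rfl⟩ := Submodule.mem_sup.1 (h.inf_ker_le hy)
  obtain ⟨c, hc, rfl⟩ := mem_sp.1 hz
  exact ⟨c, fun j hj => hc j (by omega), by simpa using hr⟩

/-- A matrix of block form that takes `N` to `N'` modulo `R`. -/
theorem exists_matrix (h : IsRows K R φ α β N) (h' : IsRows K R φ α β N')
    (htail : ∀ i : Fin d, Module.finrank (ZMod p) K ≤ i → N i = N' i) :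
    ∃ P : Mat p d d, (∀ i j : Fin d, α ≤ (j : ℕ) → P i j = if i = j then 1 else 0) ∧
      (∀ i j : Fin d, α + β ≤ (i : ℕ) → P i j = if i = j then 1 else 0) ∧
      ∀ i, N' i - ∑ j, P i j • N j ∈ R := by
  have h0 := h.le
  have key : ∀ i : Fin d, ∃ r : Fin d → ZMod p,
      (∀ j : Fin d, α ≤ (j : ℕ) → r j = if i = j then 1 else 0) ∧
      (α + β ≤ (i : ℕ) → ∀ j : Fin d, r j = if i = j then 1 else 0) ∧
      N' i - ∑ j, r j • N j ∈ R := by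
    intro i
    rcases lt_or_ge (i : ℕ) α with hα | hα
    · obtain ⟨c, hc, hcR⟩ := h.exists_coeffs (y := N' i)
        ⟨h'.mem_K (by omega), (h'.zero i (by omega)).2 hα⟩
      refine ⟨c, fun j hj => ?_, fun hi => by omega, hcR⟩
      rw [hc j hj, if_neg]
      rintro rfl
      omega
    rcases lt_or_ge (i : ℕ) (α + β) with hβ | hβ
    -- Rows of the middle block have equal keys, so their difference lies in the kernel of `φ` and
    -- is, modulo `R`, a combination of the first `α` rows. This yields the identity block with an
    -- arbitrary block to its left.
    · obtain ⟨c, hc, hcR⟩ := h.exists_coeffs (y := N' i - N i)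
        ⟨sub_mem (h'.mem_K (by omega)) (h.mem_K (by omega)), by
          rw [SetLike.mem_coe, LinearMap.mem_ker, map_sub, h.key_eq h' i hβ, sub_self]⟩
      refine ⟨fun j => c j + if i = j then 1 else 0, fun j hj => by simp only [hc j hj, zero_add],
        fun hi => by omega, ?_⟩
      have : ∑ j, (c j + if i = j then 1 else 0) • N j = ∑ j, c j • N j + N i := by
        simp [add_smul, Finset.sum_add_distrib]
      rw [this, add_comm, ← sub_sub]
      exact hcR
    · refine ⟨fun j => if i = j then 1 else 0, fun j _ => rfl, fun _ j => rfl, ?_⟩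
      have : ∑ j, (if i = j then (1 : ZMod p) else 0) • N j = N i := by simp
      rw [this]
      rcases lt_or_ge (i : ℕ) (Module.finrank (ZMod p) K) with hκ | hκ
      · exact sub_mem (h'.mem_R hκ hβ) (h.mem_R hκ hβ)
      · rw [htail i hκ, sub_self]
        exact zero_mem _
  choose r hr1 hr2 hr3 using key
  exact ⟨r, fun i => hr1 i, fun i j hi => hr2 i hi j, hr3⟩

/-- Two systems of formatting rows differ by an invertible matrix of block form. -/
theorem exists_blockForm (h : IsRows K R φ α β N) (h' : IsRows K R φ α β N')
    (htail : ∀ i : Fin d, Module.finrank (ZMod p) K ≤ i → N i = N' i) :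
    ∃ P : GL (Fin d) (ZMod p), IsBlockForm α β P ∧
      ∀ i, N' i - ∑ j, (P : Mat p d d) i j • N j ∈ R := by
  obtain ⟨P, hP1, hP2, hP3⟩ := h.exists_matrix h' htail
  obtain ⟨Q, hQ1, hQ2, hQ3⟩ := h'.exists_matrix h fun i hi => (htail i hi).symm
  have h0 := h.le
  -- Both matrices are correct modulo `R`, so each row of `Q * P - 1` gives a combination of the
  -- rows `N` that lies in `R`. It involves only the first `α` rows, because the other columns
  -- vanish, and these rows are independent of `R`.
  have hQP : Q * P = 1 := by
    ext i k
    have hcol : ∀ k : Fin d, α ≤ (k : ℕ) → (Q * P - 1) i k = 0 := by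
      intro k hk
      rw [Matrix.sub_apply, Matrix.mul_apply, Matrix.one_apply]
      simp [hP1 _ k hk, hQ1 i k hk]
    have hmem : ∑ k, (Q * P - 1) i k • N k ∈ R := by
      have e : ∑ k, (Q * P - 1) i k • N k =
          -((N i - ∑ j, Q i j • N' j) + ∑ j, Q i j • (N' j - ∑ k, P j k • N k)) := by
        have e1 : ∑ k, (Q * P) i k • N k = ∑ j, Q i j • ∑ k, P j k • N k := by
          simp only [Matrix.mul_apply, Finset.sum_smul, Finset.smul_sum, mul_smul]
          exact Finset.sum_comm
        have e2 : ∑ k, (1 : Mat p d d) i k • N k = N i := by simp [Matrix.one_apply]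
        simp only [Matrix.sub_apply, sub_smul, smul_sub, Finset.sum_sub_distrib]
        rw [e1, e2]
        abel
      rw [e]
      exact neg_mem (add_mem (hQ3 i) (sum_mem fun j _ => Submodule.smul_mem _ _ (hP3 j)))
    have hsp : ∑ k, (Q * P - 1) i k • N k ∈ sp N fun k => (k : ℕ) < α :=
      mem_sp.2 ⟨_, fun j hj => hcol j (by omega), rfl⟩
    have hdis : Disjoint (sp N fun k => (k : ℕ) < α) R := by
      rw [h.eq_R]
      exact disjoint_sp h.indep fun i hi => by omega
    have hz := Submodule.disjoint_def.1 hdis _ hsp hmem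
    have := Fintype.linearIndependent_iff.1 h.indep _ hz k
    rwa [Matrix.sub_apply, sub_eq_zero] at this
  exact ⟨⟨P, Q, mul_eq_one_comm.1 hQP, hQP⟩, ⟨hP1, hP2⟩, hP3⟩

end IsRows

end rows

/-! ### Correctness of the greedily constructed formatting rows -/

section

variable {p d a b : ℕ}

theorem sp_getD_Ico {l : List (Vec p d)} (hl : l.length = d) (s t : ℕ) :
    sp (fun i : Fin d => l.getD i 0) (fun i => s ≤ (i : ℕ) ∧ (i : ℕ) < t) =
      lspan ((l.take t).drop s) := by
  rw [sp, lspan]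
  congr 1
  ext x
  simp only [Set.mem_image, Set.mem_ofPred_eq, List.mem_iff_getElem, List.length_drop,
    List.length_take, List.getElem_drop, List.getElem_take]
  constructor
  · rintro ⟨i, ⟨h1, h2⟩, rfl⟩
    refine ⟨i - s, by omega, ?_⟩
    rw [List.getD_eq_getElem _ _ (by omega)]
    congr 1
    omega
  · rintro ⟨i, hi, rfl⟩
    refine ⟨⟨s + i, by omega⟩, ⟨by simp, by simp; omega⟩, ?_⟩
    exact List.getD_eq_getElem _ _ _

theorem sp_getD_lt {l : List (Vec p d)} (hl : l.length = d) (t : ℕ) :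
    sp (fun i : Fin d => l.getD i 0) (fun i => (i : ℕ) < t) = lspan (l.take t) := by
  have := sp_getD_Ico hl 0 t
  simpa using this

/-- The hypothesis makes `q` hold exactly on an initial segment, whose length is that of the
filtered list. It identifies the counted parameter `α` with a threshold on row indices. -/
theorem length_sel_iff {α : Type} {q : α → Prop} {l : List α}
    (h : ∀ i j (hij : i < j) (hj : j < l.length), q l[j] → q l[i]) (i : ℕ) (hi : i < l.length) :
    q l[i] ↔ i < (sel q l).length := by
  induction l generalizing i with
  | nil => simp at hi
  | cons x l ih =>
    have ih' := ih fun i j hij hj => by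
      have := h (i + 1) (j + 1) (by omega) (by simpa using hj)
      simpa using this
    by_cases hx : q x
    · rw [sel_cons_of_pos hx]
      cases i with
      | zero => simpa using hx
      | succ i => simpa using ih' i (by simpa using hi)
    · have hn : ∀ y ∈ x :: l, ¬ q y := by
        intro y hy hq
        obtain ⟨j, hj, rfl⟩ := List.mem_iff_getElem.1 hy
        cases j with
        | zero => exact hx hq
        | succ j => exact hx (h 0 (j + 1) (by omega) hj hq)
      have : sel q (x :: l) = [] := List.eq_nil_iff_forall_not_mem.2 fun y hy =>
        hn y (mem_sel.1 hy).1 (mem_sel.1 hy).2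
      rw [this]
      exact iff_of_false (hn _ (List.getElem_mem _)) (by simp)

theorem length_sel_add {α : Type} (q : α → Prop) (l : List α) :
    (sel q l).length + (sel (fun x => ¬ q x) l).length = l.length := by
  induction l with
  | nil => rfl
  | cons x l ih =>
    by_cases hx : q x
    · rw [sel_cons_of_pos hx, sel_cons_of_neg (q := fun x => ¬ q x) (not_not.2 hx), List.length_cons, List.length_cons]
      omega
    · rw [sel_cons_of_neg hx, sel_cons_of_pos (q := fun x => ¬ q x) hx, List.length_cons,
        List.length_cons]
      omega

/-- The hypotheses of the construction of formatting rows. -/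
structure RowInput (K R : Submodule (ZMod p) (Vec p d)) (Kl Rl C : List (Vec p d)) : Prop where
  mem_K : ∀ x, x ∈ Kl ↔ x ∈ K
  mem_R : ∀ x, x ∈ Rl ↔ x ∈ R
  R_le : R ≤ K
  inf : K ⊓ lspan C = ⊥
  sup : K ⊔ lspan C = ⊤
  card : Module.finrank (ZMod p) (lspan C) = C.length

namespace RowInput

variable {K R : Submodule (ZMod p) (Vec p d)} {Kl Rl C : List (Vec p d)}
  (key : Vec p d → List (ZMod p))

theorem lspan_sort (h : RowInput K R Kl Rl C) :
    lspan (descSort (fun v w => lexLE (key v) (key w)) Kl) = K :=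
  lspan_eq fun x => by rw [mem_descSort, h.mem_K]

theorem finrank_add [Fact p.Prime] (h : RowInput K R Kl Rl C) :
    Module.finrank (ZMod p) K + C.length = d := by
  have := Submodule.finrank_sup_add_finrank_inf_eq K (lspan C)
  rw [h.sup, h.inf, finrank_bot, finrank_top, Module.finrank_fin_fun, h.card] at this
  omega

theorem lspan_R (h : RowInput K R Kl Rl C) : lspan Rl = R := lspan_eq h.mem_R

theorem main_subset (h : RowInput K R Kl Rl C) : ∀ x ∈ mainRows key Kl Rl C, x ∈ K := by
  intro x hx
  exact (h.mem_K x).1 (mem_descSort.1 ((greedy_sublist _ _).subset (List.mem_reverse.1 hx)))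

theorem length_main [Fact p.Prime] (h : RowInput K R Kl Rl C) :
    (mainRows key Kl Rl C).length + Module.finrank (ZMod p) R = Module.finrank (ZMod p) K := by
  rw [mainRows, List.length_reverse]
  have h1 := finrank_lspan_greedy (Rl ++ C) (descSort (fun v w => lexLE (key v) (key w)) Kl)
  rw [lspan_greedy, lspan_append, lspan_append, h.lspan_sort, h.lspan_R, sup_right_comm, sup_eq_right.2 h.R_le, h.sup,
    finrank_top, Module.finrank_fin_fun] at h1
  have h2 := Submodule.finrank_sup_add_finrank_inf_eq R (lspan C)
  have h3 : R ⊓ lspan C = ⊥ := le_bot_iff.1 (h.inf ▸ inf_le_inf_right _ h.R_le)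
  rw [h3, finrank_bot, h.card] at h2
  have := h.finrank_add
  omega

theorem lspan_rows [Fact p.Prime] (h : RowInput K R Kl Rl C) : lspan (formatRows key Kl Rl C) = ⊤ := by
  have h1 := lspan_greedy (mainRows key Kl Rl C ++ C) Rl
  have h2 := lspan_greedy (Rl ++ C) (descSort (fun v w => lexLE (key v) (key w)) Kl)
  rw [lspan_append (Rl ++ C) (descSort _ _), h.lspan_sort] at h2
  have h3 : lspan (formatRows key Kl Rl C) =
      lspan (mainRows key Kl Rl C ++ C ++ greedy (mainRows key Kl Rl C ++ C) Rl) := by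
    simp only [formatRows, lspan_append]
    rw [sup_assoc, sup_comm (lspan C)]
  rw [h3, h1, eq_top_iff, ← h.sup]
  have h4 : lspan (mainRows key Kl Rl C ++ C ++ Rl) = lspan (Rl ++ C ++
      greedy (Rl ++ C) (descSort (fun v w => lexLE (key v) (key w)) Kl)) := by
    simp only [mainRows, lspan_append, lspan_reverse]
    rw [sup_comm, sup_comm (lspan (greedy _ _)), sup_assoc]
  rw [h4, h2, lspan_append]
  exact sup_le le_sup_right (le_trans le_sup_right le_sup_left)

theorem length_rest [Fact p.Prime] (h : RowInput K R Kl Rl C) :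
    (greedy (mainRows key Kl Rl C ++ C) Rl).length = Module.finrank (ZMod p) R := by
  have h0 := h.length_main key
  have h00 := h.finrank_add
  have h1 := finrank_lspan_greedy (mainRows key Kl Rl C ++ C) Rl
  have h2 : lspan (mainRows key Kl Rl C ++ C ++ greedy (mainRows key Kl Rl C ++ C) Rl) = ⊤ := by
    rw [← h.lspan_rows key]
    simp only [formatRows, lspan_append]
    rw [sup_assoc, sup_comm (lspan C)]
  have h3 := finrank_lspan_le (mainRows key Kl Rl C ++ C)
  have h4 := Submodule.finrank_add_le_finrank_add_finrank
    (lspan (mainRows key Kl Rl C ++ C)) R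
  have h5 : lspan (mainRows key Kl Rl C ++ C) ⊔ R = ⊤ := by
    rw [eq_top_iff, ← h2, lspan_append _ (greedy _ _)]
    exact sup_le_sup_left (lspan_le.2 fun x hx => (h.mem_R x).1 ((greedy_sublist _ _).subset hx)) _
  rw [h5, finrank_top, Module.finrank_fin_fun] at h4
  rw [h2, finrank_top, Module.finrank_fin_fun] at h1
  rw [List.length_append] at h3
  omega

theorem length_rows [Fact p.Prime] (h : RowInput K R Kl Rl C) : (formatRows key Kl Rl C).length = d := by
  rw [formatRows, List.length_append, List.length_append, h.length_rest]
  have h0 := h.length_main key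
  have h00 := h.finrank_add
  omega

theorem indep [Fact p.Prime] (h : RowInput K R Kl Rl C) :
    LinearIndependent (ZMod p) fun i : Fin d => (formatRows key Kl Rl C).getD i 0 := by
  refine linearIndependent_of_top_le_span_of_card_eq_finrank ?_ (by simp)
  rw [← h.lspan_rows key]
  refine lspan_le.2 fun x hx => ?_
  obtain ⟨i, hi, rfl⟩ := List.mem_iff_getElem.1 hx
  refine Submodule.subset_span ⟨⟨i, (h.length_rows key) ▸ hi⟩, ?_⟩
  exact List.getD_eq_getElem _ _ _

theorem tail [Fact p.Prime] (h : RowInput K R Kl Rl C) (i k : ℕ) (hi : i = Module.finrank (ZMod p) K + k) :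
    (formatRows key Kl Rl C).getD i 0 = C.getD k 0 := by
  have h0 := h.length_main key
  have h1 := h.length_rest key
  rw [formatRows, List.getD_append_right _ _ _ _ (by omega),
    List.getD_append_right _ _ _ _ (by omega)]
  congr 1
  omega

theorem getD_main (_ : RowInput K R Kl Rl C) (i : ℕ) (hi : i < (mainRows key Kl Rl C).length) :
    (formatRows key Kl Rl C).getD i 0 = (mainRows key Kl Rl C)[i] := by
  rw [formatRows, List.getD_append _ _ _ _ hi, List.getD_eq_getElem]

variable {φ : Vec p d →ₗ[ZMod p] Mat p a b}

/-- The candidates are sorted in descending order and read from the end, so `le_of_greedy` gives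
minimality against vectors outside the span of `R`, `C` and the earlier rows. For `y` in `K` the
complement `C` may be dropped: the `C`-component of such a `y` is a difference of vectors of `K`,
hence zero. -/
theorem main_min [Fact p.Prime] (h : RowInput K R Kl Rl C) (hφ : ∀ v, key v = flat (φ v)) (i : ℕ)
    (hi : i < (mainRows key Kl Rl C).length) {y : Vec p d} (hy : y ∈ K)
    (hy' : y ∉ lspan ((mainRows key Kl Rl C).take i) ⊔ R) :
    LexLE (φ ((mainRows key Kl Rl C)[i])) (φ y) := by
  have hkey : ∀ v w, lexLE (key v) (key w) ↔ lexKey (φ v) ≤ lexKey (φ w) := fun v w => by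
    rw [hφ, hφ, lexLE_flat_iff, lexLE_iff]
  have hsort := descSort_pairwise (le := fun v w => lexLE (key v) (key w))
    (fun v w => by rw [hkey, hkey]; exact le_total _ _)
    (fun u v w huv hvw => by rw [hkey] at *; exact huv.trans hvw) Kl
  have hsplit : greedy (Rl ++ C) (descSort (fun v w => lexLE (key v) (key w)) Kl) =
      ((mainRows key Kl Rl C).drop (i + 1)).reverse ++ (mainRows key Kl Rl C)[i] ::
        ((mainRows key Kl Rl C).take i).reverse := by
    have : greedy (Rl ++ C) (descSort (fun v w => lexLE (key v) (key w)) Kl) =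
        (mainRows key Kl Rl C).reverse := by rw [mainRows, List.reverse_reverse]
    conv_lhs => rw [this, ← List.take_append_drop i (mainRows key Kl Rl C),
      List.drop_eq_getElem_cons hi]
    simp
  have := le_of_greedy (fun a => (hkey a a).2 le_rfl) hsort hsplit (y := y)
    (mem_descSort.2 ((h.mem_K y).2 hy)) fun hm => hy' ?_
  · rwa [hkey, ← lexLE_iff] at this
  · rw [lspan_append, lspan_append, lspan_reverse, h.lspan_R, sup_right_comm] at hm
    obtain ⟨s, hs, c, hc, rfl⟩ := Submodule.mem_sup.1 hm
    have hsK : s ∈ K := by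
      refine (sup_le h.R_le (lspan_le.2 fun x hx => ?_) : R ⊔ _ ≤ K) hs
      exact h.main_subset key x (List.mem_of_mem_take hx)
    have hcK : c ∈ K ⊓ lspan C := ⟨by simpa using sub_mem hy hsK, hc⟩
    rw [h.inf, Submodule.mem_bot] at hcK
    rw [hcK, add_zero, sup_comm]
    exact hs

theorem isRows [Fact p.Prime] (h : RowInput K R Kl Rl C) (hφ : ∀ v, key v = flat (φ v)) :
    IsRows K R φ (sel (fun v => φ v = 0) (mainRows key Kl Rl C)).length
      (sel (fun v => ¬ φ v = 0) (mainRows key Kl Rl C)).length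
      (fun i : Fin d => (formatRows key Kl Rl C).getD i 0) := by
  have hind := h.indep key
  have hlen := h.length_rows key
  have hab := length_sel_add (fun v => φ v = 0) (mainRows key Kl Rl C)
  have h0 := h.length_main key
  have h1 := h.length_rest key
  have h2 := h.finrank_add
  have hR : R = sp (fun i : Fin d => (formatRows key Kl Rl C).getD i 0)
      fun i => (mainRows key Kl Rl C).length ≤ (i : ℕ) ∧ (i : ℕ) < Module.finrank (ZMod p) K := by
    have e : ((formatRows key Kl Rl C).take (Module.finrank (ZMod p) K)).drop
        (mainRows key Kl Rl C).length = greedy (mainRows key Kl Rl C ++ C) Rl := by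
      rw [formatRows, ← h0, ← h1, List.drop_take, List.drop_left, Nat.add_sub_cancel_left,
        List.take_left]
    rw [sp_getD_Ico hlen, e]
    have hind' : LinearIndependent (ZMod p) fun i : Fin d => (formatRows key Kl Rl C).getD i 0 := hind
    refine (Submodule.eq_of_le_of_finrank_le (lspan_le.2 fun x hx =>
      (h.mem_R x).1 ((greedy_sublist _ _).subset hx)) ?_).symm
    rw [← e, ← sp_getD_Ico hlen, ← h1]
    have hsup := sp_or (N := fun i : Fin d => (formatRows key Kl Rl C).getD i 0)
      (P := fun i => (i : ℕ) < (mainRows key Kl Rl C).length)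
      (Q := fun i => (mainRows key Kl Rl C).length ≤ (i : ℕ) ∧
        (i : ℕ) < Module.finrank (ZMod p) K)
    have h3 := Submodule.finrank_add_le_finrank_add_finrank
      (sp (fun i : Fin d => (formatRows key Kl Rl C).getD i 0)
        (fun i => (i : ℕ) < (mainRows key Kl Rl C).length))
      (sp (fun i : Fin d => (formatRows key Kl Rl C).getD i 0)
        (fun i => (mainRows key Kl Rl C).length ≤ (i : ℕ) ∧
        (i : ℕ) < Module.finrank (ZMod p) K))
    rw [hsup] at h3
    have h4 : (fun i : Fin d => (i : ℕ) < (mainRows key Kl Rl C).length ∨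
        ((mainRows key Kl Rl C).length ≤ (i : ℕ) ∧ (i : ℕ) < Module.finrank (ZMod p) K)) =
        fun i : Fin d => (i : ℕ) < Module.finrank (ZMod p) K := by
      ext i
      omega
    rw [h4, finrank_sp hind, finrank_sp hind, card_fin_lt (by omega), card_fin_lt (by omega)] at h3
    omega
  have hK : K = sp (fun i : Fin d => (formatRows key Kl Rl C).getD i 0)
      fun i => (i : ℕ) < Module.finrank (ZMod p) K := by
    refine eq_sp_of_le hind (fun i hi => ?_) (card_fin_lt (by omega)).symm
    rcases lt_or_ge (i : ℕ) (mainRows key Kl Rl C).length with hi' | hi'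
    · rw [h.getD_main key i hi']
      exact h.main_subset key _ (List.getElem_mem _)
    · refine h.R_le ?_
      rw [hR]
      exact self_mem_sp (N := fun i : Fin d => (formatRows key Kl Rl C).getD i 0) ⟨hi', hi⟩
  have hbefore : ∀ i, i < (mainRows key Kl Rl C).length →
      sp (fun i : Fin d => (formatRows key Kl Rl C).getD i 0) (fun j => (j : ℕ) < i) =
        lspan ((mainRows key Kl Rl C).take i) := by
    intro i hi
    rw [sp_getD_lt hlen, formatRows, List.take_append_of_le_length hi.le]
  refine ⟨hind, by omega, hK, by rw [hab]; exact hR, fun i hi => ?_, fun i hi y hy hy' => ?_⟩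
  · rw [hab] at hi
    rw [h.getD_main key i hi]
    refine length_sel_iff (q := fun v => φ v = 0) (fun i j hij hj hq => ?_) i hi
    -- A later row with zero image is admissible in the minimality of an earlier one, whose image is
    -- then at most zero. So the rows with zero image form an initial segment.
    have := h.main_min key hφ i (by omega) (y := (mainRows key Kl Rl C)[j])
      (h.main_subset key _ (List.getElem_mem _)) ?_
    · rw [hq] at this
      exact this.eq_zero
    · rw [← hbefore i (by omega), hR, sp_or, ← h.getD_main key j hj]
      refine notMem_sp (i := (⟨j, by omega⟩ : Fin d)) hind fun hj' => ?_
      dsimp only at hj'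
      omega
  · rw [hab] at hi
    rw [h.getD_main key i hi]
    refine h.main_min key hφ i hi hy ?_
    rwa [← hbefore i hi]

end RowInput

end

/-! ### The trilinear form and the matrix spaces -/

section tri

variable {p m n : ℕ} (G : Tensor p m n)

theorem tri_eq_sum (u : Vec p m) (v w : Vec p n) :
    tri G u v w = ∑ i, ∑ j, ∑ k, u i * (v j * (w k * G i j k)) := by
  simp only [tri, dotProduct, Finset.mul_sum]

/-- The linear map `u ↦ ∑ i, u i • X_{G,i}`. -/
def xmap : Vec p m →ₗ[ZMod p] Mat p n n := Fintype.linearCombination (ZMod p) (sliceX G)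

/-- The linear map `v ↦ ∑ j, v j • Y_{G,j}`. -/
def ymap : Vec p n →ₗ[ZMod p] Mat p m n := Fintype.linearCombination (ZMod p) (sliceY G)

theorem xmap_apply (u : Vec p m) : xmap G u = ∑ i, u i • sliceX G i := rfl

theorem ymap_apply (v : Vec p n) : ymap G v = ∑ j, v j • sliceY G j := rfl

theorem xmap_entry (u : Vec p m) (j k : Fin n) : xmap G u j k = ∑ i, u i * G i j k := by
  rw [xmap_apply, Matrix.sum_apply]
  rfl

theorem ymap_entry (v : Vec p n) (i : Fin m) (k : Fin n) :
    ymap G v i k = ∑ j, v j * G i j k := by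
  rw [ymap_apply, Matrix.sum_apply]
  rfl

theorem range_xmap : LinearMap.range (xmap G) = spaceX G := Fintype.range_linearCombination ..

theorem range_ymap : LinearMap.range (ymap G) = spaceY G := Fintype.range_linearCombination ..

/-- Together with `vecMul_ymap`, this turns the conditions on both matrix spaces into conditions on
one trilinear form, the object that an isometry preserves. -/
theorem vecMul_xmap (u : Vec p m) (v w : Vec p n) : v ᵥ* xmap G u ⬝ᵥ w = tri G u v w := by
  simp only [tri_eq_sum, dotProduct, Matrix.vecMul, xmap_entry, Finset.mul_sum, Finset.sum_mul]
  rw [Finset.sum_comm]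
  conv_rhs => rw [Finset.sum_comm]
  refine Finset.sum_congr rfl fun j _ => ?_
  rw [Finset.sum_comm]
  exact Finset.sum_congr rfl fun i _ => Finset.sum_congr rfl fun k _ => by ring

theorem vecMul_ymap (u : Vec p m) (v w : Vec p n) : u ᵥ* ymap G v ⬝ᵥ w = tri G u v w := by
  simp only [tri_eq_sum, dotProduct, Matrix.vecMul, ymap_entry, Finset.mul_sum, Finset.sum_mul]
  rw [Finset.sum_comm]
  refine Finset.sum_congr rfl fun i _ => ?_
  rw [Finset.sum_comm]
  exact Finset.sum_congr rfl fun j _ => Finset.sum_congr rfl fun k _ => by ring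

theorem mul_mul_transpose_apply {a b m n : ℕ} (L : Mat p a m) (A : Mat p m n) (R : Mat p b n)
    (i : Fin a) (j : Fin b) : (L * A * Rᵀ) i j = L i ᵥ* A ⬝ᵥ R j := rfl

theorem sandwich_xmap {a b : ℕ} (L : Mat p a n) (R : Mat p b n) (u : Vec p m) (i : Fin a)
    (j : Fin b) : (L * xmap G u * Rᵀ) i j = tri G u (L i) (R j) := by
  rw [mul_mul_transpose_apply, vecMul_xmap]

theorem sandwich_ymap {a b : ℕ} (L : Mat p a m) (R : Mat p b n) (v : Vec p n) (i : Fin a)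
    (j : Fin b) : (L * ymap G v * Rᵀ) i j = tri G (L i) v (R j) := by
  rw [mul_mul_transpose_apply, vecMul_ymap]

theorem trans_apply (N : GL (Fin n) (ZMod p)) (M : GL (Fin m) (ZMod p)) (i : Fin m)
    (j k : Fin n) : trans N M G i j k =
      tri G ((M : Mat p m m) i) ((N : Mat p n n) j) ((N : Mat p n n) k) := by
  rw [← sandwich_xmap, trans, xmap_apply, Matrix.mul_sum, Matrix.sum_mul]
  simp only [Matrix.mul_smul, Matrix.smul_mul]

theorem ymap_eq_zero_iff {v : Vec p n} : ymap G v = 0 ↔ ∀ u w, tri G u v w = 0 := by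
  constructor
  · intro h u w
    rw [← vecMul_ymap, h, Matrix.vecMul_zero, zero_dotProduct]
  · intro h
    ext i k
    have := sandwich_ymap G 1 1 v i k
    rw [h] at this
    simpa using this

theorem xmap_eq_zero_iff {u : Vec p m} : xmap G u = 0 ↔ ∀ v w, tri G u v w = 0 := by
  constructor
  · intro h v w
    rw [← vecMul_xmap, h, Matrix.vecMul_zero, zero_dotProduct]
  · intro h
    ext j k
    have := sandwich_xmap G 1 1 u j k
    rw [h] at this
    simpa using this

end tri

/-! ### The tuple determined by the data -/

section

variable {p d : ℕ} [Fact p.Prime]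

/-- A spanning complement with the right number of vectors is automatically independent and meets
`K` trivially, by counting dimensions. -/
theorem RowInput.of_sup {K R : Submodule (ZMod p) (Vec p d)} {Kl Rl C : List (Vec p d)}
    (mem_K : ∀ x, x ∈ Kl ↔ x ∈ K) (mem_R : ∀ x, x ∈ Rl ↔ x ∈ R) (R_le : R ≤ K)
    (sup : K ⊔ lspan C = ⊤) (card : Module.finrank (ZMod p) K + C.length = d) :
    RowInput K R Kl Rl C := by
  have h1 := Submodule.finrank_sup_add_finrank_inf_eq K (lspan C)
  rw [sup, finrank_top, Module.finrank_fin_fun] at h1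
  have h2 := finrank_lspan_le C
  exact ⟨mem_K, mem_R, R_le, Submodule.finrank_eq_zero.1 (by omega), sup, by omega⟩

theorem linearIndependent_get {l : List (Vec p d)}
    (h : Module.finrank (ZMod p) (lspan l) = l.length) :
    LinearIndependent (ZMod p) fun i : Fin l.length => l.get i := by
  rw [linearIndependent_iff_card_eq_finrank_span, Fintype.card_fin, Set.finrank]
  have e : (Set.range fun i : Fin l.length => l.get i) = {x | x ∈ l} := by
    ext x
    rw [Set.mem_range]
    exact List.mem_iff_get.symm
  rw [e]
  exact h.symm

theorem RowInput.isComplement {K R : Submodule (ZMod p) (Vec p d)} {Kl Rl C : List (Vec p d)}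
    (h : RowInput K R Kl Rl C) :
    IsComplement K (Matrix.of fun i : Fin C.length => C.get i : Mat p C.length d) := by
  refine ⟨by have := h.finrank_add; omega, linearIndependent_get h.card, ?_⟩
  rw [← h.inf, lspan]
  congr 2
  ext x
  rw [Set.mem_range]
  exact List.mem_iff_get.symm

theorem isAttributeSet_toFinset {l : List (Vec p d)}
    (h : Module.finrank (ZMod p) (lspan l) = l.length) :
    IsAttributeSet l.toFinset ∧ l.toFinset.card = l.length := by
  have h1 : Submodule.span (ZMod p) (l.toFinset : Set (Vec p d)) = lspan l := by
    rw [lspan]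
    congr 1
    ext x
    simp
  have h2 := finrank_span_finset_le_card (R := ZMod p) l.toFinset
  rw [Set.finrank, h1, h] at h2
  have h3 := l.toFinset_card_le
  refine ⟨?_, by omega⟩
  rw [IsAttributeSet, linearIndependent_iff_card_eq_finrank_span, Set.finrank, Fintype.card_coe]
  have : Set.range (fun x : l.toFinset => (x : Vec p d)) = (l.toFinset : Set (Vec p d)) := by
    ext x
    simp
  rw [this, h1, h]
  omega

theorem finrank_orth_ge (l : List (Vec p d)) :
    d ≤ Module.finrank (ZMod p) (orth l.toFinset) + l.length := by
  let f : Vec p d →ₗ[ZMod p] (Fin l.length → ZMod p) :=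
    Matrix.mulVecLin (Matrix.of fun i : Fin l.length => l.get i)
  have h1 := f.finrank_range_add_finrank_ker
  have h2 := Submodule.finrank_le (LinearMap.range f)
  rw [Module.finrank_fin_fun] at h1 h2
  have h3 : LinearMap.ker f = orth l.toFinset := by
    ext v
    rw [LinearMap.mem_ker, Matrix.mulVecLin_apply]
    constructor
    · intro h x hx
      obtain ⟨i, rfl⟩ := List.mem_iff_get.1 (List.mem_toFinset.1 hx)
      exact congrFun h i
    · intro h
      funext i
      exact h _ (List.mem_toFinset.2 (List.get_mem l i))
  rw [h3] at h1
  omega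

/-- The rows as an invertible matrix. -/
noncomputable def IsRows.toGL {a b α β : ℕ} {K R : Submodule (ZMod p) (Vec p d)}
    {φ : Vec p d →ₗ[ZMod p] Mat p a b} {N : Fin d → Vec p d} (h : IsRows K R φ α β N) :
    GL (Fin d) (ZMod p) :=
  (Matrix.linearIndependent_rows_iff_isUnit (A := Matrix.of N) |>.1 h.indep).unit

theorem IsRows.isFormatting {a b α β c : ℕ} {K R : Submodule (ZMod p) (Vec p d)}
    {φ : Vec p d →ₗ[ZMod p] Mat p a b} {N : Fin d → Vec p d} (h : IsRows K R φ α β N)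
    {C : Mat p c d}
    (hC : ∀ (i : Fin d) (k : Fin c), (i : ℕ) = Module.finrank (ZMod p) K + k → N i = C k) :
    IsFormatting K C h.toGL := by
  refine ⟨?_, fun i k hik => hC i k hik⟩
  conv_rhs => rw [h.eq_K]
  rw [sp]
  congr 1
  ext v
  constructor
  · rintro ⟨i, hi, rfl⟩
    exact ⟨i, hi, rfl⟩
  · rintro ⟨i, hi, rfl⟩
    exact ⟨i, hi, rfl⟩

section basis

variable {a b k l α β : ℕ} {K : Submodule (ZMod p) (Vec p d)} {L : Mat p a k} {M : Mat p l b}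
  {ψ : Vec p d →ₗ[ZMod p] Mat p k l} {N : Fin d → Vec p d}

theorem IsRows.le_dim (h : IsRows K (K ⊓ LinearMap.ker ψ) (sandwich L M ∘ₗ ψ) α β N) :
    α + β ≤ d := h.le.trans h.finrank_le

theorem IsRows.finrank_map (h : IsRows K (K ⊓ LinearMap.ker ψ) (sandwich L M ∘ₗ ψ) α β N) :
    Module.finrank (ZMod p) (K.map ψ) = α + β := by
  have h1 := h.finrank_R
  have h2 := finrank_map_add_finrank_inf_ker K ψ
  omega

/-- Here `R` is exactly the kernel of `ψ` on `K`. Applying `ψ` therefore lowers the dimension `α +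
dim R` of the vectors with zero key to `α`. -/
theorem IsRows.finrank_zeroSpace
    (h : IsRows K (K ⊓ LinearMap.ker ψ) (sandwich L M ∘ₗ ψ) α β N) :
    Module.finrank (ZMod p) (zeroSpace L M (K.map ψ)) = α := by
  have h1 := h.finrank_inf_ker fun v hv => by
    rw [LinearMap.mem_ker, LinearMap.comp_apply, LinearMap.mem_ker.1 hv.2, map_zero]
  have h2 := finrank_map_add_finrank_inf_ker (K ⊓ LinearMap.ker (sandwich L M ∘ₗ ψ)) ψ
  have h3 : K ⊓ LinearMap.ker (sandwich L M ∘ₗ ψ) ⊓ LinearMap.ker ψ = K ⊓ LinearMap.ker ψ := by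
    refine le_antisymm (inf_le_inf_right _ inf_le_left) fun v hv => ⟨⟨hv.1, ?_⟩, hv.2⟩
    rw [SetLike.mem_coe, LinearMap.mem_ker, LinearMap.comp_apply, LinearMap.mem_ker.1 hv.2,
      map_zero]
  have h4 : (K ⊓ LinearMap.ker (sandwich L M ∘ₗ ψ)).map ψ = zeroSpace L M (K.map ψ) := by
    ext A
    constructor
    · rintro ⟨v, ⟨hv, hv'⟩, rfl⟩
      exact ⟨⟨v, hv, rfl⟩, hv'⟩
    · rintro ⟨⟨v, hv, rfl⟩, hv'⟩
      exact ⟨v, ⟨hv, hv'⟩, rfl⟩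
  rw [h3, h4] at h2
  omega

theorem IsRows.finrank_map_sandwich
    (h : IsRows K (K ⊓ LinearMap.ker ψ) (sandwich L M ∘ₗ ψ) α β N) :
    Module.finrank (ZMod p) ((K.map ψ).map (sandwich L M)) = β := by
  have h1 := finrank_map_add_finrank_inf_ker (K.map ψ) (sandwich L M)
  have h2 := h.finrank_zeroSpace
  have h3 := h.finrank_map
  rw [zeroSpace] at h2
  omega

/-- A matrix outside the span of the earlier basis elements lifts to a vector of `K` outside the
span of the earlier rows and `R`, since `ψ` kills `R`. The minimality of rows therefore descends to
matrices. -/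
theorem IsRows.isSemiCanonicalBasis
    (h : IsRows K (K ⊓ LinearMap.ker ψ) (sandwich L M ∘ₗ ψ) α β N) :
    IsSemiCanonicalBasis L M (K.map ψ)
      (fun j : Fin (α + β) => ψ (N (Fin.castLE h.le_dim j))) := by
  have hK : K = sp N (fun i => (i : ℕ) < α + β) ⊔ (K ⊓ LinearMap.ker ψ) := by
    conv_rhs => rw [h.eq_R, sp_or]
    conv_lhs => rw [h.eq_K]
    congr 1
    ext i
    have := h.le
    omega
  refine ⟨h.finrank_map, ?_, fun i B hB hB' => ?_⟩
  · refine le_antisymm (Submodule.span_le.2 ?_) ?_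
    · rintro _ ⟨j, rfl⟩
      exact ⟨_, h.mem_K (lt_of_lt_of_le j.2 h.le), rfl⟩
    · rintro _ ⟨v, hv, rfl⟩
      rw [SetLike.mem_coe, hK] at hv
      obtain ⟨y, hy, z, hz, rfl⟩ := Submodule.mem_sup.1 hv
      rw [map_add, LinearMap.mem_ker.1 hz.2, add_zero]
      obtain ⟨c, hc, rfl⟩ := mem_sp.1 hy
      rw [map_sum]
      refine sum_mem fun j _ => ?_
      rw [map_smul]
      by_cases hj : (j : ℕ) < α + β
      · exact Submodule.smul_mem _ _ (Submodule.subset_span ⟨⟨j, hj⟩, rfl⟩)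
      · rw [hc j hj, zero_smul]
        exact zero_mem _
  · obtain ⟨y, hy, rfl⟩ := hB
    refine h.min _ i.2 y hy fun hm => hB' ?_
    obtain ⟨z, hz, r, hr, rfl⟩ := Submodule.mem_sup.1 hm
    rw [map_add, LinearMap.mem_ker.1 hr.2, add_zero]
    obtain ⟨c, hc, rfl⟩ := mem_sp.1 hz
    rw [map_sum]
    refine sum_mem fun j _ => ?_
    rw [map_smul]
    by_cases hj : j < Fin.castLE h.le_dim i
    · refine Submodule.smul_mem _ _ (Submodule.subset_span
        ⟨⟨j, lt_trans (Fin.lt_def.1 hj) i.2⟩, Fin.lt_def.1 hj, rfl⟩)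
    · rw [hc j hj, zero_smul]
      exact zero_mem _

end basis

end

namespace TupleData

variable {p m n : ℕ} (D : TupleData p m n) (G : Tensor p m n)

/-- The characterization tuple determined by the data. -/
noncomputable def toTuple : CharTuple p m n where
  a := D.Ls.length
  b := D.L.length
  cs := (D.Cs G).length
  c := (D.C G).length
  Lskew := Matrix.of fun i => D.Ls.get i
  L := Matrix.of fun i => D.L.get i
  Λ := D.Λ.toFinset
  Cskew := Matrix.of fun i => (D.Cs G).get i
  C := Matrix.of fun i => (D.C G).get i

theorem sandwich_xmap_eq_zero {u : Vec p m} :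
    (D.toTuple G).Lskew * xmap G u * (D.toTuple G).Lskewᵀ = 0 ↔
      ∀ x ∈ D.Ls, ∀ y ∈ D.Ls, tri G u x y = 0 := by
  constructor
  · intro h x hx y hy
    obtain ⟨i, rfl⟩ := List.mem_iff_get.1 hx
    obtain ⟨j, rfl⟩ := List.mem_iff_get.1 hy
    exact (sandwich_xmap G _ _ u i j).symm.trans (congrFun (congrFun h i) j)
  · intro h
    ext i j
    rw [sandwich_xmap]
    exact h _ (List.get_mem _ _) _ (List.get_mem _ _)

theorem sandwich_ymap_eq_zero {v : Vec p n} :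
    (D.toTuple G).L * ymap G v * (D.toTuple G).Lskewᵀ = 0 ↔
      ∀ x ∈ D.L, ∀ y ∈ D.Ls, tri G x v y = 0 := by
  constructor
  · intro h x hx y hy
    obtain ⟨i, rfl⟩ := List.mem_iff_get.1 hx
    obtain ⟨j, rfl⟩ := List.mem_iff_get.1 hy
    exact (sandwich_ymap G _ _ v i j).symm.trans (congrFun (congrFun h i) j)
  · intro h
    ext i j
    rw [sandwich_ymap]
    exact h _ (List.get_mem _ _) _ (List.get_mem _ _)

theorem flat_sandwich_xmap (u : Vec p m) :
    D.keyX G u = flat (((sandwich (D.toTuple G).Lskew (D.toTuple G).Lskewᵀ) ∘ₗ xmap G) u) := by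
  have h : ((sandwich (D.toTuple G).Lskew (D.toTuple G).Lskewᵀ) ∘ₗ xmap G) u =
      fun i j => tri G u (D.Ls.get i) (D.Ls.get j) := by
    ext i j
    exact sandwich_xmap G _ _ u i j
  rw [h, keyX]
  change _ = (List.ofFn fun i j => tri G u (D.Ls.get i) (D.Ls.get j)).flatMap fun r => List.ofFn r
  conv_lhs => rw [← List.ofFn_get D.Ls]
  rw [List.flatMap_def, List.flatMap_def, List.map_ofFn, List.map_ofFn]
  congr 2
  funext i
  simp only [Function.comp_apply, List.map_ofFn]
  rfl

theorem flat_sandwich_ymap (v : Vec p n) :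
    D.keyY G v = flat (((sandwich (D.toTuple G).L (D.toTuple G).Lskewᵀ) ∘ₗ ymap G) v) := by
  have h : ((sandwich (D.toTuple G).L (D.toTuple G).Lskewᵀ) ∘ₗ ymap G) v =
      fun i j => tri G (D.L.get i) v (D.Ls.get j) := by
    ext i j
    exact sandwich_ymap G _ _ v i j
  rw [h, keyY]
  change _ = (List.ofFn fun i j => tri G (D.L.get i) v (D.Ls.get j)).flatMap fun r => List.ofFn r
  conv_lhs => rw [← List.ofFn_get D.L, ← List.ofFn_get D.Ls]
  rw [List.flatMap_def, List.flatMap_def, List.map_ofFn, List.map_ofFn]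
  congr 2
  funext i
  simp only [Function.comp_apply, List.map_ofFn]
  rfl

theorem span_Λ : Submodule.span (ZMod p) ((D.toTuple G).Λ : Set (Vec p n)) = lspan D.Λ := by
  rw [lspan]
  congr 1
  ext x
  simp [toTuple]

variable [Fact p.Prime]

theorem mem_zeroX {A : Mat p n n} :
    A ∈ (D.toTuple G).zeroX G ↔ ∃ u ∈ D.zeroX G, xmap G u = A := by
  simp only [CharTuple.zeroX, zeroSpace, ← range_xmap, TupleData.zeroX, mem_sel, mem_vecs,
    true_and, ← D.sandwich_xmap_eq_zero G]
  constructor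
  · rintro ⟨⟨u, rfl⟩, h⟩
    exact ⟨u, h, rfl⟩
  · rintro ⟨u, h, rfl⟩
    exact ⟨⟨u, rfl⟩, h⟩

theorem mem_zeroY {A : Mat p m n} :
    A ∈ (D.toTuple G).zeroY G ↔ ∃ v ∈ D.zeroY G, ymap G v = A := by
  simp only [CharTuple.zeroY, zeroSpace, ← range_ymap, TupleData.zeroY, mem_sel, mem_vecs,
    true_and, ← D.sandwich_ymap_eq_zero G]
  constructor
  · rintro ⟨⟨u, rfl⟩, h⟩
    exact ⟨u, h, rfl⟩
  · rintro ⟨u, h, rfl⟩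
    exact ⟨⟨u, rfl⟩, h⟩

theorem mem_orth {v : Vec p n} : v ∈ orth (D.toTuple G).Λ ↔ ∀ x ∈ D.Λ, x ⬝ᵥ v = 0 := by
  simp only [orth, toTuple]
  exact ⟨fun h x hx => h x (List.mem_toFinset.2 hx), fun h x hx => h x (List.mem_toFinset.1 hx)⟩

theorem mem_KX {v : Vec p n} :
    v ∈ D.KX G ↔ v ∈ kerSkew ((D.toTuple G).zeroX G) (D.toTuple G).Λ := by
  rw [KX, mem_sel, mem_perp, kerSkew, Submodule.mem_inf, mem_orth]
  refine and_congr_right fun _ => ?_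
  constructor
  · intro h A hA
    obtain ⟨u, hu, rfl⟩ := (D.mem_zeroX G).1 hA
    rw [span_Λ, mem_lspan_iff]
    intro w hw
    rw [vecMul_xmap]
    exact h u hu w hw
  · intro h u hu w hw
    have := h _ ((D.mem_zeroX G).2 ⟨u, hu, rfl⟩)
    rw [span_Λ, mem_lspan_iff] at this
    rw [← vecMul_xmap]
    exact this w hw

theorem mem_KY {u : Vec p m} :
    u ∈ D.KY G ↔ u ∈ ker ((D.toTuple G).zeroY G) (D.toTuple G).Λ := by
  rw [KY, mem_sel]
  constructor
  · intro h A hA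
    obtain ⟨v, hv, rfl⟩ := (D.mem_zeroY G).1 hA
    rw [span_Λ, mem_lspan_iff]
    intro w hw
    rw [vecMul_ymap]
    exact h.2 v hv w hw
  · intro h
    refine ⟨mem_vecs _, fun v hv w hw => ?_⟩
    have := h _ ((D.mem_zeroY G).2 ⟨v, hv, rfl⟩)
    rw [span_Λ, mem_lspan_iff] at this
    rw [← vecMul_ymap]
    exact this w hw

/-- The kernel `ker_skew` as a submodule. -/
noncomputable def subX : Submodule (ZMod p) (Vec p n) :=
  kerSkew ((D.toTuple G).zeroX G) (D.toTuple G).Λ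

/-- The kernel `ker` as a submodule. -/
noncomputable def subY : Submodule (ZMod p) (Vec p m) :=
  ker ((D.toTuple G).zeroY G) (D.toTuple G).Λ

theorem finrank_Λ : Module.finrank (ZMod p) (lspan D.Λ) = D.Λ.length := by
  have := finrank_lspan_greedy [] D.Λ₀
  rwa [List.nil_append, lspan_nil, finrank_bot, zero_add] at this

theorem lspan_KX_C₁ : lspan (D.KX G ++ D.C₁ G) = orth (D.toTuple G).Λ := by
  rw [C₁, lspan_greedy, lspan_append, lspan_append]
  have h1 : lspan (perp D.Λ) = orth (D.toTuple G).Λ := lspan_eq fun x => by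
    rw [mem_perp, mem_orth]
  have h2 : lspan (sel (fun v => ∀ x ∈ D.Λ, x ⬝ᵥ v = 0) D.Cs₁) ≤ orth (D.toTuple G).Λ :=
    lspan_le.2 fun x hx => (D.mem_orth G).2 (mem_sel.1 hx).2
  have h3 : lspan (D.KX G) ≤ orth (D.toTuple G).Λ := lspan_le.2 fun x hx =>
    ((D.mem_KX G).1 hx).1
  rw [h1, sup_eq_left.2 h2, sup_eq_right.2 h3]

theorem lspan_KX : lspan (D.KX G) = D.subX G := lspan_eq fun _ => D.mem_KX G

theorem lspan_KY : lspan (D.KY G) = D.subY G := lspan_eq fun _ => D.mem_KY G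

theorem finrank_orth : Module.finrank (ZMod p) (orth (D.toTuple G).Λ) =
    Module.finrank (ZMod p) (D.subX G) + (D.C₁ G).length := by
  have := finrank_lspan_greedy (D.KX G) (perp D.Λ ++ sel (fun v => ∀ x ∈ D.Λ, x ⬝ᵥ v = 0) D.Cs₁)
  change Module.finrank (ZMod p) (lspan (D.KX G ++ D.C₁ G)) = _ + (D.C₁ G).length at this
  rwa [lspan_KX_C₁, lspan_KX] at this

theorem lspan_KX_Cs : lspan (D.KX G ++ D.C₁ G ++ D.C₂ G) = ⊤ := by
  rw [C₂, lspan_greedy, lspan_append, lspan_append (vecs p n), lspan_vecs, top_sup_eq,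
    sup_top_eq]

theorem finrank_orth_add : Module.finrank (ZMod p) (orth (D.toTuple G).Λ) + (D.C₂ G).length
    = n := by
  have := finrank_lspan_greedy (D.KX G ++ D.C₁ G) (vecs p n ++ D.Cs₂)
  change Module.finrank (ZMod p) (lspan (D.KX G ++ D.C₁ G ++ D.C₂ G)) = _ + (D.C₂ G).length at this
  rw [lspan_KX_C₁, lspan_KX_Cs, finrank_top, Module.finrank_fin_fun] at this
  exact this.symm

theorem length_C₂_le : (D.C₂ G).length ≤ D.Λ.length := by
  have h1 := D.finrank_orth_add G
  have h2 := finrank_orth_ge D.Λ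
  change n ≤ Module.finrank (ZMod p) (orth (D.toTuple G).Λ) + _ at h2
  omega

theorem mem_RX {v : Vec p n} :
    v ∈ D.RX G ↔ v ∈ D.subX G ⊓ LinearMap.ker (ymap G) := by
  rw [RX, mem_sel, mem_KX, Submodule.mem_inf, LinearMap.mem_ker, ymap_eq_zero_iff]
  exact and_congr_right fun _ => ⟨fun h u w => h u (mem_vecs _) w (mem_vecs _),
    fun h u _ w _ => h u w⟩

theorem mem_RY {u : Vec p m} :
    u ∈ D.RY G ↔ u ∈ D.subY G ⊓ LinearMap.ker (xmap G) := by
  rw [RY, mem_sel, mem_KY, Submodule.mem_inf, LinearMap.mem_ker, xmap_eq_zero_iff]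
  exact and_congr_right fun _ => ⟨fun h u w => h u (mem_vecs _) w (mem_vecs _),
    fun h u _ w _ => h u w⟩

theorem rowInputN : RowInput (D.subX G) (D.subX G ⊓ LinearMap.ker (ymap G)) (D.KX G) (D.RX G)
    (D.Cs G) := by
  refine RowInput.of_sup (fun _ => D.mem_KX G) (fun _ => D.mem_RX G) inf_le_left ?_ ?_
  · rw [← lspan_KX, ← lspan_append, Cs, ← List.append_assoc, lspan_KX_Cs]
  · rw [Cs, List.length_append, ← add_assoc, ← finrank_orth, finrank_orth_add]

theorem rowInputM : RowInput (D.subY G) (D.subY G ⊓ LinearMap.ker (xmap G)) (D.KY G) (D.RY G)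
    (D.C G) := by
  have h1 : lspan (D.KY G ++ D.C G) = ⊤ := by
    rw [C, lspan_greedy, lspan_append, lspan_append, lspan_vecs, top_sup_eq, sup_top_eq]
  refine RowInput.of_sup (fun _ => D.mem_KY G) (fun _ => D.mem_RY G) inf_le_left ?_ ?_
  · rw [← lspan_KY, ← lspan_append, h1]
  · have := finrank_lspan_greedy (D.KY G) (vecs p m ++ D.C₀)
    change Module.finrank (ZMod p) (lspan (D.KY G ++ D.C G)) = _ + (D.C G).length at this
    rw [h1, lspan_KY, finrank_top, Module.finrank_fin_fun] at this
    exact this.symm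

theorem length_rowsN : (D.rowsN G).length = n := (D.rowInputN G).length_rows _

theorem length_rowsM : (D.rowsM G).length = m := (D.rowInputM G).length_rows _

theorem forall_mem_flat {k l : ℕ} {A : Mat p k l} : (∀ c ∈ flat A, c = 0) ↔ A = 0 := by
  constructor
  · intro h
    ext i j
    refine h _ (List.mem_flatMap.2 ⟨A i, ?_, ?_⟩)
    · exact List.mem_ofFn.2 ⟨i, rfl⟩
    · exact List.mem_ofFn.2 ⟨j, rfl⟩
  · rintro rfl c hc
    obtain ⟨r, hr, hc⟩ := List.mem_flatMap.1 hc
    obtain ⟨i, rfl⟩ := List.mem_ofFn.1 hr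
    obtain ⟨j, rfl⟩ := List.mem_ofFn.1 hc
    rfl

theorem isRowsN : IsRows (D.subX G) (D.subX G ⊓ LinearMap.ker (ymap G))
    (sandwich (D.toTuple G).L (D.toTuple G).Lskewᵀ ∘ₗ ymap G) (D.form G).αY (D.form G).βY
    (fun i : Fin n => (D.rowsN G).getD i 0) := by
  have h := (D.rowInputN G).isRows (D.keyY G) (D.flat_sandwich_ymap G)
  simp only [form, flat_sandwich_ymap, forall_mem_flat]
  exact h

theorem isRowsM : IsRows (D.subY G) (D.subY G ⊓ LinearMap.ker (xmap G))
    (sandwich (D.toTuple G).Lskew (D.toTuple G).Lskewᵀ ∘ₗ xmap G) (D.form G).αX (D.form G).βX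
    (fun i : Fin m => (D.rowsM G).getD i 0) := by
  have h := (D.rowInputM G).isRows (D.keyX G) (D.flat_sandwich_xmap G)
  simp only [form, flat_sandwich_xmap, forall_mem_flat]
  exact h

theorem isFor (hLs : D.Ls ≠ []) (hL : D.L ≠ []) : (D.toTuple G).IsFor G := by
  obtain ⟨h1, h2⟩ := isAttributeSet_toFinset D.finrank_Λ
  refine ⟨List.length_pos_of_ne_nil hLs, List.length_pos_of_ne_nil hL, h1,
    ⟨(D.rowInputN G).isComplement, fun i hi x hx => ?_⟩, (D.rowInputM G).isComplement⟩
  have h3 := D.length_C₂_le G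
  change (i : ℕ) + D.Λ.toFinset.card < (D.Cs G).length at hi
  rw [h2] at hi
  have h4 : (D.Cs G).length = (D.C₁ G).length + (D.C₂ G).length := List.length_append
  -- As `C₂` has at most `|Λ|` vectors, an index more than `|Λ|` places from the end belongs to
  -- `C₁`, whose members are orthogonal to `Λ`.
  have h5 : (D.Cs G).get i = (D.C₁ G)[(i : ℕ)]'(by omega) := by
    exact List.getElem_append_left (by omega)
  change x ⬝ᵥ (D.Cs G).get i = 0
  rw [h5]
  have h6 : (D.C₁ G)[(i : ℕ)]'(by omega) ∈ orth (D.toTuple G).Λ := by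
    rw [← lspan_KX_C₁]
    exact mem_lspan (List.mem_append_right _ (List.getElem_mem _))
  exact h6 x hx

theorem kerSpaceX_eq : (D.toTuple G).kerSpaceX G = (D.subY G).map (xmap G) := by
  refine le_antisymm (Submodule.span_le.2 ?_) ?_
  · rintro _ ⟨v, hv, rfl⟩
    exact ⟨v, hv, rfl⟩
  · rintro _ ⟨v, hv, rfl⟩
    exact Submodule.subset_span ⟨v, hv, rfl⟩

theorem kerSpaceY_eq : (D.toTuple G).kerSpaceY G = (D.subX G).map (ymap G) := by
  refine le_antisymm (Submodule.span_le.2 ?_) ?_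
  · rintro _ ⟨v, hv, rfl⟩
    exact ⟨v, hv, rfl⟩
  · rintro _ ⟨v, hv, rfl⟩
    exact Submodule.subset_span ⟨v, hv, rfl⟩

theorem αX_eq : (D.toTuple G).αX G = (D.form G).αX := by
  rw [CharTuple.αX, kerSpaceX_eq, (D.isRowsM G).finrank_zeroSpace]

theorem βX_eq : (D.toTuple G).βX G = (D.form G).βX := by
  rw [CharTuple.βX, kerSpaceX_eq, (D.isRowsM G).finrank_map_sandwich]

theorem αY_eq : (D.toTuple G).αY G = (D.form G).αY := by
  rw [CharTuple.αY, kerSpaceY_eq, (D.isRowsN G).finrank_zeroSpace]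

theorem βY_eq : (D.toTuple G).βY G = (D.form G).βY := by
  rw [CharTuple.βY, kerSpaceY_eq, (D.isRowsN G).finrank_map_sandwich]

/-- The formatting matrices. -/
noncomputable def matN : GL (Fin n) (ZMod p) := (D.isRowsN G).toGL

noncomputable def matM : GL (Fin m) (ZMod p) := (D.isRowsM G).toGL

theorem form_tensor : (D.form G).tensor = trans (D.matN G) (D.matM G) G := by
  funext i j k
  rw [trans_apply]
  rfl

theorem isSemiCanonicalForm : (D.toTuple G).IsSemiCanonicalForm G (D.form G).tensor := by
  refine ⟨D.matN G, D.matM G, D.form_tensor G, ?_, ?_, ?_, ?_⟩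
  · refine (D.isRowsN G).isFormatting fun i k hik => ?_
    refine ((D.rowInputN G).tail (D.keyY G) i k hik).trans ?_
    exact List.getD_eq_getElem _ _ _
  · rw [αY_eq, βY_eq, kerSpaceY_eq]
    refine ⟨(D.isRowsN G).le_dim, ?_⟩
    refine Eq.mp (congrArg _ (funext fun j => ?_)) (D.isRowsN G).isSemiCanonicalBasis
    -- Transforming by `N` also multiplies the slices on the right by the transpose of `N`. The
    -- inverse in the definition of a semi-canonical form cancels this factor and leaves `ymap` of a
    -- row of `N`.
    have h : sliceY (trans (D.matN G) 1 G) (Fin.castLE (D.isRowsN G).le_dim j) =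
        ymap G ((D.matN G : Mat p n n) (Fin.castLE (D.isRowsN G).le_dim j)) *
          (D.matN G : Mat p n n)ᵀ := by
      ext i k
      have := sandwich_ymap G (1 : Mat p m m) (D.matN G : Mat p n n)
        ((D.matN G : Mat p n n) (Fin.castLE (D.isRowsN G).le_dim j)) i k
      rw [Matrix.one_mul] at this
      rw [this]
      exact trans_apply ..
    rw [h, Matrix.mul_nonsing_inv_cancel_right]
    · rfl
    · rw [Matrix.det_transpose]
      exact (Matrix.isUnit_iff_isUnit_det _).1 (D.matN G).isUnit
  · refine (D.isRowsM G).isFormatting fun i k hik => ?_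
    refine ((D.rowInputM G).tail (D.keyX G) i k hik).trans ?_
    exact List.getD_eq_getElem _ _ _
  · rw [αX_eq, βX_eq, kerSpaceX_eq]
    refine ⟨(D.isRowsM G).le_dim, ?_⟩
    refine Eq.mp (congrArg _ (funext fun j => ?_)) (D.isRowsM G).isSemiCanonicalBasis
    ext i k
    have := sandwich_xmap G (1 : Mat p n n) (1 : Mat p n n)
      ((D.matM G : Mat p m m) (Fin.castLE (D.isRowsM G).le_dim j)) i k
    rw [Matrix.one_mul, Matrix.transpose_one, Matrix.mul_one] at this
    have e : sliceX (trans 1 (D.matM G) G) (Fin.castLE (D.isRowsM G).le_dim j) i k =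
        trans 1 (D.matM G) G (Fin.castLE (D.isRowsM G).le_dim j) i k := rfl
    rw [e, trans_apply, Units.val_one]
    exact this

theorem isSemiForm (hG : IsSkewTensor G) (hLs : D.Ls ≠ []) (hL : D.L ≠ []) :
    IsSemiForm (D.form G) :=
  ⟨G, D.toTuple G, hG, D.isFor G hLs hL, D.isSemiCanonicalForm G, (D.αX_eq G).symm,
    (D.βX_eq G).symm, (D.αY_eq G).symm, (D.βY_eq G).symm⟩

end TupleData

/-! ### Transport of the data along an isometry -/

section

variable {p m n : ℕ}

theorem xmap_trans (N : GL (Fin n) (ZMod p)) (M : GL (Fin m) (ZMod p)) (G : Tensor p m n)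
    (u : Vec p m) : xmap (trans N M G) u =
      (N : Mat p n n) * xmap G (u ᵥ* (M : Mat p m m)) * (N : Mat p n n)ᵀ := by
  have h : ∀ i, sliceX (trans N M G) i =
      (N : Mat p n n) * xmap G ((M : Mat p m m) i) * (N : Mat p n n)ᵀ := fun i => by
    ext j k
    rw [sandwich_xmap]
    exact trans_apply ..
  rw [xmap_apply, Matrix.vecMul_eq_sum, map_sum, Matrix.mul_sum, Matrix.sum_mul]
  refine Finset.sum_congr rfl fun i _ => ?_
  rw [h, map_smul, Matrix.mul_smul, Matrix.smul_mul]

theorem tri_trans (N : GL (Fin n) (ZMod p)) (M : GL (Fin m) (ZMod p)) (G : Tensor p m n)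
    (u : Vec p m) (v w : Vec p n) : tri (trans N M G) u v w =
      tri G (u ᵥ* (M : Mat p m m)) (v ᵥ* (N : Mat p n n)) (w ᵥ* (N : Mat p n n)) := by
  rw [← vecMul_xmap, ← vecMul_xmap, xmap_trans, ← Matrix.vecMul_vecMul, ← Matrix.vecMul_vecMul,
    ← Matrix.dotProduct_mulVec, Matrix.mulVec_transpose]

theorem trans_trans (N N' : GL (Fin n) (ZMod p)) (M M' : GL (Fin m) (ZMod p)) (G : Tensor p m n) :
    trans N' M' (trans N M G) = trans (N' * N) (M' * M) G := by
  funext i j k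
  rw [trans_apply, tri_trans, trans_apply]
  rfl

theorem trans_one (G : Tensor p m n) : trans 1 1 G = G := by
  funext i j k
  rw [trans, Units.val_one, Units.val_one]
  simp [Matrix.one_apply, sliceX]

theorem IsometricTensors.symm {G H : Tensor p m n} (h : IsometricTensors G H) :
    IsometricTensors H G := by
  obtain ⟨N, M, rfl⟩ := h
  refine ⟨N⁻¹, M⁻¹, ?_⟩
  rw [trans_trans, inv_mul_cancel, inv_mul_cancel, trans_one]

theorem IsometricTensors.trans {G H S : Tensor p m n} (h : IsometricTensors G H)
    (h' : IsometricTensors H S) : IsometricTensors G S := by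
  obtain ⟨N, M, rfl⟩ := h
  obtain ⟨N', M', rfl⟩ := h'
  exact ⟨N' * N, M' * M, (trans_trans ..).symm⟩

theorem tri_sub_left (G : Tensor p m n) (u u' : Vec p m) (v w : Vec p n) :
    tri G (u - u') v w = tri G u v w - tri G u' v w := by
  simp only [← vecMul_xmap, map_sub, Matrix.vecMul_sub, sub_dotProduct]

theorem tri_sub_mid (G : Tensor p m n) (u : Vec p m) (v v' w : Vec p n) :
    tri G u (v - v') w = tri G u v w - tri G u v' w := by
  simp only [← vecMul_ymap, map_sub, Matrix.vecMul_sub, sub_dotProduct]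

theorem IsSkewTensor.apply {G : Tensor p m n} (hG : IsSkewTensor G) (i : Fin m) (j k : Fin n) :
    G i j k = -G i k j :=
  congrFun (congrFun (hG.1 (sliceX G i) (Submodule.subset_span ⟨i, rfl⟩)) j) k

theorem IsSkewTensor.tri_swap {G : Tensor p m n} (hG : IsSkewTensor G) (u : Vec p m)
    (v w : Vec p n) : tri G u v w = -tri G u w v := by
  rw [tri_eq_sum, tri_eq_sum, ← Finset.sum_neg_distrib]
  refine Finset.sum_congr rfl fun i _ => ?_
  rw [Finset.sum_comm, ← Finset.sum_neg_distrib]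
  refine Finset.sum_congr rfl fun k _ => ?_
  rw [← Finset.sum_neg_distrib]
  refine Finset.sum_congr rfl fun j _ => ?_
  rw [hG.apply i j k]
  ring

/-- Skew-symmetry exchanges the last two arguments, so the kernel of `ymap` is negligible in both of
them. Formatting rows therefore matter only modulo `R`. -/
theorem tri_congr {G : Tensor p m n} (hG : IsSkewTensor G) {u u' : Vec p m} {v v' w w' : Vec p n}
    (hu : u - u' ∈ LinearMap.ker (xmap G)) (hv : v - v' ∈ LinearMap.ker (ymap G))
    (hw : w - w' ∈ LinearMap.ker (ymap G)) : tri G u v w = tri G u' v' w' := by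
  have h1 := (xmap_eq_zero_iff G).1 (LinearMap.mem_ker.1 hu) v w
  have h2 := (ymap_eq_zero_iff G).1 (LinearMap.mem_ker.1 hv) u' w
  have h3 := (ymap_eq_zero_iff G).1 (LinearMap.mem_ker.1 hw) u' v'
  rw [tri_sub_left, sub_eq_zero] at h1
  rw [tri_sub_mid, sub_eq_zero] at h2 h3
  rw [h1, h2, hG.tri_swap u' v' w, h3, ← hG.tri_swap]

/-- The linear equivalence given by an invertible matrix acting on row vectors. -/
noncomputable def vecMulEquiv {d : ℕ} (A : GL (Fin d) (ZMod p)) : Vec p d ≃ₗ[ZMod p] Vec p d :=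
  LinearEquiv.ofLinearMap (Matrix.vecMulLinear (A : Mat p d d))
    (Matrix.vecMulLinear ((A⁻¹ : GL (Fin d) (ZMod p)) : Mat p d d))
    (LinearMap.ext fun v => by
      rw [LinearMap.comp_apply, Matrix.vecMulLinear_apply, Matrix.vecMulLinear_apply,
        Matrix.vecMul_vecMul, ← Units.val_mul, inv_mul_cancel, Units.val_one, Matrix.vecMul_one]
      rfl)
    (LinearMap.ext fun v => by
      rw [LinearMap.comp_apply, Matrix.vecMulLinear_apply, Matrix.vecMulLinear_apply,
        Matrix.vecMul_vecMul, ← Units.val_mul, mul_inv_cancel, Units.val_one, Matrix.vecMul_one]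
      rfl)

theorem vecMulEquiv_apply {d : ℕ} (A : GL (Fin d) (ZMod p)) (v : Vec p d) :
    vecMulEquiv A v = v ᵥ* (A : Mat p d d) := rfl

/-- Linear equivalences that take the trilinear form of `G` to that of `H`; `f'` is contragredient
to `f`. -/
structure Transport (G H : Tensor p m n) where
  f : Vec p n ≃ₗ[ZMod p] Vec p n
  f' : Vec p n ≃ₗ[ZMod p] Vec p n
  g : Vec p m ≃ₗ[ZMod p] Vec p m
  tri_eq : ∀ u v w, tri H (g u) (f v) (f w) = tri G u v w
  dot_eq : ∀ x v, f' x ⬝ᵥ f v = x ⬝ᵥ v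

theorem IsometricTensors.transport {G H : Tensor p m n} (h : IsometricTensors G H) :
    Nonempty (Transport G H) := by
  obtain ⟨N, M, rfl⟩ := h
  -- The form of the transformed tensor is that of `G` after multiplying the arguments by `N` and
  -- `M`, so arguments are carried over by the inverses. Attribute vectors are paired with arguments
  -- by the dot product and hence transform by the transpose of `N`.
  refine ⟨⟨vecMulEquiv N⁻¹, vecMulEquiv ⟨(N : Mat p n n)ᵀ, ((N⁻¹ : GL _ _) : Mat p n n)ᵀ, ?_, ?_⟩,
    vecMulEquiv M⁻¹, fun u v w => ?_, fun x v => ?_⟩⟩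
  · rw [← Matrix.transpose_mul, ← Units.val_mul, inv_mul_cancel, Units.val_one,
      Matrix.transpose_one]
  · rw [← Matrix.transpose_mul, ← Units.val_mul, mul_inv_cancel, Units.val_one,
      Matrix.transpose_one]
  · simp only [vecMulEquiv_apply, tri_trans, Matrix.vecMul_vecMul, ← Units.val_mul, inv_mul_cancel,
      Units.val_one, Matrix.vecMul_one]
  · simp only [vecMulEquiv_apply, Matrix.vecMul_transpose]
    rw [dotProduct_comm, Matrix.dotProduct_mulVec, Matrix.vecMul_vecMul, ← Units.val_mul,
      inv_mul_cancel, Units.val_one, Matrix.vecMul_one, dotProduct_comm]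

theorem lspan_map {d : ℕ} (f : Vec p d ≃ₗ[ZMod p] Vec p d) (l : List (Vec p d)) :
    lspan (l.map f) = (lspan l).map f.toLinearMap := by
  rw [lspan, lspan, Submodule.map_span]
  congr 1
  ext x
  simp

theorem finrank_lspan_map {d : ℕ} (f : Vec p d ≃ₗ[ZMod p] Vec p d) (l : List (Vec p d)) :
    Module.finrank (ZMod p) (lspan (l.map f)) = Module.finrank (ZMod p) (lspan l) := by
  rw [lspan_map]
  exact LinearEquiv.finrank_map_eq f (lspan l)

theorem mem_lspan_map {d : ℕ} (f : Vec p d ≃ₗ[ZMod p] Vec p d) {l : List (Vec p d)} {x : Vec p d} :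
    f x ∈ lspan (l.map f) ↔ x ∈ lspan l := by
  rw [lspan_map]
  exact ⟨fun ⟨y, hy, h⟩ => f.injective h ▸ hy, fun h => ⟨x, h, rfl⟩⟩

variable {a b d : ℕ} {K R K' R' : Submodule (ZMod p) (Vec p d)}
  {φ : Vec p d →ₗ[ZMod p] Mat p a b} {α β : ℕ}

theorem sp_map (f : Vec p d ≃ₗ[ZMod p] Vec p d) (N : Fin d → Vec p d) (P : Fin d → Prop)
    (x : Vec p d) : x ∈ sp (fun i => f.symm (N i)) P ↔ f x ∈ sp N P := by
  rw [mem_sp, mem_sp]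
  refine exists_congr fun c => and_congr_right fun _ => ?_
  simp only [← map_smul, ← map_sum]
  exact LinearEquiv.eq_symm_apply f

theorem IsRows.comap (f : Vec p d ≃ₗ[ZMod p] Vec p d) (hK : ∀ x, x ∈ K ↔ f x ∈ K')
    (hR : ∀ x, x ∈ R ↔ f x ∈ R') {N : Fin d → Vec p d}
    (h : IsRows K' R' (φ ∘ₗ f.symm.toLinearMap) α β N) :
    IsRows K R φ α β fun i => f.symm (N i) := by
  have e : K' = K.map f.toLinearMap := by
    ext x
    refine ⟨fun h => ⟨f.symm x, (hK _).2 (by simpa using h), by simp⟩, ?_⟩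
    rintro ⟨y, hy, rfl⟩
    exact (hK y).1 hy
  have hdim : Module.finrank (ZMod p) K' = Module.finrank (ZMod p) K := by
    rw [e]
    exact LinearEquiv.finrank_map_eq f K
  constructor
  · exact h.indep.map' f.symm.toLinearMap (LinearMap.ker_eq_bot.2 f.symm.injective)
  · exact hdim ▸ h.le
  · ext x
    rw [sp_map, hK, ← hdim]
    conv_lhs => rw [h.eq_K]
  · ext x
    rw [sp_map, hR, ← hdim]
    conv_lhs => rw [h.eq_R]
  · exact h.zero
  · intro i hi y hy hy'
    have := h.min i hi (f y) ((hK y).1 hy) fun hn => hy' ?_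
    · simpa using this
    · obtain ⟨s, hs, r, hr, hsr⟩ := Submodule.mem_sup.1 hn
      refine Submodule.mem_sup.2 ⟨f.symm s, (sp_map f N _ _).2 (by simpa using hs), f.symm r,
        (hR _).2 (by simpa using hr), ?_⟩
      rw [← map_add, hsr, LinearEquiv.symm_apply_apply]

end

theorem sel_eq_self {α : Type} {q : α → Prop} {l : List α} (h : ∀ x ∈ l, q x) : sel q l = l := by
  induction l with
  | nil => rfl
  | cons x l ih =>
    rw [sel_cons_of_pos (h x List.mem_cons_self), ih fun y hy => h y (List.mem_cons_of_mem _ hy)]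

/-! ### Forms computed from corresponding data -/

namespace TupleData

variable {p m n : ℕ} [Fact p.Prime] {G H : Tensor p m n}

/-- The data for `H` that correspond to data for `G`; all lists but the first two are padded with
zeros to prescribed lengths. -/
noncomputable def transport (D : TupleData p m n) (t : Transport G H) (kn km : ℕ) :
    TupleData p m n where
  Ls := D.Ls.map t.f
  L := D.L.map t.g
  Λ₀ := List.replicate (kn - D.Λ.length) 0 ++ D.Λ.map t.f'
  Cs₁ := List.replicate (kn - (D.C₁ G).length) 0 ++ (D.C₁ G).map t.f
  Cs₂ := List.replicate (kn - (D.C₂ G).length) 0 ++ (D.C₂ G).map t.f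
  C₀ := List.replicate (km - (D.C G).length) 0 ++ (D.C G).map t.g

variable (D : TupleData p m n) (t : Transport G H) (kn km : ℕ)

theorem transport_Λ : (D.transport t kn km).Λ = D.Λ.map t.f' := by
  rw [Λ, transport, greedy_append_of_subset]
  · refine greedy_eq_self ?_
    rw [List.nil_append, finrank_lspan_map, finrank_Λ, lspan_nil, finrank_bot, zero_add,
      List.length_map]
  · intro x hx
    rw [List.eq_of_mem_replicate hx]
    exact zero_mem _

theorem transport_mem_perp {v : Vec p n} :
    t.f v ∈ perp (D.transport t kn km).Λ ↔ v ∈ perp D.Λ := by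
  simp only [mem_perp, transport_Λ, List.forall_mem_map, t.dot_eq]

theorem forall_equiv_iff {α : Type} (f : α ≃ α) {q q' : α → Prop} (h : ∀ x, q (f x) ↔ q' x) :
    (∀ x, q x) ↔ ∀ x, q' x :=
  ⟨fun H x => (h x).1 (H _), fun H x => by
    rw [← f.apply_symm_apply x, h]
    exact H _⟩

theorem transport_mem_zeroX {u : Vec p m} :
    t.g u ∈ (D.transport t kn km).zeroX H ↔ u ∈ D.zeroX G := by
  simp only [zeroX, mem_sel, mem_vecs, true_and, transport, List.forall_mem_map, t.tri_eq]

theorem transport_mem_zeroY {v : Vec p n} :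
    t.f v ∈ (D.transport t kn km).zeroY H ↔ v ∈ D.zeroY G := by
  simp only [zeroY, mem_sel, mem_vecs, true_and, transport, List.forall_mem_map, t.tri_eq]

theorem transport_mem_KX {v : Vec p n} :
    t.f v ∈ (D.transport t kn km).KX H ↔ v ∈ D.KX G := by
  simp only [KX, mem_sel, transport_mem_perp]
  refine and_congr_right fun _ => ?_
  refine forall_equiv_iff t.g.toEquiv fun u => ?_
  refine imp_congr (D.transport_mem_zeroX t kn km) (forall_equiv_iff t.f.toEquiv fun w => ?_)
  exact imp_congr (D.transport_mem_perp t kn km) (by simp only [LinearEquiv.coe_toEquiv, t.tri_eq])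

theorem transport_mem_KY {u : Vec p m} :
    t.g u ∈ (D.transport t kn km).KY H ↔ u ∈ D.KY G := by
  simp only [KY, mem_sel, mem_vecs, true_and]
  refine forall_equiv_iff t.f.toEquiv fun u => ?_
  refine imp_congr (D.transport_mem_zeroY t kn km) (forall_equiv_iff t.f.toEquiv fun w => ?_)
  exact imp_congr (D.transport_mem_perp t kn km) (by simp only [LinearEquiv.coe_toEquiv, t.tri_eq])

theorem transport_mem_RX {v : Vec p n} :
    t.f v ∈ (D.transport t kn km).RX H ↔ v ∈ D.RX G := by
  simp only [RX, mem_sel, mem_vecs, true_implies, transport_mem_KX]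
  refine and_congr_right fun _ => ?_
  refine forall_equiv_iff t.g.toEquiv fun u => ?_
  refine forall_equiv_iff t.f.toEquiv fun w => ?_
  simp only [LinearEquiv.coe_toEquiv, t.tri_eq]

theorem transport_mem_RY {u : Vec p m} :
    t.g u ∈ (D.transport t kn km).RY H ↔ u ∈ D.RY G := by
  simp only [RY, mem_sel, mem_vecs, true_implies, transport_mem_KY]
  refine and_congr_right fun _ => ?_
  refine forall_equiv_iff t.f.toEquiv fun u => ?_
  refine forall_equiv_iff t.f.toEquiv fun w => ?_
  simp only [LinearEquiv.coe_toEquiv, t.tri_eq]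

/-- The transported choice stands at the end and is independent modulo the base, so it is kept
completely. By then it spans, with the base, the images of all candidates used for `G`; the fallback
vectors in front and the zeros are rejected. -/
theorem greedy_transport {d : ℕ} (f : Vec p d ≃ₗ[ZMod p] Vec p d) {base base' l pre C : List (Vec p d)}
    {k : ℕ} (hbase : ∀ x, f x ∈ base' ↔ x ∈ base) (hC : greedy base l = C)
    (hpre : ∀ x, f x ∈ pre → x ∈ l) :
    greedy base' (pre ++ (List.replicate k 0 ++ C.map f)) = C.map f := by
  have h1 : lspan base' = lspan (base.map f) := by
    rw [lspan, lspan]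
    congr 1
    ext x
    rw [Set.mem_ofPred_eq, Set.mem_ofPred_eq, List.mem_map, ← f.apply_symm_apply x, hbase]
    exact ⟨fun h => ⟨_, h, rfl⟩, fun ⟨y, hy, h⟩ => f.injective h ▸ hy⟩
  have h2 : lspan (base' ++ C.map f) = lspan ((base ++ C).map f) := by
    rw [lspan_append, h1, ← lspan_append, List.map_append]
  rw [← List.append_assoc, greedy_append_of_subset]
  · refine greedy_eq_self ?_
    rw [h2, h1, finrank_lspan_map, finrank_lspan_map, List.length_map, ← hC, finrank_lspan_greedy]
  · intro x hx
    rcases List.mem_append.1 hx with hx | hx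
    · rw [h2, ← f.apply_symm_apply x, mem_lspan_map, ← hC, lspan_greedy]
      exact mem_lspan (List.mem_append_right _ (hpre _ (by simpa using hx)))
    · rw [List.eq_of_mem_replicate hx]
      exact zero_mem _

theorem transport_C₁ : (D.transport t kn km).C₁ H = (D.C₁ G).map t.f := by
  have h : sel (fun v => ∀ x ∈ (D.transport t kn km).Λ, x ⬝ᵥ v = 0) (D.transport t kn km).Cs₁ =
      (D.transport t kn km).Cs₁ := by
    refine sel_eq_self fun v hv x hx => ?_
    rcases List.mem_append.1 hv with hv | hv
    · rw [List.eq_of_mem_replicate hv, dotProduct_zero]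
    · obtain ⟨w, hw, rfl⟩ := List.mem_map.1 hv
      rw [transport_Λ] at hx
      obtain ⟨y, hy, rfl⟩ := List.mem_map.1 hx
      rw [t.dot_eq]
      have h6 : w ∈ orth (D.toTuple G).Λ := by
        rw [← lspan_KX_C₁]
        exact mem_lspan (List.mem_append_right _ hw)
      exact (D.mem_orth G).1 h6 y hy
  rw [C₁, h]
  refine greedy_transport t.f (fun x => D.transport_mem_KX t kn km) rfl fun x hx => ?_
  exact List.mem_append_left _ ((D.transport_mem_perp t kn km).1 hx)

theorem transport_C₂ : (D.transport t kn km).C₂ H = (D.C₂ G).map t.f := by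
  refine greedy_transport t.f (base := D.KX G ++ D.C₁ G) (fun x => ?_) rfl fun x _ =>
    List.mem_append_left _ (mem_vecs _)
  rw [List.mem_append, List.mem_append, transport_mem_KX, transport_C₁,
    List.mem_map_of_injective t.f.injective]

theorem transport_Cs : (D.transport t kn km).Cs H = (D.Cs G).map t.f := by
  rw [Cs, transport_C₁, transport_C₂, ← List.map_append]
  rfl

theorem transport_C : (D.transport t kn km).C H = (D.C G).map t.g :=
  greedy_transport t.g (fun _ => D.transport_mem_KY t kn km) rfl fun _ _ =>
    List.mem_append_left _ (mem_vecs _)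

theorem transport_keyY (v : Vec p n) : (D.transport t kn km).keyY H (t.f v) = D.keyY G v := by
  simp only [keyY, transport, List.flatMap_map, List.map_map, Function.comp_def, t.tri_eq]

theorem transport_keyX (u : Vec p m) : (D.transport t kn km).keyX H (t.g u) = D.keyX G u := by
  simp only [keyX, transport, List.flatMap_map, List.map_map, Function.comp_def, t.tri_eq]

/-- Pulled back, the rows for `H` are a second system of rows for the same `K`, `R` and `φ` as those
for `G`. The proof builds them with the map of `G` composed with the inverse equivalence, since the
matrices of the two tuples have different index types; as lists, the keys agree. -/
theorem transport_isRowsN : IsRows (D.subX G) (D.subX G ⊓ LinearMap.ker (ymap G))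
    (sandwich (D.toTuple G).L (D.toTuple G).Lskewᵀ ∘ₗ ymap G) ((D.transport t kn km).form H).αY
    ((D.transport t kn km).form H).βY
    (fun i : Fin n => t.f.symm (((D.transport t kn km).rowsN H).getD i 0)) := by
  refine IsRows.comap t.f
    (K' := (D.transport t kn km).subX H)
    (R' := (D.transport t kn km).subX H ⊓ LinearMap.ker (ymap H)) (fun x => ?_) (fun x => ?_) ?_
  · exact (D.mem_KX G).symm.trans
      ((D.transport_mem_KX t kn km).symm.trans ((D.transport t kn km).mem_KX H))
  · rw [← mem_RX, ← mem_RX, transport_mem_RX]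
  · have hφ : ∀ v, (D.transport t kn km).keyY H v =
        flat (((sandwich (D.toTuple G).L (D.toTuple G).Lskewᵀ ∘ₗ ymap G) ∘ₗ t.f.symm.toLinearMap)
          v) := fun v => by
      rw [LinearMap.comp_apply, ← flat_sandwich_ymap, LinearEquiv.coe_coe,
        ← D.transport_keyY t kn km, t.f.apply_symm_apply]
    have h := ((D.transport t kn km).rowInputN H).isRows _ hφ
    simp only [form, hφ, forall_mem_flat]
    exact h

theorem transport_isRowsM : IsRows (D.subY G) (D.subY G ⊓ LinearMap.ker (xmap G))
    (sandwich (D.toTuple G).Lskew (D.toTuple G).Lskewᵀ ∘ₗ xmap G)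
    ((D.transport t kn km).form H).αX ((D.transport t kn km).form H).βX
    (fun i : Fin m => t.g.symm (((D.transport t kn km).rowsM H).getD i 0)) := by
  refine IsRows.comap t.g
    (K' := (D.transport t kn km).subY H)
    (R' := (D.transport t kn km).subY H ⊓ LinearMap.ker (xmap H)) (fun x => ?_) (fun x => ?_) ?_
  · exact (D.mem_KY G).symm.trans
      ((D.transport_mem_KY t kn km).symm.trans ((D.transport t kn km).mem_KY H))
  · rw [← mem_RY, ← mem_RY, transport_mem_RY]
  · have hφ : ∀ v, (D.transport t kn km).keyX H v =
        flat (((sandwich (D.toTuple G).Lskew (D.toTuple G).Lskewᵀ ∘ₗ xmap G) ∘ₗ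
          t.g.symm.toLinearMap) v) := fun v => by
      rw [LinearMap.comp_apply, ← flat_sandwich_xmap, LinearEquiv.coe_coe,
        ← D.transport_keyX t kn km, t.g.apply_symm_apply]
    have h := ((D.transport t kn km).rowInputM H).isRows _ hφ
    simp only [form, hφ, forall_mem_flat]
    exact h

theorem transport_tail {d : ℕ} (f : Vec p d ≃ₗ[ZMod p] Vec p d)
    {K R K' R' : Submodule (ZMod p) (Vec p d)} {Kl Rl C Kl' Rl' : List (Vec p d)}
    (h : RowInput K R Kl Rl C) (h' : RowInput K' R' Kl' Rl' (C.map f))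
    (key key' : Vec p d → List (ZMod p)) {i : ℕ} (hi : Module.finrank (ZMod p) K ≤ i) :
    (formatRows key Kl Rl C).getD i 0 = f.symm ((formatRows key' Kl' Rl' (C.map f)).getD i 0) := by
  have h1 := h.finrank_add
  have h2 := h'.finrank_add
  rw [List.length_map] at h2
  rw [h.tail key i (i - Module.finrank (ZMod p) K) (by omega),
    h'.tail key' i (i - Module.finrank (ZMod p) K) (by omega), LinearEquiv.eq_symm_apply,
    ← map_zero f, List.getD_map, map_zero]

/-- Both forms evaluate the trilinear form of `G`, one on the rows for `G` and one on the
pulled-back rows for `H`. The two row systems share the same complement and differ by block matrices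
modulo `R`, so `tri_congr` applies. -/
theorem transport_isometric (hG : IsSkewTensor G) :
    IsometricSemiForms (D.form G) ((D.transport t kn km).form H) := by
  have hN := D.isRowsN G
  have hN' := D.transport_isRowsN t kn km
  have hM := D.isRowsM G
  have hM' := D.transport_isRowsM t kn km
  obtain ⟨a1, b1⟩ := hN.params_eq hN' (inf_le_right.trans (LinearMap.ker_le_ker_comp _ _))
  obtain ⟨a2, b2⟩ := hM.params_eq hM' (inf_le_right.trans (LinearMap.ker_le_ker_comp _ _))
  rw [← a1, ← b1] at hN'
  rw [← a2, ← b2] at hM'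
  obtain ⟨P, hP, hP'⟩ := hN.exists_blockForm hN' fun i hi => by
    have h' := (D.transport t kn km).rowInputN H
    rw [transport_Cs] at h'
    have := transport_tail t.f (D.rowInputN G) h' (D.keyY G) ((D.transport t kn km).keyY H) hi
    rwa [← transport_Cs D t kn km] at this
  obtain ⟨Q, hQ, hQ'⟩ := hM.exists_blockForm hM' fun i hi => by
    have h' := (D.transport t kn km).rowInputM H
    rw [transport_C] at h'
    have := transport_tail t.g (D.rowInputM G) h' (D.keyX G) ((D.transport t kn km).keyX H) hi
    rwa [← transport_C D t kn km] at this
  refine ⟨a2, b2, a1, b1, P, Q, hP, hQ, ?_⟩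
  funext i j k
  have e : ∀ u v w, tri H u v w = tri G (t.g.symm u) (t.f.symm v) (t.f.symm w) := fun u v w => by
    rw [← t.tri_eq]
    simp only [LinearEquiv.apply_symm_apply]
  have hq := fun i => Submodule.mem_inf.1 (hQ' i)
  have hp := fun i => Submodule.mem_inf.1 (hP' i)
  rw [D.form_tensor, trans_apply, tri_trans]
  change _ = tri H _ _ _
  rw [e, Matrix.vecMul_eq_sum, Matrix.vecMul_eq_sum, Matrix.vecMul_eq_sum]
  exact (tri_congr hG (hq i).2 (hp j).2 (hp k).2).symm

theorem isometricTensors_form (D : TupleData p m n) (G : Tensor p m n) :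
    IsometricTensors G (D.form G).tensor := ⟨_, _, (D.form_tensor G).symm⟩

/-- The block shape plays no role in this direction: each form is a transform of its own tensor. -/
theorem isometricTensors_of_form {D' : TupleData p m n}
    (h : IsometricSemiForms (D.form G) (D'.form H)) : IsometricTensors G H := by
  obtain ⟨-, -, -, -, N, M, -, -, h⟩ := h
  exact (D.isometricTensors_form G).trans
    ((show IsometricTensors _ _ from ⟨N, M, h⟩).trans (D'.isometricTensors_form H).symm)

end TupleData

/-! ### Spaces of linear maps of bounded rank -/

section rank

variable {p : ℕ} [Fact p.Prime]

theorem finrank_comap {V W : Type} [AddCommGroup V] [Module (ZMod p) V]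
    [FiniteDimensional (ZMod p) V] [AddCommGroup W] [Module (ZMod p) W] (T : Submodule (ZMod p) W)
    (f : V →ₗ[ZMod p] W) :
    Module.finrank (ZMod p) (T.comap f) =
      Module.finrank (ZMod p) (LinearMap.range f ⊓ T : Submodule _ _) +
        Module.finrank (ZMod p) (LinearMap.ker f) := by
  have h := finrank_map_add_finrank_inf_ker (T.comap f) f
  have e : T.comap f ⊓ LinearMap.ker f = LinearMap.ker f :=
    inf_eq_right.2 fun x hx => by
      rw [Submodule.mem_comap, LinearMap.mem_ker.1 hx]
      exact zero_mem _
  rw [Submodule.map_comap_eq, e] at h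
  exact h.symm

/-- If the ranks of `B` and of `A + B` do not exceed the rank of `A`, then the map from the kernel
of `A` to the cokernel of `A` induced by `B` has at most half the rank of `A`. -/
theorem two_mul_finrank_le {V W : Type} [AddCommGroup V] [Module (ZMod p) V]
    [FiniteDimensional (ZMod p) V] [AddCommGroup W] [Module (ZMod p) W]
    [FiniteDimensional (ZMod p) W] (A B : V →ₗ[ZMod p] W)
    (h1 : Module.finrank (ZMod p) (LinearMap.range B) ≤
      Module.finrank (ZMod p) (LinearMap.range A))
    (h2 : Module.finrank (ZMod p) (LinearMap.range (A + B)) ≤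
      Module.finrank (ZMod p) (LinearMap.range A)) :
    2 * Module.finrank (ZMod p) (((LinearMap.ker A).map B).map (LinearMap.range A).mkQ) ≤
      Module.finrank (ZMod p) (LinearMap.range A) := by
  set T := (LinearMap.ker A).map B with hT
  -- A map of rank at most that of `A` has a kernel at least as large as that of `A`. If its range
  -- contains `T`, the preimage of `T` thus has dimension at least `dim T + dim ker A`. This applies
  -- to `B` and, because `A + B` agrees with `B` on the kernel of `A`, to `A + B`.
  have key : ∀ f : V →ₗ[ZMod p] W, T ≤ LinearMap.range f →
      Module.finrank (ZMod p) (LinearMap.range f) ≤ Module.finrank (ZMod p) (LinearMap.range A) →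
      Module.finrank (ZMod p) T + Module.finrank (ZMod p) (LinearMap.ker A) ≤
        Module.finrank (ZMod p) (T.comap f) := fun f hf hr => by
    rw [finrank_comap, inf_eq_right.2 hf]
    have := f.finrank_range_add_finrank_ker
    have := A.finrank_range_add_finrank_ker
    omega
  have e1 := key B LinearMap.map_le_range h1
  have e2 := key (A + B) (by
    rintro _ ⟨x, hx, rfl⟩
    exact ⟨x, by rw [LinearMap.add_apply, LinearMap.mem_ker.1 hx, zero_add]⟩) h2
  have e3 := Submodule.finrank_sup_add_finrank_inf_eq (T.comap B) (T.comap (A + B))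
  -- As `A` is the difference of `A + B` and `B`, the two preimages of `T` meet inside its preimage
  -- under `A`. The rest is counting dimensions in `V`.
  have e4 : Module.finrank (ZMod p) (T.comap B ⊓ T.comap (A + B) : Submodule _ _) ≤
      Module.finrank (ZMod p) (T.comap A) := by
    refine Submodule.finrank_mono ?_
    rintro x ⟨hx1, hx2⟩
    rw [SetLike.mem_coe, Submodule.mem_comap] at hx1 hx2
    rw [Submodule.mem_comap]
    have := sub_mem hx2 hx1
    rwa [LinearMap.add_apply, add_sub_cancel_right] at this
  rw [finrank_comap] at e4
  have e5 := Submodule.finrank_le (T.comap B ⊔ T.comap (A + B))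
  have e6 := finrank_map_add_finrank_inf_ker T (LinearMap.range A).mkQ
  rw [Submodule.ker_mkQ, inf_comm] at e6
  have e7 := A.finrank_range_add_finrank_ker
  omega

/-- A set of linear maps of rank at most `r` that is closed under addition maps a subspace of small
codimension to a subspace of small dimension. -/
theorem exists_compression (r : ℕ) : ∀ {V W : Type} [AddCommGroup V] [Module (ZMod p) V]
    [FiniteDimensional (ZMod p) V] [AddCommGroup W] [Module (ZMod p) W]
    [FiniteDimensional (ZMod p) W] (S : Set (V →ₗ[ZMod p] W)),
    (∀ A ∈ S, ∀ B ∈ S, A + B ∈ S) →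
    (∀ A ∈ S, Module.finrank (ZMod p) (LinearMap.range A) ≤ r) →
    ∃ (K : Submodule (ZMod p) V) (P : Submodule (ZMod p) W),
      Module.finrank (ZMod p) V ≤ Module.finrank (ZMod p) K + 2 * r ∧
      Module.finrank (ZMod p) P ≤ 2 * r ∧ ∀ A ∈ S, ∀ v ∈ K, A v ∈ P := by
  induction r using Nat.strong_induction_on with
  | _ r ih =>
    intro V W _ _ _ _ _ _ S hadd hr
    rcases Nat.eq_zero_or_pos r with rfl | hpos
    · refine ⟨⊤, ⊥, by rw [finrank_top]; omega, by rw [finrank_bot], fun A hA v _ => ?_⟩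
      have := Submodule.finrank_eq_zero.1 (Nat.le_zero.1 (hr A hA))
      rw [LinearMap.range_eq_bot.1 this]
      exact zero_mem _
    rcases S.eq_empty_or_nonempty with rfl | hne
    · exact ⟨⊤, ⊥, by rw [finrank_top]; omega, by rw [finrank_bot]; omega, fun A hA => hA.elim⟩
    -- For an element of maximal rank the rank hypotheses of `two_mul_finrank_le` hold for every `B`
    -- in `S`; only closure under addition is used.
    obtain ⟨A, hA, hmax⟩ : ∃ A ∈ S, ∀ B ∈ S, Module.finrank (ZMod p) (LinearMap.range B) ≤
        Module.finrank (ZMod p) (LinearMap.range A) := by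
      have hbdd : BddAbove ((fun A : V →ₗ[ZMod p] W =>
          Module.finrank (ZMod p) (LinearMap.range A)) '' S) :=
        ⟨r, by rintro _ ⟨A, hA, rfl⟩; exact hr A hA⟩
      obtain ⟨A, hA, h⟩ := Nat.sSup_mem (hne.image _) hbdd
      exact ⟨A, hA, fun B hB => (le_csSup hbdd ⟨B, hB, rfl⟩).trans_eq h.symm⟩
    let ψ : (V →ₗ[ZMod p] W) → (LinearMap.ker A →ₗ[ZMod p] W ⧸ LinearMap.range A) :=
      fun B => (LinearMap.range A).mkQ ∘ₗ B ∘ₗ (LinearMap.ker A).subtype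
    -- The induced maps from the kernel to the cokernel have rank at most `r / 2`. Lifting back
    -- costs `rank A ≤ r` once in the source and once in the target, and `r + 2 * (r / 2) ≤ 2 * r`.
    obtain ⟨K, P, hK, hP, hKP⟩ := ih (r / 2) (by omega) (ψ '' S)
      (by
        rintro _ ⟨B, hB, rfl⟩ _ ⟨C, hC, rfl⟩
        refine ⟨B + C, hadd B hB C hC, ?_⟩
        ext x
        simp [ψ])
      (by
        rintro _ ⟨B, hB, rfl⟩
        have := two_mul_finrank_le A B (hmax B hB) (hmax _ (hadd A hA B hB))
        have e : LinearMap.range (ψ B) =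
            ((LinearMap.ker A).map B).map (LinearMap.range A).mkQ := by
          rw [LinearMap.range_comp, LinearMap.range_comp, Submodule.range_subtype]
        rw [e]
        have := hr A hA
        omega)
    refine ⟨K.map (LinearMap.ker A).subtype, P.comap (LinearMap.range A).mkQ, ?_, ?_, ?_⟩
    · rw [Submodule.finrank_map_subtype_eq]
      have := hr A hA
      have := A.finrank_range_add_finrank_ker
      omega
    · rw [finrank_comap, Submodule.ker_mkQ, Submodule.range_mkQ, top_inf_eq]
      have := hr A hA
      omega
    · rintro B hB _ ⟨v, hv, rfl⟩
      exact hKP _ ⟨B, hB, rfl⟩ v hv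

end rank

/-! ### Choosing vectors by averaging -/

section averaging

/-- Double counting of the failing pairs: since each `b` fails for at most a fraction `1/q` of the
choices, the average choice fails for at most a fraction `1/q` of `S`. -/
theorem exists_card_filter_mul_le {α β : Type} [Fintype α] [Nonempty α] (S : Finset β)
    (fail : β → α → Prop) [∀ b, DecidablePred (fail b)] [∀ a, DecidablePred fun b => fail b a]
    (q : ℕ) (h : ∀ b ∈ S, (Finset.univ.filter (fail b)).card * q ≤ Fintype.card α) :
    ∃ a, (S.filter fun b => fail b a).card * q ≤ S.card := by
  by_contra! hc
  have h1 : ∑ a : α, (S.filter fun b => fail b a).card * q =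
      ∑ b ∈ S, (Finset.univ.filter (fail b)).card * q := by
    simp only [← Finset.sum_mul, Finset.card_filter]
    rw [Finset.sum_comm]
  have h2 : ∑ b ∈ S, (Finset.univ.filter (fail b)).card * q ≤ S.card * Fintype.card α := by
    rw [← smul_eq_mul]
    exact Finset.sum_le_card_nsmul _ _ _ h
  have h3 : ∑ _a : α, S.card < ∑ a : α, (S.filter fun b => fail b a).card * q :=
    Finset.sum_lt_sum_of_nonempty Finset.univ_nonempty fun a _ => hc a
  rw [Finset.sum_const, Finset.card_univ, smul_eq_mul] at h3
  rw [h1] at h3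
  exact absurd (h3.trans_le h2) (by rw [mul_comm]; exact lt_irrefl _)

open Classical in
-- Each averaged choice divides the number of undetected elements by at least `q`. Starting with
-- fewer than `q ^ t`, none survives `t` choices.
theorem exists_list_forall {α β : Type} [Fintype α] [Nonempty α] (S : Finset β)
    (fail : β → α → Prop) (q : ℕ)
    (h : ∀ b ∈ S, (Finset.univ.filter (fail b)).card * q ≤ Fintype.card α) (t : ℕ)
    (ht : S.card < q ^ t) : ∃ l : List α, l.length = t ∧ ∀ b ∈ S, ∃ a ∈ l, ¬ fail b a := by
  induction t generalizing S with
  | zero =>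
    rw [pow_zero, Nat.lt_one_iff, Finset.card_eq_zero] at ht
    exact ⟨[], rfl, fun b hb => by simp [ht] at hb⟩
  | succ t ih =>
    obtain ⟨a, ha⟩ := exists_card_filter_mul_le S fail q h
    obtain ⟨l, hl, hl'⟩ := ih (S.filter fun b => fail b a)
      (fun b hb => h b (Finset.mem_filter.1 hb).1) (by
        rw [pow_succ] at ht
        exact lt_of_mul_lt_mul_right (ha.trans_lt ht) (Nat.zero_le _))
    refine ⟨a :: l, by rw [List.length_cons, hl], fun b hb => ?_⟩
    by_cases hf : fail b a
    · obtain ⟨x, hx, hx'⟩ := hl' b (Finset.mem_filter.2 ⟨hb, hf⟩)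
      exact ⟨x, List.mem_cons_of_mem _ hx, hx'⟩
    · exact ⟨a, List.mem_cons_self, hf⟩

variable {p : ℕ} [Fact p.Prime] {k n : ℕ}

theorem card_filter_mem (K : Submodule (ZMod p) (Vec p n)) [DecidablePred (· ∈ K)] :
    (Finset.univ.filter (· ∈ K)).card = p ^ Module.finrank (ZMod p) K := by
  have h := Module.natCard_eq_pow_finrank (K := ZMod p) (V := K)
  rw [Nat.card_zmod] at h
  rw [← h, Nat.card_eq_fintype_card, Fintype.card_subtype]

theorem card_filter_mul_le (K : Submodule (ZMod p) (Vec p n)) {P : Vec p n → Prop}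
    {_ : DecidablePred P} (hP : ∀ v, P v → v ∈ K) {a : ℕ} (h : Module.finrank (ZMod p) K + a ≤ n) :
    (Finset.univ.filter P).card * p ^ a ≤ Fintype.card (Vec p n) := by
  classical
  have h1 : (Finset.univ.filter P).card ≤ p ^ Module.finrank (ZMod p) K := by
    rw [← card_filter_mem]
    exact Finset.card_le_card fun v hv => by
      simp only [Finset.mem_filter, Finset.mem_univ, true_and] at hv ⊢
      exact hP v hv
  rw [Fintype.card_fun, ZMod.card, Fintype.card_fin]
  calc _ ≤ p ^ Module.finrank (ZMod p) K * p ^ a := Nat.mul_le_mul_right _ h1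
    _ = p ^ (Module.finrank (ZMod p) K + a) := (pow_add ..).symm
    _ ≤ p ^ n := Nat.pow_le_pow_right (Fact.out (p := p.Prime)).pos h

/-- Vectors whose images under each of the matrices span a space of dimension at least `s`. -/
theorem exists_list_finrank {r s d t : ℕ} (S : Finset (Mat p k n)) (hS : S.card ≤ p ^ d)
    (hr : ∀ A ∈ S, r < A.rank) (ht : d < (r - s) * t) (j : ℕ) (hj : j ≤ s) (hsr : s ≤ r) :
    ∃ l : List (Vec p n), l.length = j * t ∧
      ∀ A ∈ S, j ≤ Module.finrank (ZMod p) (lspan (l.map fun u => A *ᵥ u)) := by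
  classical
  induction j with
  | zero => exact ⟨[], by simp, fun A _ => Nat.zero_le _⟩
  | succ j ih =>
    obtain ⟨l, hl, hl'⟩ := ih (by omega)
    let T : Mat p k n → Submodule (ZMod p) (Vec p k) := fun A => lspan (l.map fun u => A *ᵥ u)
    -- A vector fails for `A` if the span is stuck at dimension `j` and the vector adds nothing to
    -- it. The failing vectors lie in the preimage of that span, of codimension at least `rank A - j
    -- ≥ r - s`. So `t` further vectors raise all deficient dimensions by at least one.
    obtain ⟨l₁, h1, h2⟩ := exists_list_forall S (fun A u =>
        Module.finrank (ZMod p) (T A) = j ∧ A *ᵥ u ∈ T A) (p ^ (r - s)) (fun A hA => by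
      by_cases hj : Module.finrank (ZMod p) (T A) = j
      · refine card_filter_mul_le ((T A).comap A.mulVecLin) (fun v hv => hv.2) ?_
        have e0 : Module.finrank (ZMod p) ((T A).comap A.mulVecLin) =
            Module.finrank (ZMod p) (LinearMap.range A.mulVecLin ⊓ T A : Submodule _ _) +
              Module.finrank (ZMod p) (LinearMap.ker A.mulVecLin) := finrank_comap ..
        have e1 := A.mulVecLin.finrank_range_add_finrank_ker
        rw [Module.finrank_fin_fun] at e1
        have e2 := hr A hA
        rw [Matrix.rank] at e2
        have e3 : Module.finrank (ZMod p) (LinearMap.range A.mulVecLin ⊓ T A : Submodule _ _) ≤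
            Module.finrank (ZMod p) (T A) := Submodule.finrank_mono inf_le_right
        have e4 : Module.finrank (ZMod p) ((T A).comap A.mulVecLin) + (r - s) ≤ n := by omega
        exact e4
      · simp [hj]) t (by
      rw [← pow_mul]
      exact hS.trans_lt (Nat.pow_lt_pow_right (Fact.out (p := p.Prime)).one_lt ht))
    refine ⟨l ++ l₁, by rw [List.length_append, hl, h1, Nat.succ_mul], fun A hA => ?_⟩
    obtain ⟨u, hu, hu'⟩ := h2 A hA
    have h3 : T A ≤ lspan ((l ++ l₁).map fun u => A *ᵥ u) := lspan_mono (by simp)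
    have h4 := hl' A hA
    change j ≤ Module.finrank (ZMod p) (T A) at h4
    have h5 := Submodule.finrank_mono h3
    rcases Nat.lt_or_ge j (Module.finrank (ZMod p) (T A)) with h6 | h6
    · omega
    · refine Nat.succ_le_of_lt ((le_of_eq (by omega)).trans_lt (Submodule.finrank_lt_finrank_of_lt
        (lt_of_le_of_ne h3 fun h => hu' ⟨by omega, ?_⟩)))
      rw [h]
      exact mem_lspan (List.mem_map.2 ⟨u, List.mem_append_right _ hu, rfl⟩)

theorem finrank_add_finrank_orthogonal (W : Submodule (ZMod p) (Vec p k)) :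
    Module.finrank (ZMod p) W + Module.finrank (ZMod p)
      (W.dualAnnihilator.comap (dotProductEquiv (ZMod p) (Fin k)).toLinearMap) = k := by
  have h := Subspace.finrank_add_finrank_dualAnnihilator_eq W
  rw [Module.finrank_fin_fun] at h
  conv_rhs => rw [← h]
  congr 1
  rw [finrank_comap, LinearEquiv.range, top_inf_eq, LinearEquiv.ker, finrank_bot, add_zero]

/-- Vectors that detect, from both sides, every matrix of large rank in a given set. -/
theorem exists_lists {r s d t t' : ℕ} (S : Finset (Mat p k n)) (hS : S.card ≤ p ^ d)
    (hr : ∀ A ∈ S, r < A.rank) (hsr : s ≤ r) (ht : d < (r - s) * t) (ht' : d < s * t') :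
    ∃ (U : List (Vec p n)) (V : List (Vec p k)), U.length = s * t ∧ V.length = t' ∧
      ∀ A ∈ S, ∃ v ∈ V, ∃ u ∈ U, v ⬝ᵥ A *ᵥ u ≠ 0 := by
  classical
  obtain ⟨U, hU, hU'⟩ := exists_list_finrank S hS hr ht s le_rfl hsr
  -- A vector fails for `A` if it is orthogonal to the span of the images of `U`. That span has
  -- dimension at least `s`, so at most a fraction `p ^ (-s)` of the vectors fails.
  obtain ⟨V, hV, hV'⟩ := exists_list_forall S (fun A v => ∀ u ∈ U, v ⬝ᵥ A *ᵥ u = 0) (p ^ s)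
    (fun A hA => by
      have h1 := finrank_add_finrank_orthogonal (lspan (U.map fun u => A *ᵥ u))
      have h2 := hU' A hA
      refine card_filter_mul_le ((lspan (U.map fun u => A *ᵥ u)).dualAnnihilator.comap
        (dotProductEquiv (ZMod p) (Fin k)).toLinearMap) (fun v hv => ?_) ?_
      · rw [Submodule.mem_comap, Submodule.mem_dualAnnihilator]
        intro w hw
        have : lspan (U.map fun u => A *ᵥ u) ≤
            LinearMap.ker (dotProductEquiv (ZMod p) (Fin k) v) := by
          refine lspan_le.2 fun x hx => ?_
          obtain ⟨u, hu, rfl⟩ := List.mem_map.1 hx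
          exact hv u hu
        exact this hw
      · have h3 : Module.finrank (ZMod p) ((lspan (U.map fun u => A *ᵥ u)).dualAnnihilator.comap
            (dotProductEquiv (ZMod p) (Fin k)).toLinearMap) + s ≤ k := by omega
        exact h3) t' (by
    rw [← pow_mul]
    exact hS.trans_lt (Nat.pow_lt_pow_right (Fact.out (p := p.Prime)).one_lt ht'))
  refine ⟨U, V, hU, hV, fun A hA => ?_⟩
  obtain ⟨v, hv, h⟩ := hV' A hA
  push Not at h
  exact ⟨v, hv, h⟩

end averaging

/-! ### Parameters -/

/-- Count upwards while the value of `f` is less than `m`. -/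
def climb (f : ℕ → ℕ) (m : ℕ) : ℕ → ℕ
  | 0 => 0
  | j + 1 => if f (climb f m j) < m then climb f m j + 1 else climb f m j

theorem apply_lt_of_lt_climb {f : ℕ → ℕ} {m : ℕ} (j i : ℕ) (hi : i < climb f m j) : f i < m := by
  induction j with
  | zero => simp [climb] at hi
  | succ j ih =>
    rw [climb] at hi
    split_ifs at hi with h
    · rcases Nat.lt_succ_iff_lt_or_eq.1 hi with h' | rfl
      · exact ih h'
      · exact h
    · exact ih hi

theorem le_apply_climb {f : ℕ → ℕ} {m j : ℕ} (h : m ≤ f j) : m ≤ f (climb f m j) := by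
  have key : ∀ j, climb f m j = j ∨ m ≤ f (climb f m j) := fun j => by
    induction j with
    | zero => exact Or.inl rfl
    | succ j ih =>
      rw [climb]
      split_ifs with h'
      · rcases ih with ih | ih
        · exact Or.inl (by rw [ih])
        · exact absurd h' (not_lt.2 ih)
      · exact Or.inr (not_lt.1 h')
  rcases key j with h' | h'
  · rwa [h']
  · exact h'

/-- The fourth root of `n`, rounded up. -/
def root (n : ℕ) : ℕ := climb (fun j => j * j * (j * j)) n n

/-- The quotient of `m` and `w`, rounded up. -/
def quot (m w : ℕ) : ℕ := climb (fun j => j * w) m m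

theorem le_root (n : ℕ) : n ≤ root n ^ 4 := by
  have h : n ≤ n * n * (n * n) := by
    rcases Nat.eq_zero_or_pos n with rfl | h
    · exact le_rfl
    · have := Nat.mul_pos h h
      have := Nat.mul_le_mul (Nat.le_mul_of_pos_left n h) this
      simpa using this
  exact (le_apply_climb (f := fun j => j * j * (j * j)) h).trans_eq
    (by rw [root]; ring)

theorem lt_of_lt_root {n j : ℕ} (h : j < root n) : j ^ 4 < n :=
  lt_of_eq_of_lt (by ring) (apply_lt_of_lt_climb (f := fun j => j * j * (j * j)) n j h)

theorem root_pos {n : ℕ} (h : 0 < n) : 0 < root n := by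
  have := le_root n
  rcases Nat.eq_zero_or_pos (root n) with h0 | h0
  · rw [h0] at this
    omega
  · exact h0

theorem le_quot (m : ℕ) {w : ℕ} (h : 0 < w) : m ≤ quot m w * w :=
  le_apply_climb (f := fun j => j * w) (Nat.le_mul_of_pos_right m h)

theorem lt_of_lt_quot {m w j : ℕ} (h : j < quot m w) : j * w < m :=
  apply_lt_of_lt_climb (f := fun j => j * w) m j h

/-- The number of row vectors of length `n` in each part of the data. -/
def sizeN (m n : ℕ) : ℕ := 20 * (quot m (root n) + root n * (root n * root n))

/-- The number of row vectors of length `m` in each part of the data. -/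
def sizeM (n : ℕ) : ℕ := 20 * (root n * (root n * root n))

theorem exists_list_lspan {p d : ℕ} [Fact p.Prime] (Q : Submodule (ZMod p) (Vec p d)) {k : ℕ}
    (h : Module.finrank (ZMod p) Q ≤ k) : ∃ l : List (Vec p d), l.length = k ∧ lspan l = Q := by
  have h1 : lspan (sel (· ∈ Q) (vecs p d)) = Q := lspan_eq fun x => by
    rw [mem_sel]
    exact ⟨fun h => h.2, fun h => ⟨mem_vecs _, h⟩⟩
  have h2 := lspan_greedy [] (sel (· ∈ Q) (vecs p d))
  have h3 := finrank_lspan_greedy [] (sel (· ∈ Q) (vecs p d))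
  rw [List.nil_append, List.nil_append, h1] at h2
  rw [List.nil_append, h2, lspan_nil, finrank_bot, zero_add] at h3
  refine ⟨greedy [] (sel (· ∈ Q) (vecs p d)) ++
    List.replicate (k - Module.finrank (ZMod p) Q) 0, ?_, ?_⟩
  · rw [List.length_append, List.length_replicate, ← h3]
    omega
  · rw [lspan_append, h2, sup_eq_left, lspan_le]
    intro x hx
    rw [List.eq_of_mem_replicate hx]
    exact zero_mem _

theorem exists_list_length {p d k : ℕ} (l : List (Vec p d)) (h : l.length ≤ k) :
    ∃ l' : List (Vec p d), l'.length = k ∧ l ⊆ l' :=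
  ⟨l ++ List.replicate (k - l.length) 0, by
    rw [List.length_append, List.length_replicate]; omega, by simp⟩

theorem finrank_range_vecMulLinear {p k n : ℕ} [Fact p.Prime] (A : Mat p k n) :
    Module.finrank (ZMod p) (LinearMap.range A.vecMulLinear) = A.rank := by
  rw [← Matrix.rank_transpose, Matrix.rank, Matrix.mulVecLin_transpose]

theorem exists_compression_matrix {p k n r : ℕ} [Fact p.Prime] (𝒜 : MatSpace p k n)
    (h : ∀ A ∈ 𝒜, A.rank ≤ r) : ∃ (K : Submodule (ZMod p) (Vec p k))
      (P : Submodule (ZMod p) (Vec p n)), k ≤ Module.finrank (ZMod p) K + 2 * r ∧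
      Module.finrank (ZMod p) P ≤ 2 * r ∧ ∀ A ∈ 𝒜, ∀ v ∈ K, v ᵥ* A ∈ P := by
  obtain ⟨K, P, h1, h2, h3⟩ := exists_compression r (Matrix.vecMulLinear '' (𝒜 : Set (Mat p k n)))
    (by
      rintro _ ⟨A, hA, rfl⟩ _ ⟨B, hB, rfl⟩
      refine ⟨A + B, add_mem hA hB, ?_⟩
      refine LinearMap.ext fun v => ?_
      rw [LinearMap.add_apply, Matrix.vecMulLinear_apply, Matrix.vecMulLinear_apply,
        Matrix.vecMulLinear_apply, Matrix.vecMul_add])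
    (by
      rintro _ ⟨A, hA, rfl⟩
      rw [finrank_range_vecMulLinear]
      exact h A hA)
  rw [Module.finrank_fin_fun] at h1
  exact ⟨K, P, h1, h2, fun A hA v hv => h3 _ ⟨A, hA, rfl⟩ v hv⟩

/-! ### Existence of small data and the resulting criterion for isometry -/

section

variable {p m n : ℕ} [Fact p.Prime]

/-- The data consist of lists of prescribed lengths. -/
structure TupleData.HasSize (D : TupleData p m n) (kn km : ℕ) : Prop where
  Ls : D.Ls.length = kn
  L : D.L.length = km
  Λ₀ : D.Λ₀.length = kn
  Cs₁ : D.Cs₁.length = kn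
  Cs₂ : D.Cs₂.length = kn
  C₀ : D.C₀.length = km

/-- The lists derived from the data do not exceed prescribed lengths. -/
structure TupleData.Fits (D : TupleData p m n) (G : Tensor p m n) (kn km : ℕ) : Prop where
  Λ : D.Λ.length ≤ kn
  C₁ : (D.C₁ G).length ≤ kn
  C₂ : (D.C₂ G).length ≤ kn
  C : (D.C G).length ≤ km

theorem TupleData.HasSize.transport {D : TupleData p m n} {G H : Tensor p m n} {kn km : ℕ}
    (h : D.HasSize kn km) (h' : D.Fits G kn km) (t : Transport G H) :
    (D.transport t kn km).HasSize kn km := by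
  have := h'.Λ
  have := h'.C₁
  have := h'.C₂
  have := h'.C
  constructor <;> simp only [TupleData.transport, List.length_append, List.length_map,
    List.length_replicate, h.Ls, h.L] <;> omega

/-- The kernel for `X` contains `K ⊓ orth Λ`, of codimension at most `2r + 4r`, and the kernel for
`Y` contains `K'`, of codimension at most `2r`. Complements have as many vectors as these
codimensions, and `C₂` is no longer than `Λ`. -/
theorem TupleData.fits {D : TupleData p m n} {G : Tensor p m n} {r : ℕ}
    {K : Submodule (ZMod p) (Vec p n)} {K' : Submodule (ZMod p) (Vec p m)}
    (hK : n ≤ Module.finrank (ZMod p) K + 2 * r) (hK' : m ≤ Module.finrank (ZMod p) K' + 2 * r)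
    (hΛ : Module.finrank (ZMod p) (lspan D.Λ₀) ≤ 4 * r)
    (h : ∀ A ∈ (D.toTuple G).zeroX G, ∀ v ∈ K, v ᵥ* A ∈ lspan D.Λ₀)
    (h' : ∀ A ∈ (D.toTuple G).zeroY G, ∀ v ∈ K', v ᵥ* A ∈ lspan D.Λ₀) :
    D.Fits G (6 * r) (2 * r) := by
  have e1 : lspan D.Λ = lspan D.Λ₀ := lspan_greedy [] D.Λ₀
  have e2 := D.finrank_Λ
  rw [e1] at e2
  have e3 : n ≤ Module.finrank (ZMod p) (orth (D.toTuple G).Λ) + D.Λ.length := finrank_orth_ge D.Λ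
  have e4 : K ⊓ orth (D.toTuple G).Λ ≤ D.subX G := fun v hv => ⟨hv.2, fun A hA => by
    rw [span_Λ, e1]
    exact h A hA v hv.1⟩
  have e5 : K' ≤ D.subY G := fun v hv A hA => by
    rw [span_Λ, e1]
    exact h' A hA v hv
  have e6 := Submodule.finrank_mono e4
  have e7 := Submodule.finrank_mono e5
  have e8 := Submodule.finrank_sup_add_finrank_inf_eq K (orth (D.toTuple G).Λ)
  have e9 := Submodule.finrank_le (K ⊔ orth (D.toTuple G).Λ)
  rw [Module.finrank_fin_fun] at e9
  have e10 := D.finrank_orth G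
  have e11 := D.length_C₂_le G
  have e12 := (D.rowInputM G).finrank_add
  have e13 := Submodule.finrank_le (orth (D.toTuple G).Λ)
  rw [Module.finrank_fin_fun] at e13
  constructor <;> omega

theorem rank_le_of_lists {k n r : ℕ} {S : Finset (Mat p k n)} {U : List (Vec p n)}
    {V : List (Vec p k)} (h : ∀ A ∈ S.filter (fun A => r < A.rank), ∃ v ∈ V, ∃ u ∈ U, v ⬝ᵥ A *ᵥ u ≠ 0)
    {A : Mat p k n} (hA : A ∈ S) (h0 : ∀ v ∈ V, ∀ u ∈ U, v ᵥ* A ⬝ᵥ u = 0) : A.rank ≤ r := by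
  by_contra hr
  obtain ⟨v, hv, u, hu, h1⟩ := h A (Finset.mem_filter.2 ⟨hA, not_le.1 hr⟩)
  rw [Matrix.dotProduct_mulVec] at h1
  exact h1 (h0 v hv u hu)

theorem card_image_vec_le {k n l : ℕ} (f : Vec p l → Mat p k n) (q : Mat p k n → Prop)
    [DecidablePred q] : ((Finset.univ.image f).filter q).card ≤ p ^ l := by
  refine (Finset.card_filter_le _ _).trans (Finset.card_image_le.trans ?_)
  rw [Finset.card_univ, Fintype.card_fun, ZMod.card, Fintype.card_fin]

theorem exists_tupleData (G : Tensor p m n) (hn : 0 < n) : ∃ D : TupleData p m n,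
    D.HasSize (sizeN m n) (sizeM n) ∧ D.Fits G (sizeN m n) (sizeM n) := by
  classical
  set w := root n with hw
  have hw0 : 0 < w := root_pos hn
  have hq : m ≤ quot m w * w := le_quot m hw0
  have hn4 : n ≤ w ^ 4 := le_root n
  set q := quot m w with hq'
  have hw1 : w ≤ w ^ 2 := Nat.le_self_pow (by norm_num) w
  have hw2 : w ^ 2 ≤ w ^ 3 := Nat.pow_le_pow_right hw0 (by norm_num)
  have hkn : sizeN m n = 20 * (q + w ^ 3) := by rw [sizeN, ← hw]; ring
  have hkm : sizeM n = 20 * w ^ 3 := by rw [sizeM, ← hw]; ring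
  have hr : w ^ 3 ≤ 2 * w ^ 3 - w ^ 2 := by omega
  have hw3 : 0 < w ^ 3 := by positivity
  have ht : ∀ d, d < (2 * w ^ 3 - w ^ 2) * (d / w ^ 3 + 1) := fun d =>
    (Nat.lt_mul_div_succ d hw3).trans_le (Nat.mul_le_mul_right _ hr)
  have ht' : ∀ d, d < w ^ 2 * (d / w ^ 2 + 1) := fun d => Nat.lt_mul_div_succ d (by positivity)
  -- The choice is `r = 2w³` and `s = w²`. The gap `r - s` is at least `w³`, so `w²` rounds of `m /
  -- w³ + 1` vectors give `U`, and `m / w² + 1` vectors give `V`; both counts are `O(m/w + w²)`. For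
  -- the `Y`-slices `m` is replaced by `n ≤ w⁴`, with counts `O(w³)`.
  obtain ⟨U, V, hU, hV, hUV⟩ := exists_lists ((Finset.univ.image (xmap G)).filter
    (fun A => 2 * w ^ 3 < A.rank)) (card_image_vec_le _ _)
    (fun A hA => (Finset.mem_filter.1 hA).2) (by omega) (ht m) (ht' m)
  obtain ⟨U', V', hU', hV', hUV'⟩ := exists_lists ((Finset.univ.image (ymap G)).filter
    (fun A => 2 * w ^ 3 < A.rank)) (card_image_vec_le _ _)
    (fun A hA => (Finset.mem_filter.1 hA).2) (by omega) (ht n) (ht' n)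
  have b1 : w ^ 2 * (m / w ^ 3) ≤ q := by
    refine le_of_mul_le_mul_right ?_ hw0
    calc w ^ 2 * (m / w ^ 3) * w = m / w ^ 3 * w ^ 3 := by ring
      _ ≤ m := Nat.div_mul_le_self _ _
      _ ≤ q * w := hq
  have b2 : m / w ^ 2 ≤ q :=
    Nat.div_le_of_le_mul (hq.trans (by rw [mul_comm]; exact Nat.mul_le_mul_right _ hw1))
  have b3 : w ^ 2 * (n / w ^ 3) ≤ w ^ 3 := by
    have : n / w ^ 3 ≤ w := Nat.div_le_of_le_mul (hn4.trans_eq (by ring))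
    calc _ ≤ w ^ 2 * w := Nat.mul_le_mul_left _ this
      _ = w ^ 3 := by ring
  have b4 : n / w ^ 2 ≤ w ^ 2 := Nat.div_le_of_le_mul (hn4.trans_eq (by ring))
  rw [Nat.mul_add, Nat.mul_one] at hU hU'
  obtain ⟨Ls, hLs, hLs'⟩ := exists_list_length (k := sizeN m n) (U ++ V ++ U') (by
    rw [List.length_append, List.length_append]
    omega)
  obtain ⟨L, hL, hL'⟩ := exists_list_length (k := sizeM n) V' (by omega)
  -- Only the attribute list is left open. The zero spaces do not depend on it, so they can be
  -- compressed with the empty list before the attributes are chosen. Zero candidates for the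
  -- complements leave their choice to the fallback vectors.
  let D : List (Vec p n) → TupleData p m n := fun l =>
    ⟨Ls, L, l, List.replicate (sizeN m n) 0, List.replicate (sizeN m n) 0,
      List.replicate (sizeM n) 0⟩
  have hX : ∀ l, ∀ A ∈ ((D l).toTuple G).zeroX G, A.rank ≤ 2 * w ^ 3 := fun l A hA => by
    obtain ⟨u, hu, rfl⟩ := ((D l).mem_zeroX G).1 hA
    refine rank_le_of_lists hUV (Finset.mem_image_of_mem _ (Finset.mem_univ u))
      fun x hx y hy => ?_
    rw [vecMul_xmap]
    exact (mem_sel.1 hu).2 x (hLs' (by simp [hx])) y (hLs' (by simp [hy]))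
  have hY : ∀ l, ∀ A ∈ ((D l).toTuple G).zeroY G, A.rank ≤ 2 * w ^ 3 := fun l A hA => by
    obtain ⟨v, hv, rfl⟩ := ((D l).mem_zeroY G).1 hA
    refine rank_le_of_lists hUV' (Finset.mem_image_of_mem _ (Finset.mem_univ v))
      fun x hx y hy => ?_
    rw [vecMul_ymap]
    exact (mem_sel.1 hv).2 x (hL' hx) y (hLs' (by simp [hy]))
  obtain ⟨K, P, hK, hP, hKP⟩ := exists_compression_matrix _ (hX [])
  obtain ⟨K', P', hK', hP', hKP'⟩ := exists_compression_matrix _ (hY [])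
  -- With `r = 2w³` each of the two targets has dimension at most `2r`. The bounds `6r = 12w³` and
  -- `2r = 4w³` of `TupleData.fits` stay below the sizes with factor `20`.
  have hPP : Module.finrank (ZMod p) (P ⊔ P' : Submodule _ _) ≤ 4 * (2 * w ^ 3) := by
    have := Submodule.finrank_sup_add_finrank_inf_eq P P'
    omega
  obtain ⟨l, hl, hl'⟩ := exists_list_lspan (P ⊔ P') (k := sizeN m n) (by omega)
  refine ⟨D l, ⟨hLs, hL, hl, List.length_replicate, List.length_replicate,
    List.length_replicate⟩, ?_⟩
  have h1 : lspan (D l).Λ₀ = P ⊔ P' := hl'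
  have := TupleData.fits (D := D l) (G := G) hK hK' (h1 ▸ hPP)
    (fun A hA v hv => h1 ▸ Submodule.mem_sup_left (hKP A
      (((D []).mem_zeroX G).2 (((D l).mem_zeroX G).1 hA)) v hv))
    (fun A hA v hv => h1 ▸ Submodule.mem_sup_right (hKP' A
      (((D []).mem_zeroY G).2 (((D l).mem_zeroY G).1 hA)) v hv))
  exact ⟨this.Λ.trans (by omega), this.C₁.trans (by omega), this.C₂.trans (by omega),
    this.C.trans (by omega)⟩

theorem isometricTensors_iff {G H : Tensor p m n} (hn : 0 < n) (hG : IsSkewTensor G) :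
    IsometricTensors G H ↔ ∃ D D' : TupleData p m n, D.HasSize (sizeN m n) (sizeM n) ∧
      D'.HasSize (sizeN m n) (sizeM n) ∧ IsometricSemiForms (D.form G) (D'.form H) := by
  constructor
  · intro h
    obtain ⟨t⟩ := h.transport
    obtain ⟨D, hD, hD'⟩ := exists_tupleData G hn
    exact ⟨D, D.transport t _ _, hD, hD.transport hD' t, D.transport_isometric t _ _ hG⟩
  · rintro ⟨D, D', -, -, h⟩
    exact TupleData.isometricTensors_of_form D h

theorem TupleData.HasSize.isSemiForm {D : TupleData p m n} {G : Tensor p m n} (hn : 0 < n)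
    (hD : D.HasSize (sizeN m n) (sizeM n)) (hG : IsSkewTensor G) : IsSemiForm (D.form G) := by
  have h1 : 0 < root n * (root n * root n) := by
    have := root_pos hn
    positivity
  refine D.isSemiForm G hG (List.ne_nil_of_length_pos ?_) (List.ne_nil_of_length_pos ?_)
  · rw [hD.Ls, sizeN]
    omega
  · rw [hD.L, sizeM]
    omega

end

/-! ### Computing semi-canonical forms and enumerating the data -/

namespace PT

section form

variable {ι κ : Type} {μ : ι → ℕ} {e : ι → BTree} {p m n : ι → ℕ}
  {G : ∀ i, Tensor (p i) (m i) (n i)} {D : ∀ i, TupleData (p i) (m i) (n i)}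

namespace TupleInput

theorem lift {μ' : κ → ℕ} {e' : κ → BTree} {π : κ → ι}
    (up : ∀ {g : ι → BTree}, PT μ e g → PT μ' e' fun q => g (π q)) (H : TupleInput μ e G D) :
    TupleInput μ' e' (fun q => G (π q)) fun q => D (π q) :=
  ⟨up H.hp, up H.hV, up H.hU, up H.hG, up H.Ls, up H.L, up H.Λ₀, up H.Cs₁, up H.Cs₂, up H.C₀⟩

variable [∀ i, Fact (p i).Prime]

theorem keyY (H : TupleInput μ e G D) {v : ∀ i, Vec (p i) (n i)}
    (hv : PT μ e fun i => encVec (v i)) :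
    PT μ e fun i => encList (((D i).keyY (G i) (v i)).map encZ) :=
  (flatMap (f := fun i x => (D i).Ls.map fun y => encZ (TensorIso.tri (G i) x (v i) y)) H.L
    fun up hx => map (f := fun q y => encZ (TensorIso.tri (G q.1) q.2.1 (v q.1) y)) (up H.Ls)
      fun up' hy => tri (up' (up H.hp)) (up' (up H.hG)) (up' hx) (up' (up hv)) hy).congr
    fun i => by simp [TupleData.keyY, List.map_flatMap, Function.comp_def]

theorem keyX (H : TupleInput μ e G D) {u : ∀ i, Vec (p i) (m i)}
    (hu : PT μ e fun i => encVec (u i)) :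
    PT μ e fun i => encList (((D i).keyX (G i) (u i)).map encZ) :=
  (flatMap (f := fun i x => (D i).Ls.map fun y => encZ (TensorIso.tri (G i) (u i) x y)) H.Ls
    fun up hx => map (f := fun q y => encZ (TensorIso.tri (G q.1) (u q.1) q.2.1 y)) (up H.Ls)
      fun up' hy => tri (up' (up H.hp)) (up' (up H.hG)) (up' (up hu)) (up' hx) hy).congr
    fun i => by simp [TupleData.keyX, List.map_flatMap, Function.comp_def]

theorem keyedY (H : TupleInput μ e G D) : PT μ e fun i => encList ((((D i).KX (G i)).map
    fun v => ((D i).keyY (G i) v, v)).map encKeyed) :=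
  (map (f := fun i v => encKeyed ((D i).keyY (G i) v, v)) H.KX fun up hv =>
    ((H.lift up).keyY hv).pair hv).congr fun i => by rw [List.map_map]; rfl

theorem keyedX (H : TupleInput μ e G D) : PT μ e fun i => encList ((((D i).KY (G i)).map
    fun u => ((D i).keyX (G i) u, u)).map encKeyed) :=
  (map (f := fun i u => encKeyed ((D i).keyX (G i) u, u)) H.KY fun up hu =>
    ((H.lift up).keyX hu).pair hu).congr fun i => by rw [List.map_map]; rfl

theorem _root_.TensorIso.TupleData.length_keyY {p m n : ℕ} (D : TupleData p m n)
    (G : Tensor p m n) (v : Vec p n) : (D.keyY G v).length = D.L.length * D.Ls.length := by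
  simp [TupleData.keyY, List.length_flatMap]

theorem _root_.TensorIso.TupleData.length_keyX {p m n : ℕ} (D : TupleData p m n)
    (G : Tensor p m n) (u : Vec p m) : (D.keyX G u).length = D.Ls.length * D.Ls.length := by
  simp [TupleData.keyX, List.length_flatMap]

theorem mainN (H : TupleInput μ e G D) :
    PT μ e fun i => encList (((D i).mainN (G i)).map encVec) :=
  mainRows H.hp H.hV H.keyedY (fun i v => (D i).length_keyY (G i) v) H.RX H.Cs

theorem mainM (H : TupleInput μ e G D) :
    PT μ e fun i => encList (((D i).mainM (G i)).map encVec) :=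
  mainRows H.hp H.hU H.keyedX (fun i v => (D i).length_keyX (G i) v) H.RY H.C

theorem rowsN (H : TupleInput μ e G D) :
    PT μ e fun i => encList (((D i).rowsN (G i)).map encVec) :=
  formatRows H.hp H.hV H.keyedY (fun i v => (D i).length_keyY (G i) v) H.RX H.Cs

theorem rowsM (H : TupleInput μ e G D) :
    PT μ e fun i => encList (((D i).rowsM (G i)).map encVec) :=
  formatRows H.hp H.hU H.keyedX (fun i v => (D i).length_keyX (G i) v) H.RY H.C

theorem _root_.TensorIso.ofFn_getD {α β : Type} {d : ℕ} {l : List α} (h : l.length = d)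
    (f : α → β) (a : α) : List.ofFn (fun i : Fin d => f (l.getD i a)) = l.map f := by
  subst h
  conv_rhs => rw [← List.ofFn_get l, List.map_ofFn]
  congr 1
  funext i
  rw [List.getD_eq_getElem _ _ i.2]
  rfl

theorem _root_.TensorIso.TupleData.encTensor_form {p m n : ℕ} [Fact p.Prime]
    (D : TupleData p m n) (G : Tensor p m n) : encTensor (D.form G).tensor =
      encList ((D.rowsM G).map fun u => encList ((D.rowsN G).map fun v =>
        encList ((D.rowsN G).map fun w => encZ (TensorIso.tri G u v w)))) := by
  rw [encTensor, ← ofFn_getD (D.length_rowsM G) _ 0]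
  congr 2
  funext i
  rw [← ofFn_getD (D.length_rowsN G) _ 0]
  congr 2
  funext j
  rw [← ofFn_getD (D.length_rowsN G) _ 0]
  rfl

theorem formTensor (H : TupleInput μ e G D) :
    PT μ e fun i => encTensor ((D i).form (G i)).tensor := by
  have key : ∀ {κ : Type} {π : κ → ι} {μ' : κ → ℕ} {e' : κ → BTree}
      {u : ∀ q, Vec (p (π q)) (m (π q))} {v : ∀ q, Vec (p (π q)) (n (π q))}
      (H' : TupleInput μ' e' (fun q => G (π q)) fun q => D (π q)),
      PT μ' e' (fun q => encVec (u q)) → PT μ' e' (fun q => encVec (v q)) →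
      PT μ' e' fun q => encList (((D (π q)).rowsN (G (π q))).map fun w =>
        encZ (TensorIso.tri (G (π q)) (u q) (v q) w)) := fun H' hu hv =>
    map (l := fun q => (D _).rowsN (G _)) (enc := fun _ => encVec)
      (f := fun q w => encZ (TensorIso.tri (G _) (_) (_) w)) H'.rowsN fun up hw =>
      tri (up H'.hp) (up H'.hG) (up hu) (up hv) hw
  have key' : ∀ {κ : Type} {π : κ → ι} {μ' : κ → ℕ} {e' : κ → BTree}
      {u : ∀ q, Vec (p (π q)) (m (π q))}
      (H' : TupleInput μ' e' (fun q => G (π q)) fun q => D (π q)),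
      PT μ' e' (fun q => encVec (u q)) →
      PT μ' e' fun q => encList (((D (π q)).rowsN (G (π q))).map fun v =>
        encList (((D (π q)).rowsN (G (π q))).map fun w =>
          encZ (TensorIso.tri (G (π q)) (u q) v w))) := fun {κ π μ' e' u} H' hu =>
    map (l := fun q => (D (π q)).rowsN (G (π q))) (enc := fun _ => encVec)
      (f := fun q v => encList (((D (π q)).rowsN (G (π q))).map fun w =>
          encZ (TensorIso.tri (G (π q)) (u q) v w))) H'.rowsN fun up hv =>
      key (π := fun q : Mem fun q => (D (π q)).rowsN (G (π q)) => π q.1) (TupleInput.lift (G := fun q => G (π q)) (D := fun q => D (π q))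
        (π := Sigma.fst) up H') (up hu) hv
  have h := map (l := fun i => (D i).rowsM (G i)) (enc := fun _ => encVec)
    (f := fun i u => encList (((D i).rowsN (G i)).map fun v =>
      encList (((D i).rowsN (G i)).map fun w => encZ (TensorIso.tri (G i) u v w)))) H.rowsM
    fun up hu => key' (H.lift up) hu
  exact h.congr fun i => (D i).encTensor_form (G i)

theorem form (H : TupleInput μ e G D) :
    PT μ e fun i => encParamTensor ((D i).form (G i)) := by
  have hX : ∀ {κ : Type} {π : κ → ι} {μ' : κ → ℕ} {e' : κ → BTree} {u : ∀ q, Vec (p (π q)) (m (π q))}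
      (H' : TupleInput μ' e' (fun q => G (π q)) fun q => D (π q)),
      PT μ' e' (fun q => encVec (u q)) →
      PT μ' e' fun q => bit (∀ c ∈ (D (π q)).keyX (G (π q)) (u q), c = 0) := fun H' hu =>
    all (H'.keyX hu) fun _ hc => eqZ hc zeroZ
  have hY : ∀ {κ : Type} {π : κ → ι} {μ' : κ → ℕ} {e' : κ → BTree} {u : ∀ q, Vec (p (π q)) (n (π q))}
      (H' : TupleInput μ' e' (fun q => G (π q)) fun q => D (π q)),
      PT μ' e' (fun q => encVec (u q)) →
      PT μ' e' fun q => bit (∀ c ∈ (D (π q)).keyY (G (π q)) (u q), c = 0) := fun H' hu =>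
    all (H'.keyY hu) fun _ hc => eqZ hc zeroZ
  have h1 := length (sel (p := fun i u => ∀ c ∈ (D i).keyX (G i) u, c = 0) H.mainM
    fun up hu => hX (H.lift up) hu)
  have h2 := length (sel (p := fun i u => ¬ ∀ c ∈ (D i).keyX (G i) u, c = 0) H.mainM
    fun up hu => (hX (H.lift up) hu).not)
  have h3 := length (sel (p := fun i u => ∀ c ∈ (D i).keyY (G i) u, c = 0) H.mainN
    fun up hu => hY (H.lift up) hu)
  have h4 := length (sel (p := fun i u => ¬ ∀ c ∈ (D i).keyY (G i) u, c = 0) H.mainN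
    fun up hu => (hY (H.lift up) hu).not)
  exact h1.pair (h2.pair (h3.pair (h4.pair (H.formTensor.pair nil))))

end TupleInput

end form

/-! ### Programs enumerating families and computing the size parameters -/

section enumeration

variable {ι : Type} {μ : ι → ℕ} {e : ι → BTree} {X Y : ι → Type} {l : ∀ i, List (X i)}
  {enc : ∀ i, X i → BTree} {l' : ∀ i, List (Y i)} {enc' : ∀ i, Y i → BTree}

theorem product (hl : PT μ e fun i => encList ((l i).map (enc i)))
    (hl' : PT μ e fun i => encList ((l' i).map (enc' i))) :
    PT μ e fun i => encList (((l i).product (l' i)).map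
      fun z => .node (enc i z.1) (enc' i z.2)) :=
  (flatMap (f := fun i x => (l' i).map fun y => BTree.node (enc i x) (enc' i y)) hl
    fun up hx => map (f := fun q y => BTree.node (enc q.1 q.2.1) (enc' q.1 y)) (up hl')
      fun up' hy => (up' hx).pair hy).congr fun i => by
        simp [List.product, List.map_flatMap, Function.comp_def]

/-- The additional `1` is needed for `a = 0`, where `0 ^ 0` exceeds the later powers. -/
theorem _root_.TensorIso.pow_le_pow_add_one {a j k : ℕ} (h : j ≤ k) : a ^ j ≤ a ^ k + 1 := by
  rcases Nat.eq_zero_or_pos a with rfl | ha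
  · rcases Nat.eq_zero_or_pos j with rfl | hj
    · simp
    · simp [hj.ne']
  · exact (Nat.pow_le_pow_right ha h).trans (Nat.le_succ _)

theorem families {k : ι → ℕ} (hl : PT μ e fun i => encList ((l i).map (enc i)))
    (hk : PT μ e fun i => encNat (k i)) (hs : PolyBdd μ fun i => (l i).length ^ k i) :
    PT μ e fun i => encList ((TensorIso.families (l i) (k i)).map
      fun f => encList ((List.ofFn f).map (enc i))) := by
  refine natRec (fun i j => encList ((TensorIso.families (l i) j).map
    fun f => encList ((List.ofFn f).map (enc i)))) hk ?_ ?_ fun up hst => ?_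
  · exact (nil.pair nil).congr fun i => by simp [TensorIso.families, encList]
  · refine (((hs.add (PolyBdd.const 1)).mul (((hk.poly_nat.mul (hl.1.add (PolyBdd.const 1))).add
      (PolyBdd.const 1)).add (PolyBdd.const 1))).add (PolyBdd.const 1)).reindex Sigma.fst
      |>.mono fun q => ?_
    refine (size_encList_le (c := k q.1 * ((encList ((l q.1).map (enc q.1))).size + 1) + 1)
      ?_).trans ?_
    · intro x hx
      obtain ⟨f, hf, rfl⟩ := List.mem_map.1 hx
      refine (size_encList_le (c := (encList ((l q.1).map (enc q.1))).size) ?_).trans ?_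
      · intro y hy
        obtain ⟨z, hz, rfl⟩ := List.mem_map.1 hy
        obtain ⟨i, rfl⟩ := List.mem_ofFn.1 hz
        exact size_le_size_encList (List.mem_map_of_mem (mem_families.1 hf i))
      · rw [List.length_map, List.length_ofFn]
        gcongr
        exact q.2.2.le
    · rw [List.length_map, length_families]
      gcongr
      exact pow_le_pow_add_one q.2.2.le
  · refine (flatMap (f := fun q x => (TensorIso.families (l q.1) q.2).map
      fun f => encList ((List.ofFn (Fin.cons x f : Fin (q.2 + 1) → X q.1)).map (enc q.1)))
      (up hl) fun up' hx => map (f := fun q f => encList ((List.ofFn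
        (Fin.cons q.2.1 f : Fin (q.1.2 + 1) → X q.1.1)).map (enc q.1.1)))
        (up' hst) fun up'' hf => ((up'' hx).pair hf).congr fun q => ?_).congr fun q => ?_
    · rw [List.ofFn_succ, List.map_cons]
      rfl
    · rw [TensorIso.families, List.map_flatMap]
      simp only [List.map_map]
      rfl

/-- The state pairs a counter with the list built so far. New elements are put in front, which
explains the descending order of the enumeration. -/
theorem elems {p : ι → ℕ} [∀ i, NeZero (p i)] (hp : PT μ e fun i => encNat (p i)) :
    PT μ e fun i => encList ((TensorIso.elems (p i)).map encZ) := by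
  refine ((natRec (fun i j => .node (encNat j) (encList (((List.range j).reverse.map
    (Nat.cast : ℕ → ZMod (p i))).map encZ))) hp (nil.pair nil) ?_ fun up hst => ?_).snd_of).congr
    fun i => rfl
  · refine (hp.1.add ((hp.poly_nat.mul (hp.1.add (PolyBdd.const 1))).add
      (PolyBdd.const 2))).reindex Sigma.fst |>.mono fun q => ?_
    have h1 := size_encList_le (c := (encNat (p q.1)).size)
      (l := ((List.range q.2).reverse.map (Nat.cast : ℕ → ZMod (p q.1))).map encZ) fun x hx => by
        obtain ⟨y, hy, rfl⟩ := List.mem_map.1 hx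
        rw [encZ, size_encNat, size_encNat]
        have := ZMod.val_lt y
        omega
    have h2 := q.2.2
    have h3 : (((List.range q.2).reverse.map (Nat.cast : ℕ → ZMod (p q.1))).map encZ).length ≤
        p q.1 := by simp
    have h4 := h1.trans (Nat.add_le_add_right (Nat.mul_le_mul_right _ h3) 1)
    simp only [BTree.size]
    have h5 : (encNat q.2).size ≤ (encNat (p q.1)).size := by
      rw [size_encNat, size_encNat]
      omega
    omega
  · refine (hst.fst_of.succ.pair (hst.fst_of.pair hst.snd_of)).congr fun q => ?_
    rw [List.range_succ, List.reverse_append, List.reverse_singleton, List.singleton_append,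
      List.map_cons, List.map_cons, encList, encZ, ZMod.val_natCast, Nat.mod_eq_of_lt q.2.2]

theorem climb {f : ι → ℕ → ℕ} {a m : ι → ℕ} (hm : PT μ e fun i => encNat (m i))
    (ha : PT μ e fun i => encNat (a i))
    (hf : (∀ {g : ι → BTree}, PT μ e g → PT (fun q : (i : ι) × Fin (a i) => μ q.1)
        (fun q => .node (.node .nil (encNat (TensorIso.climb (f q.1) (m q.1) q.2))) (e q.1))
          (fun q => g q.1)) →
      PT (fun q : (i : ι) × Fin (a i) => μ q.1)
        (fun q => .node (.node .nil (encNat (TensorIso.climb (f q.1) (m q.1) q.2))) (e q.1))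
        (fun q => encNat (TensorIso.climb (f q.1) (m q.1) q.2)) →
      PT (fun q : (i : ι) × Fin (a i) => μ q.1)
        (fun q => .node (.node .nil (encNat (TensorIso.climb (f q.1) (m q.1) q.2))) (e q.1))
        (fun q => encNat (f q.1 (TensorIso.climb (f q.1) (m q.1) q.2)))) :
    PT μ e fun i => encNat (TensorIso.climb (f i) (m i) (a i)) := by
  refine natRec (fun i j => encNat (TensorIso.climb (f i) (m i) j)) ha PT.nil ?_ fun up hst => ?_
  · refine (ha.1.reindex Sigma.fst).mono fun q => ?_
    have : ∀ j, TensorIso.climb (f q.1) (m q.1) j ≤ j := fun j => by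
      induction j with
      | zero => exact le_rfl
      | succ j ih =>
        rw [TensorIso.climb]
        split_ifs <;> omega
    have h1 := this q.2
    have h2 := q.2.2
    rw [size_encNat, size_encNat]
    omega
  · refine (ite ((hf up hst).lt (up hm)) hst.succ hst).congr fun q => ?_
    rw [TensorIso.climb]
    split_ifs <;> rfl

theorem root {n : ι → ℕ} (hn : PT μ e fun i => encNat (n i)) :
    PT μ e fun i => encNat (TensorIso.root (n i)) :=
  climb hn hn fun _ h => (h.mul h).mul (h.mul h)

theorem quot {m w : ι → ℕ} (hm : PT μ e fun i => encNat (m i))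
    (hw : PT μ e fun i => encNat (w i)) :
    PT μ e fun i => encNat (TensorIso.quot (m i) (w i)) :=
  climb hm hm fun up h => h.mul (up hw)

theorem sizeM {n : ι → ℕ} (hn : PT μ e fun i => encNat (n i)) :
    PT μ e fun i => encNat (TensorIso.sizeM (n i)) :=
  (constNat 20).mul (hn.root.mul (hn.root.mul hn.root))

theorem sizeN {m n : ι → ℕ} (hm : PT μ e fun i => encNat (m i))
    (hn : PT μ e fun i => encNat (n i)) :
    PT μ e fun i => encNat (TensorIso.sizeN (m i) (n i)) :=
  (constNat 20).mul ((hm.quot hn.root).add (hn.root.mul (hn.root.mul hn.root)))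

end enumeration

end PT

/-! ### The reduction -/

/-- The instances of the isometry problem for tensors. -/
structure IsoInput where
  p : ℕ
  n : ℕ
  m : ℕ
  prime : p.Prime
  two_lt : 2 < p
  n_pos : 0 < n
  m_pos : 0 < m
  G : Tensor p m n
  H : Tensor p m n
  skew_G : IsSkewTensor G
  skew_H : IsSkewTensor H

namespace IsoInput

instance (i : IsoInput) : Fact i.p.Prime := ⟨i.prime⟩

/-- The quantity that the running time of the reduction is polynomial in. -/
def cost (i : IsoInput) : ℕ := i.p ^ ((i.m + i.n) * (root i.n * (root i.n * root i.n)))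

/-- The input tree. -/
def tree (i : IsoInput) : BTree :=
  encList [encNat i.p, encNat i.n, encNat i.m, encTensor i.G, encTensor i.H]

theorem cube_pos (i : IsoInput) : 0 < root i.n * (root i.n * root i.n) := by
  have := root_pos i.n_pos
  positivity

theorem pow_le_cost (i : IsoInput) {a : ℕ} (c : ℕ)
    (h : a ≤ c * ((i.m + i.n) * (root i.n * (root i.n * root i.n)))) : i.p ^ a ≤ i.cost ^ c := by
  rw [cost, ← pow_mul, mul_comm _ c]
  exact Nat.pow_le_pow_right i.prime.pos h

theorem le_exponent (i : IsoInput) :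
    i.m + i.n ≤ (i.m + i.n) * (root i.n * (root i.n * root i.n)) :=
  Nat.le_mul_of_pos_right _ i.cube_pos

theorem p_le (i : IsoInput) : i.p ≤ i.cost := by
  have := i.pow_le_cost (a := 1) 1 (by
    have := i.le_exponent
    have := i.n_pos
    omega)
  simpa using this

theorem m_add_n_le (i : IsoInput) : i.m + i.n ≤ i.cost :=
  (Nat.lt_pow_self i.prime.one_lt).le.trans ((i.pow_le_cost 1 (by
    have := i.le_exponent
    omega)).trans_eq (pow_one _))

theorem poly_p : PolyBdd cost p := PolyBdd.self.mono p_le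

theorem poly_m : PolyBdd cost m := PolyBdd.self.mono fun i => by have := i.m_add_n_le; omega

theorem poly_n : PolyBdd cost n := PolyBdd.self.mono fun i => by have := i.m_add_n_le; omega

theorem _root_.TensorIso.size_encVec_le {p d : ℕ} [NeZero p] (v : Vec p d) :
    (encVec v).size ≤ d * (2 * p + 1 + 1) + 1 := by
  refine (size_encList_le (c := 2 * p + 1) fun x hx => ?_).trans ?_
  · obtain ⟨y, -, rfl⟩ := List.mem_map.1 hx
    rw [encZ, size_encNat]
    have := ZMod.val_lt y
    omega
  · rw [List.length_map, List.length_ofFn]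

theorem _root_.TensorIso.size_encTensor_le {p m n : ℕ} [NeZero p] (G : Tensor p m n) :
    (encTensor G).size ≤ m * (n * (n * (2 * p + 1 + 1) + 1 + 1) + 1 + 1) + 1 := by
  rw [encTensor_eq]
  refine (size_encList_le (c := n * (n * (2 * p + 1 + 1) + 1 + 1) + 1) fun x hx => ?_).trans ?_
  · obtain ⟨r, -, rfl⟩ := List.mem_map.1 hx
    refine (size_encList_le (c := n * (2 * p + 1 + 1) + 1) fun x hx => ?_).trans ?_
    · obtain ⟨v, -, rfl⟩ := List.mem_map.1 hx
      exact size_encVec_le v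
    · rw [List.length_map, List.length_ofFn]
  · rw [List.length_map, List.length_ofFn]

theorem poly_tensor {G : ∀ i : IsoInput, Tensor i.p i.m i.n} :
    PolyBdd cost fun i => (encTensor (G i)).size := by
  have h1 := (((PolyBdd.const 2).mul poly_p).add (PolyBdd.const 1)).add (PolyBdd.const 1)
  have h2 := ((poly_n.mul h1).add (PolyBdd.const 1)).add (PolyBdd.const 1)
  have h3 := ((poly_n.mul h2).add (PolyBdd.const 1)).add (PolyBdd.const 1)
  exact ((poly_m.mul h3).add (PolyBdd.const 1)).mono fun i => size_encTensor_le (G i)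

theorem poly_encNat {a : IsoInput → ℕ} (h : PolyBdd cost a) :
    PolyBdd cost fun i => (encNat (a i)).size :=
  (((PolyBdd.const 2).mul h).add (PolyBdd.const 1)).mono fun i => by rw [size_encNat]

theorem PT_tree : PT cost tree fun i => .node (encNat i.p) (.node (encNat i.n)
    (.node (encNat i.m) (.node (encTensor i.G) (.node (encTensor i.H) .nil)))) := by
  refine PT.refl (e := tree) ?_
  refine (((poly_encNat poly_p).add ((poly_encNat poly_n).add ((poly_encNat poly_m).add
    ((poly_tensor (G := G)).add (poly_tensor (G := H)))))).add (PolyBdd.const 6)).mono fun i => ?_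
  simp only [tree, encList, BTree.size]
  omega

theorem PT_p : PT cost tree fun i => encNat i.p := PT_tree.fst_of

theorem PT_n : PT cost tree fun i => encNat i.n := PT_tree.snd_of.fst_of

theorem PT_m : PT cost tree fun i => encNat i.m := PT_tree.snd_of.snd_of.fst_of

theorem PT_G : PT cost tree fun i => encTensor i.G := PT_tree.snd_of.snd_of.snd_of.fst_of

theorem PT_H : PT cost tree fun i => encTensor i.H := PT_tree.snd_of.snd_of.snd_of.snd_of.fst_of

theorem length_elems (p : ℕ) : (elems p).length = p := by simp [elems]

theorem length_vecs (p n : ℕ) : (vecs p n).length = p ^ n := by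
  rw [vecs, length_families, length_elems]

theorem PT_vecs {d : IsoInput → ℕ} (hd : PT cost tree fun i => encNat (d i))
    (h : ∀ i, d i ≤ i.m + i.n) : PT cost tree fun i => encList ((vecs i.p (d i)).map encVec) := by
  refine PT.families (PT.elems PT_p) hd (PolyBdd.self.mono fun i => ?_)
  rw [length_elems]
  exact (i.pow_le_cost 1 (by
    have := i.le_exponent
    have := h i
    omega)).trans_eq (pow_one _)

/-- This bound dictates the choice of the fourth root. From `n ≤ w⁴` and `(q - 1) w ≤ m` one gets `n
(q - 1) ≤ m w³`, so the list whose length depends on `m / w` costs no more than the lists of length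
`O(w³)`. -/
theorem n_mul_sizeN_le (i : IsoInput) :
    i.n * sizeN i.m i.n ≤ 60 * ((i.m + i.n) * (root i.n * (root i.n * root i.n))) := by
  have h0 := root_pos i.n_pos
  have h1 := le_root i.n
  have h2 : (quot i.m (root i.n) - 1) * root i.n ≤ i.m := by
    rcases Nat.eq_zero_or_pos (quot i.m (root i.n)) with h | h
    · simp [h]
    · exact (lt_of_lt_quot (Nat.sub_lt h one_pos)).le
  set w := root i.n
  set q := quot i.m w
  have h3 : i.n * (q - 1) ≤ i.m * (w * (w * w)) := calc
    i.n * (q - 1) ≤ w ^ 4 * (q - 1) := Nat.mul_le_mul_right _ h1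
    _ = (q - 1) * w * (w * (w * w)) := by ring
    _ ≤ i.m * (w * (w * w)) := Nat.mul_le_mul_right _ h2
  have h4 : i.n * q ≤ i.n * (q - 1) + i.n := by
    rw [← Nat.mul_succ]
    exact Nat.mul_le_mul_left _ (by omega)
  have h5 : i.m + i.n ≤ (i.m + i.n) * (w * (w * w)) := i.le_exponent
  have h6 : i.n * (w * (w * w)) ≤ (i.m + i.n) * (w * (w * w)) :=
    Nat.mul_le_mul_right _ (Nat.le_add_left _ _)
  have h7 : i.m * (w * (w * w)) ≤ (i.m + i.n) * (w * (w * w)) :=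
    Nat.mul_le_mul_right _ (Nat.le_add_right _ _)
  calc i.n * sizeN i.m i.n = 20 * (i.n * q + i.n * (w * (w * w))) := by rw [sizeN]; ring
    _ ≤ 60 * ((i.m + i.n) * (w * (w * w))) := by omega

theorem m_mul_sizeM_le (i : IsoInput) :
    i.m * sizeM i.n ≤ 20 * ((i.m + i.n) * (root i.n * (root i.n * root i.n))) :=
  calc i.m * sizeM i.n = 20 * (i.m * (root i.n * (root i.n * root i.n))) := by rw [sizeM]; ring
    _ ≤ _ := Nat.mul_le_mul_left _ (Nat.mul_le_mul_right _ (Nat.le_add_right _ _))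

theorem PT_familiesN : PT cost tree fun i =>
    encList ((families (vecs i.p i.n) (sizeN i.m i.n)).map fun f =>
      encList ((List.ofFn f).map encVec)) := by
  refine PT.families (PT_vecs PT_n fun i => Nat.le_add_left _ _) (PT_m.sizeN PT_n)
    ((PolyBdd.self.pow 60).mono fun i => ?_)
  rw [length_vecs, ← pow_mul]
  exact i.pow_le_cost 60 i.n_mul_sizeN_le

theorem PT_familiesM : PT cost tree fun i =>
    encList ((families (vecs i.p i.m) (sizeM i.n)).map fun f =>
      encList ((List.ofFn f).map encVec)) := by
  refine PT.families (PT_vecs PT_m fun i => Nat.le_add_right _ _) PT_n.sizeM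
    ((PolyBdd.self.pow 20).mono fun i => ?_)
  rw [length_vecs, ← pow_mul]
  exact i.pow_le_cost 20 i.m_mul_sizeM_le

end IsoInput

/-- The data in the form of functions. -/
abbrev TupleFun (p m n kn km : ℕ) : Type :=
  (Fin kn → Vec p n) × (Fin km → Vec p m) × (Fin kn → Vec p n) × (Fin kn → Vec p n) ×
    (Fin kn → Vec p n) × (Fin km → Vec p m)

section

variable {p m n kn km : ℕ}

/-- Data of prescribed sizes. -/
def TupleFun.data (t : TupleFun p m n kn km) : TupleData p m n :=
  ⟨List.ofFn t.1, List.ofFn t.2.1, List.ofFn t.2.2.1, List.ofFn t.2.2.2.1, List.ofFn t.2.2.2.2.1,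
    List.ofFn t.2.2.2.2.2⟩

theorem TupleFun.hasSize [Fact p.Prime] (t : TupleFun p m n kn km) : t.data.HasSize kn km := by
  constructor <;> exact List.length_ofFn

theorem TupleData.HasSize.exists_data [Fact p.Prime] {D : TupleData p m n} (h : D.HasSize kn km) :
    ∃ t : TupleFun p m n kn km, t.data = D := by
  have key : ∀ {d k : ℕ} {l : List (Vec p d)}, l.length = k →
      ∃ f : Fin k → Vec p d, List.ofFn f = l := by
    rintro d k l rfl
    exact ⟨_, List.ofFn_get l⟩
  obtain ⟨f₁, h₁⟩ := key h.Ls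
  obtain ⟨f₂, h₂⟩ := key h.L
  obtain ⟨f₃, h₃⟩ := key h.Λ₀
  obtain ⟨f₄, h₄⟩ := key h.Cs₁
  obtain ⟨f₅, h₅⟩ := key h.Cs₂
  obtain ⟨f₆, h₆⟩ := key h.C₀
  refine ⟨(f₁, f₂, f₃, f₄, f₅, f₆), ?_⟩
  cases D
  simp only [TupleFun.data, h₁, h₂, h₃, h₄, h₅, h₆]

/-- All data of prescribed sizes. -/
def tuples (p m n kn km : ℕ) : List (TupleFun p m n kn km) :=
  (families (vecs p n) kn).product ((families (vecs p m) km).product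
    ((families (vecs p n) kn).product ((families (vecs p n) kn).product
      ((families (vecs p n) kn).product (families (vecs p m) km)))))

theorem mem_tuples [Fact p.Prime] (t : TupleFun p m n kn km) : t ∈ tuples p m n kn km := by
  have h : ∀ {d k : ℕ} (f : Fin k → Vec p d), f ∈ families (vecs p d) k := fun f =>
    mem_families.2 fun _ => mem_vecs _
  exact List.mem_product.2 ⟨h _, List.mem_product.2 ⟨h _, List.mem_product.2 ⟨h _,
    List.mem_product.2 ⟨h _, List.mem_product.2 ⟨h _, h _⟩⟩⟩⟩⟩

end

namespace IsoInput

/-- All data for an instance. -/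
def allTuples (i : IsoInput) : List (TupleFun i.p i.m i.n (sizeN i.m i.n) (sizeM i.n)) :=
  tuples i.p i.m i.n (sizeN i.m i.n) (sizeM i.n)

theorem PT_forms {S : ∀ i : IsoInput, Tensor i.p i.m i.n}
    (hS : PT cost tree fun i => encTensor (S i)) :
    PT cost tree fun i => encList (i.allTuples.map fun t =>
      encParamTensor (t.data.form (S i))) := by
  have h := PT_familiesN.product (PT_familiesM.product (PT_familiesN.product
    (PT_familiesN.product (PT_familiesN.product PT_familiesM))))
  refine PT.map (f := fun i t => encParamTensor (TupleData.form (TupleFun.data t) (S i))) h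
    fun up ht => ?_
  refine PT.TupleInput.form (G := fun q : PT.Mem allTuples => S q.1)
    (D := fun q => TupleFun.data q.2.1) ?_
  exact ⟨up PT_p, up (PT_vecs PT_n fun i => Nat.le_add_left _ _),
    up (PT_vecs PT_m fun i => Nat.le_add_right _ _), up hS, ht.fst_of, ht.snd_of.fst_of,
    ht.snd_of.snd_of.fst_of, ht.snd_of.snd_of.snd_of.fst_of, ht.snd_of.snd_of.snd_of.snd_of.fst_of,
    ht.snd_of.snd_of.snd_of.snd_of.snd_of⟩

/-- The tree of an instance of the isometry problem for semi-canonical forms. -/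
noncomputable def queryTree (i : IsoInput)
    (z : TupleFun i.p i.m i.n (sizeN i.m i.n) (sizeM i.n) ×
      TupleFun i.p i.m i.n (sizeN i.m i.n) (sizeM i.n)) : BTree :=
  encList [encNat i.p, encNat i.n, encNat i.m, encParamTensor (z.1.data.form i.G),
    encParamTensor (z.2.data.form i.H)]

theorem PT_queries : PT cost tree fun i =>
    encList ((i.allTuples.product i.allTuples).map i.queryTree) :=
  PT.map (f := fun i z => queryTree i z) ((PT_forms PT_G).product (PT_forms PT_H)) fun up hz =>
    (up PT_p).pair ((up PT_n).pair ((up PT_m).pair (hz.fst_of.pair (hz.snd_of.pair PT.nil))))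

end IsoInput

/-! ### Exhaustive search with the given procedure, and the time bound -/

theorem Runs.one_le {P : Prog} {x y : BTree} {t : ℕ} (h : Runs P x y t) : 1 ≤ t := by
  cases h <;> omega

open Classical in
/-- Running a decision program on all members of a list. -/
theorem exists_any (A : Prog) : ∃ B : Prog, ∀ {α : Type} (l : List α) (enc : α → BTree)
    (q : α → Prop) (T : ℕ),
    (∀ a ∈ l, ∃ y t, Runs A (enc a) y t ∧ t ≤ T ∧ (y ≠ .nil ↔ q a)) →
    ∃ t ≤ (l.length + 1) * (T + 30), Runs B (encList (l.map enc)) (bit (∃ a ∈ l, q a)) t := by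
  let step : Prog := .pair (.ite (.comp A (.comp .fst .snd)) (.pair .nil .nil) .fst)
    (.comp .snd .snd)
  refine ⟨.comp .fst (.comp (.loop .snd step) (.pair .nil .id)), fun {α} l enc q T h => ?_⟩
  -- The loop state is a flag, telling whether some earlier member was accepted, paired with the
  -- members still to be tested. The search does not stop early, so the bound is length times cost
  -- per member.
  obtain ⟨t, ht, hr⟩ := Runs.loop_iterate (c := .snd) (P := step) (N := l.length) (tc := 1)
    (tp := T + 20)
    (fun j => .node (bit (∃ a ∈ l.take j, q a)) (encList ((l.drop j).map enc)))
    (fun j hj => by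
      simp only [List.drop_eq_getElem_cons hj, List.map_cons, encList]
      exact ⟨_, _, _, le_rfl, Runs.snd_node _ _⟩)
    (fun j hj => by
      obtain ⟨y, t, hr, ht, hy⟩ := h l[j] (List.getElem_mem hj)
      have e : (∃ a ∈ l.take (j + 1), q a) ↔ (∃ a ∈ l.take j, q a) ∨ q l[j] := by
        rw [List.take_add_one, List.getElem?_eq_getElem hj]
        simp only [Option.toList_some, List.mem_append, List.mem_singleton, or_and_right,
          exists_or, exists_eq_left]
      simp only [List.drop_eq_getElem_cons hj, List.map_cons, encList, e]
      have hsnd := Runs.comp (Runs.snd_node (bit (∃ a ∈ l.take j, q a))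
        (.node (enc l[j]) (encList ((l.drop (j + 1)).map enc)))) (Runs.snd_node _ _)
      have hfst := Runs.comp (Runs.comp (Runs.snd_node (bit (∃ a ∈ l.take j, q a))
        (.node (enc l[j]) (encList ((l.drop (j + 1)).map enc)))) (Runs.fst_node _ _)) hr
      by_cases hq : q l[j]
      · have hy' := hy.2 hq
        cases y with
        | nil => exact absurd rfl hy'
        | node a b =>
          refine ⟨_, ?_, Runs.pair (Runs.ite_true (t := 3) hfst ?_) hsnd⟩
          · omega
          · have h1 : bit ((∃ a ∈ l.take j, q a) ∨ q l[j]) = .node .nil .nil :=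
              if_pos (Or.inr hq)
            rw [h1]
            exact Runs.pair (Runs.nil _) (Runs.nil _)
      · have hy' : y = .nil := by_contra fun h => hq (hy.1 h)
        subst hy'
        refine ⟨_, ?_, Runs.pair (Runs.ite_false (t := 1) hfst ?_) hsnd⟩
        · omega
        · simp only [hq, or_false]
          exact Runs.fst_node _ _)
    (by
      simp only [List.drop_length, List.map_nil, encList]
      exact ⟨_, le_rfl, Runs.snd_node _ _⟩)
  simp only [List.take_length, List.take_zero, List.drop_zero, List.drop_length] at hr
  have h0 : bit (∃ a ∈ ([] : List α), q a) = .nil := by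
    rw [bit, if_neg]
    simp
  rw [h0] at hr
  refine ⟨_, ?_, Runs.comp (Runs.comp (Runs.pair (Runs.nil _) (Runs.id _)) hr)
    (Runs.fst_node _ _)⟩
  have : (l.length + 1) * (T + 30) = l.length * (1 + (T + 20) + 1) + l.length * 8 + T + 30 := by ring
  omega

theorem bit_ne_nil {q : Prop} : bit q ≠ .nil ↔ q := by
  by_cases h : q <;> simp [bit, h]

/-- Rounding up at most doubles: for `w ≥ 2` one has `w ≤ 2 (w - 1)` and `(w - 1)⁴ < n`, hence `w⁴ ≤
16 n`. The resulting exponent `3/4` is even below `0.8`. -/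
theorem root_cube_le {n : ℕ} (h : 0 < n) : ((root n : ℝ)) ^ 3 ≤ 8 * (n : ℝ) ^ (0.8 : ℝ) := by
  have h0 := root_pos h
  have h1 : root n ^ 4 ≤ 16 * n := by
    rcases Nat.eq_or_lt_of_le h0 with h1 | h1
    · have h2 : root n = 1 := h1.symm
      rw [h2]
      omega
    · have h2 : root n ≤ 2 * (root n - 1) := by omega
      have h3 := lt_of_lt_root (n := n) (j := root n - 1) (by omega)
      calc root n ^ 4 ≤ (2 * (root n - 1)) ^ 4 := Nat.pow_le_pow_left h2 4
        _ = 16 * (root n - 1) ^ 4 := by ring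
        _ ≤ 16 * n := by omega
  have h2 : ((root n : ℝ)) ^ 4 ≤ 16 * n := by exact_mod_cast h1
  have h3 : (0 : ℝ) ≤ root n := Nat.cast_nonneg _
  have h4 : (1 : ℝ) ≤ n := by exact_mod_cast h
  calc ((root n : ℝ)) ^ 3 = (((root n : ℝ)) ^ 4) ^ (3 / 4 : ℝ) := by
        rw [← Real.rpow_natCast, ← Real.rpow_natCast, ← Real.rpow_mul h3]
        norm_num
    _ ≤ (16 * n : ℝ) ^ (3 / 4 : ℝ) := Real.rpow_le_rpow (by positivity) h2 (by norm_num)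
    _ = 8 * (n : ℝ) ^ (3 / 4 : ℝ) := by
        rw [Real.mul_rpow (by norm_num) (by positivity)]
        congr 1
        rw [show (16 : ℝ) = 2 ^ (4 : ℝ) by norm_num, ← Real.rpow_mul (by norm_num)]
        norm_num
    _ ≤ 8 * (n : ℝ) ^ (0.8 : ℝ) := by
        gcongr
        norm_num

namespace IsoInput

theorem cost_add_two_le (i : IsoInput) : i.cost + 2 ≤ i.cost ^ 2 := by
  have h1 : 3 ≤ i.cost := i.two_lt.trans_le i.p_le
  nlinarith

/-- The factor `16` is `2 * 8`: squaring `cost` absorbs the summand `2`, and `root_cube_le`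
contributes `8`. The logarithm is at least `1` and is not needed otherwise. -/
theorem cost_pow_le (i : IsoInput) (k : ℕ) : ((i.cost : ℝ) + 2) ^ k ≤
    (i.p : ℝ) ^ ((16 * k : ℝ) * ((i.m : ℝ) + i.n) * (i.n : ℝ) ^ (0.8 : ℝ) * Real.logb 2 i.p) := by
  have hp : (2 : ℝ) ≤ i.p := by exact_mod_cast i.prime.two_le
  have h1 : ((i.cost : ℝ) + 2) ^ k ≤ ((i.cost : ℝ) ^ 2) ^ k :=
    pow_le_pow_left₀ (by positivity) (by exact_mod_cast i.cost_add_two_le) k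
  have h2 : ((i.cost : ℝ) ^ 2) ^ k =
      (i.p : ℝ) ^ ((2 * k : ℝ) * ((i.m : ℝ) + i.n) * (root i.n : ℝ) ^ 3) := by
    rw [cost, ← pow_mul, Nat.cast_pow, ← pow_mul, ← Real.rpow_natCast]
    congr 1
    push_cast
    ring
  have h3 : 1 ≤ Real.logb 2 i.p := by
    rw [Real.le_logb_iff_rpow_le (by norm_num) (by linarith), Real.rpow_one]
    exact hp
  refine h1.trans (h2.trans_le (Real.rpow_le_rpow_of_exponent_le (by linarith) ?_))
  calc (2 * k : ℝ) * ((i.m : ℝ) + i.n) * (root i.n : ℝ) ^ 3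
      ≤ (2 * k : ℝ) * ((i.m : ℝ) + i.n) * (8 * (i.n : ℝ) ^ (0.8 : ℝ)) := by
        gcongr
        exact root_cube_le i.n_pos
    _ = (16 * k : ℝ) * ((i.m : ℝ) + i.n) * (i.n : ℝ) ^ (0.8 : ℝ) * 1 := by ring
    _ ≤ _ := by gcongr

theorem isometric_iff (i : IsoInput) : IsometricTensors i.G i.H ↔
    ∃ z ∈ i.allTuples.product i.allTuples,
      IsometricSemiForms (z.1.data.form i.G) (z.2.data.form i.H) := by
  rw [isometricTensors_iff i.n_pos i.skew_G]
  constructor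
  · rintro ⟨D, D', hD, hD', h⟩
    obtain ⟨t, rfl⟩ := hD.exists_data
    obtain ⟨t', rfl⟩ := hD'.exists_data
    exact ⟨(t, t'), List.mem_product.2 ⟨mem_tuples t, mem_tuples t'⟩, h⟩
  · rintro ⟨z, -, h⟩
    exact ⟨_, _, z.1.hasSize, z.2.hasSize, h⟩

theorem answers {A : Prog} {T : ℕ → ℕ → ℕ → ℝ} (hA : DecidesSemiFormIsometry A T) (i : IsoInput)
    (z : TupleFun i.p i.m i.n (sizeN i.m i.n) (sizeM i.n) ×
      TupleFun i.p i.m i.n (sizeN i.m i.n) (sizeM i.n)) :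
    AnswersWithin A (i.queryTree z)
      (IsometricSemiForms (z.1.data.form i.G) (z.2.data.form i.H)) (T i.p i.n i.m) :=
  hA i.p i.n i.m i.prime i.two_lt i.n_pos i.m_pos _ _
    (z.1.hasSize.isSemiForm i.n_pos i.skew_G) (z.2.hasSize.isSemiForm i.n_pos i.skew_H)

/-- Every run takes a step, and even the all-zero data give a legitimate query. The bound allows
additive terms to be absorbed into a multiple of `T`. -/
theorem one_le {A : Prog} {T : ℕ → ℕ → ℕ → ℝ} (hA : DecidesSemiFormIsometry A T) (i : IsoInput) :
    1 ≤ T i.p i.n i.m := by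
  obtain ⟨y, t, hr, ht, -⟩ := answers hA i ⟨0, 0⟩
  exact le_trans (by exact_mod_cast hr.one_le) ht

end IsoInput

/-- A decision procedure for semi-canonical forms gives one for tensors. -/
theorem exists_decidesTensorIsometry :
    ∃ (c : ℝ) (k : ℕ), ∀ (T : ℕ → ℕ → ℕ → ℝ) (A : Prog), DecidesSemiFormIsometry A T →
      ∃ B : Prog, DecidesTensorIsometry B (fun p n m =>
        (p : ℝ) ^ (c * ((m : ℝ) + n) * (n : ℝ) ^ (0.8 : ℝ) * Real.logb 2 p) *
          T p n m * ((p : ℝ) + n + m) ^ k) := by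
  obtain ⟨k', hk'⟩ := IsoInput.PT_queries.poly_length
  obtain ⟨-, Q, k, hk⟩ := IsoInput.PT_queries
  -- The polynomial factor gets exponent `0`, since `p`, `n` and `m` are bounded by `cost`. The
  -- summands `k` and `k'` pay for building the queries and for their number; the `6` pays for the
  -- constant `1 + 62 + 1 = 2 ^ 6` of the final estimate, as the base is at least `2`.
  refine ⟨16 * ((k + k' + 6 : ℕ) : ℝ), 0, fun T A hA => ?_⟩
  obtain ⟨B, hB⟩ := exists_any A
  refine ⟨.comp B Q, fun p n m hp hp2 hn hm G H hG hH => ?_⟩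
  let i : IsoInput := ⟨p, n, m, hp, hp2, hn, hm, G, H, hG, hH⟩
  obtain ⟨t, ht, hr⟩ := hk i
  obtain ⟨t', ht', hr'⟩ := hB (i.allTuples.product i.allTuples) i.queryTree
    (fun z => IsometricSemiForms (z.1.data.form i.G) (z.2.data.form i.H)) ⌊T p n m⌋₊
    (fun z _ => by
      obtain ⟨y, s, h1, h2, h3⟩ := IsoInput.answers hA i z
      exact ⟨y, s, h1, Nat.le_floor h2, h3⟩)
  refine ⟨_, _, Runs.comp hr hr', ?_, bit_ne_nil.trans i.isometric_iff.symm⟩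
  have hT : 1 ≤ T p n m := IsoInput.one_le hA i
  have hlen := hk' i
  have hfl : ((⌊T p n m⌋₊ : ℕ) : ℝ) ≤ T p n m := Nat.floor_le (by linarith)
  have e1 : (t : ℝ) ≤ ((i.cost : ℝ) + 2) ^ k := by exact_mod_cast ht
  have e2 : (((i.allTuples.product i.allTuples).length : ℕ) : ℝ) ≤ ((i.cost : ℝ) + 2) ^ k' := by
    exact_mod_cast hlen
  have e3 : (t' : ℝ) ≤ ((((i.allTuples.product i.allTuples).length : ℕ) : ℝ) + 1) *
      ((⌊T p n m⌋₊ : ℝ) + 30) := by exact_mod_cast ht'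
  have hbase : (2 : ℝ) ≤ (i.cost : ℝ) + 2 := by
    have : (0 : ℝ) ≤ i.cost := Nat.cast_nonneg _
    linarith
  beta_reduce
  rw [pow_zero, mul_one]
  refine le_trans ?_ (mul_le_mul_of_nonneg_right (i.cost_pow_le (k + k' + 6)) (by linarith))
  set b := (i.cost : ℝ) + 2
  have hb1 : (1 : ℝ) ≤ b := by linarith
  have h1 : (1 : ℝ) ≤ b ^ k := one_le_pow₀ hb1
  have h2 : (1 : ℝ) ≤ b ^ k' := one_le_pow₀ hb1
  have h6 : (64 : ℝ) ≤ b ^ 6 := by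
    calc (64 : ℝ) = 2 ^ 6 := by norm_num
      _ ≤ b ^ 6 := pow_le_pow_left₀ (by norm_num) hbase 6
  have h3 : (t' : ℝ) ≤ 62 * b ^ k' * T p n m := by
    refine e3.trans ?_
    calc _ ≤ (2 * b ^ k') * (31 * T p n m) := by
          apply mul_le_mul <;> first | positivity | linarith
      _ = 62 * b ^ k' * T p n m := by ring
  have h4 : b ^ k ≤ b ^ k * b ^ k' * T p n m := by
    have := mul_le_mul (le_refl (b ^ k)) (mul_le_mul h2 hT zero_le_one (by positivity))
      (by norm_num) (by positivity)
    linarith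
  have h5 : b ^ k' * T p n m ≤ b ^ k * b ^ k' * T p n m := by
    have := mul_le_mul_of_nonneg_right h1 (show 0 ≤ b ^ k' * T p n m by positivity)
    linarith
  have h7 : 64 * (b ^ k * b ^ k' * T p n m) ≤ b ^ 6 * (b ^ k * b ^ k' * T p n m) :=
    mul_le_mul_of_nonneg_right h6 (by positivity)
  have h8 : b ^ (k + k' + 6) * T p n m = b ^ 6 * (b ^ k * b ^ k' * T p n m) := by
    rw [pow_add, pow_add]
    ring
  rw [h8]
  push_cast
  linarith

end TensorIso

theorem mainTheorem5 :
    ∃ (c : ℝ) (k : ℕ), ∀ (T : ℕ → ℕ → ℕ → ℝ) (A : TensorIso.Prog),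
      TensorIso.DecidesSemiFormIsometry A T →
        ∃ B : TensorIso.Prog,
          TensorIso.DecidesTensorIsometry B (fun p n m =>
            (p : ℝ) ^ (c * ((m : ℝ) + n) * (n : ℝ) ^ (0.8 : ℝ) * Real.logb 2 p) *
              T p n m * ((p : ℝ) + n + m) ^ k) :=
  TensorIso.exists_decidesTensorIsometry
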